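/- **Setting.** Let $N$ be a lattice of rank $r$ with a skew-symmetric bilinear form $\{\cdot,\cdot\}\colon N\times N\to\mathbb{Q}$, let $N^\circ\subset N$ be a sublattice of rank $r$ with $\{N^\circ,N\}\subset\mathbb{Z}$, and let $\delta_1,\dots,\delta_r$ be positive integers. Let $\mathfrak{s}=(e_1,\dots,e_r)$ be a seed: a basis of $N$ such that $(\delta_1e_1,\dots,\delta_re_r)$ is a basis of $N^\circ$. Put $\delta_0=\mathrm{lcm}(\delta_1,\dots,\delta_r)$, $N^+=\{\sum a_ie_i\mid a_i\in\mathbb{Z}_{\ge0}\}\setminus\{0\}$, $\deg(\sum a_ie_i)=\sum a_i$, and $M_{\mathbb{R}}=\mathrm{Hom}(N,\mathbb{R})$. For $n\in N^+$ let $\delta(n)$ be the smallest positive rational number with $\delta(n)n\in N^\circ$, and let $n^\perp=\{z\in M_{\mathbb R}\mid\langle n,z\rangle=0\}$. Let $K=\mathbb{Q}(q^{1/\delta_0})$ and $[\alpha]_q=(q^\alpha-q^{-\alpha})/(q-q^{-1})$ for $\alpha\in(1/\delta_0)\mathbb{Z}$. Let $\widehat{\mathfrak g}$ be the completion with respect to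 $\deg$ of the Lie algebra $\bigoplus_{n\in N^+}KX_n$ with $[X_n,X_{n'}]=[\{n,n'\}]_qX_{n+n'}$, and let $G=\exp(\widehat{\mathfrak g})$, with the product given by the Baker–Campbell–Hausdorff formula and the powers $\exp(X)^c=\exp(cX)$ for $c\in K$. Let $G^{>\ell}$ be the normal subgroup of all $\exp(\sum_{\deg n>\ell}c_nX_n)$. For primitive $n\in N^+$ let $G_n^{\parallel}$ be the subgroup of all $\exp(\sum_{j\ge1}c_jX_{jn})$. For $n\in N^+$, $a\in(1/\delta_0)\mathbb{Z}_{>0}$ and $b\in(1/\delta_0)\mathbb{Z}$ put $$\Psi_{a,b}[n]=\exp\Bigl(\sum_{j\ge1}\frac{(-1)^{j+1}}{j\,[ja]_q}\,q^{jb}X_{jn}\Bigr)\in G,\qquad \Psi_a[n]=\Psi_{a,0}[n].$$ A *wall* $(\mathfrak d,g)_n$ consists of a primitive $n\in N^+$, a convex rational polyhedral cone $\mathfrak d\subset n^\perp$ of dimension $r-1$, and a wall element $g\in G_n^{\parallel}$; it is *incoming* if $\{\cdot,n\}\in\mathfrak d$. A *scattering diagram* $\mathfrak D=\{(\mathfrak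 d_\lambda,g_\lambda)_{n_\lambda}\}_{\lambda\in\Lambda}$ is a collection of walls such that for every $\ell$ only finitely many $g_\lambda$ lie outside $G^{>\ell}$. Put $\mathrm{Supp}(\mathfrak D)=\bigcup_\lambda\mathfrak d_\lambda$, and let $\mathrm{Sing}(\mathfrak D)$ be the union of all relative boundaries $\partial\mathfrak d_\lambda$ and of all intersections $\mathfrak d_\lambda\cap\mathfrak d_{\lambda'}$ of dimension $r-2$. A smooth curve $\gamma\colon[0,1]\to M_{\mathbb R}$ is *admissible* for $\mathfrak D$ if its end points are not in $\mathrm{Supp}(\mathfrak D)$, it crosses all walls transversally, and it does not meet $\mathrm{Sing}(\mathfrak D)$. Its *path-ordered product* $\mathfrak p_{\gamma,\mathfrak D}\in G$ is the (possibly infinite) product of the $g_\lambda^{\epsilon_\lambda}$ over all crossings of walls by $\gamma$, later crossings to the left of earlier ones, where $\epsilon_\lambda=1$ if $\langle n_\lambda,\gamma'\rangle<0$ and $\epsilon_\lambda=-1$ if $\langle n_\lambda,\gamma'\rangle>0$; it is finite modulo every $G^{>\ell}$. Two scattering diagrams are *equivalent* if they have the same path-ordered product along every curve that is admissible for both. A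 scattering diagram is *consistent* if $\mathfrak p_{\gamma,\mathfrak D}=1$ for every admissible closed curve $\gamma$. A *quantum cluster scattering diagram* (QCSD) for $\mathfrak s$ is a consistent scattering diagram whose incoming walls are exactly $(e_i^\perp,\Psi_{1/\delta_i}[e_i])_{e_i}$, $i=1,\dots,r$, each occurring once. **Proposition.** Every QCSD for $\mathfrak s$ is equivalent to a consistent scattering diagram all of whose wall elements have the form $$\Psi_{1/\delta(n),b}[n]^{c}\qquad(n\in N^+,\ b\in(1/\delta_0)\mathbb{Z},\ c\in\mathbb{Z}).$$ -/

import Mathlib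

open scoped ContDiff

noncomputable section

namespace QCSD

/-! ### Fixed data and seeds -/

/-- Fixed data: a lattice `N` of rank `r` with a skew-symmetric `ℚ`-valued form, a sublattice `N°`
of rank `r` with `{N°, N} ⊆ ℤ`, and positive integers `δ i` such that some basis `e` of `N` makes
`δ i • e i` a basis of `N°`. -/
structure FixedData (r : ℕ) (N : Type*) [AddCommGroup N] where
  form : N →+ N →+ ℚ
  form_skew : ∀ n n', form n n' = -form n' n
  Ncirc : AddSubgroup N
  form_int : ∀ n ∈ Ncirc, ∀ n', ∃ k : ℤ, form n n' = k
  δ : Fin r → ℕ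
  δ_pos : ∀ i, 0 < δ i
  exists_basis : ∃ e : Module.Basis (Fin r) ℤ N,
    Ncirc = AddSubgroup.closure (Set.range fun i => δ i • e i)

/-- A seed: a basis `e` of `N` such that `δ i • e i` is a basis of `N°` (linear independence
is automatic). -/
structure Seed {r : ℕ} {N : Type*} [AddCommGroup N] (Γ : FixedData r N) where
  e : Module.Basis (Fin r) ℤ N
  Ncirc_eq : Γ.Ncirc = AddSubgroup.closure (Set.range fun i => Γ.δ i • e i)

/-- `δ₀`, the least common multiple of the `δ i`. -/
def FixedData.δ₀ {r : ℕ} {N : Type*} [AddCommGroup N] (Γ : FixedData r N) : ℕ :=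
  Finset.univ.lcm Γ.δ

lemma FixedData.δ₀_pos {r : ℕ} {N : Type*} [AddCommGroup N] (Γ : FixedData r N) : 0 < Γ.δ₀ := by
  refine Nat.pos_of_ne_zero fun h => ?_
  obtain ⟨i, -, hi⟩ := Finset.lcm_eq_zero_iff.1 h
  exact (Γ.δ_pos i).ne' hi

/-- The exponent vector `a` stands for the element `∑ i, a i • e i` of `N⁺ ⊔ {0}`. -/
abbrev Expo (r : ℕ) := Fin r →₀ ℕ

/-- The (index set of the) positive vectors `N⁺`: exponent vectors different from `0`. -/
abbrev NPlus (r : ℕ) := {a : Expo r // a ≠ 0}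

/-- `deg (∑ a i • e i) = ∑ a i`. -/
def deg {r : ℕ} (a : Expo r) : ℕ := ∑ i, a i

/-- Primitive elements of `N⁺`. -/
def IsPrimitive {r : ℕ} (n : NPlus r) : Prop :=
  ∀ (k : ℕ) (b : Expo r), n.1 = k • b → k = 1

lemma deg_add {r : ℕ} (a b : Expo r) : deg (a + b) = deg a + deg b := by
  simp [deg, Finset.sum_add_distrib]

lemma deg_pos {r : ℕ} {a : Expo r} (h : a ≠ 0) : 0 < deg a := by
  refine Nat.pos_of_ne_zero fun h0 => h ?_
  ext i
  exact (Finset.sum_eq_zero_iff.1 h0) i (Finset.mem_univ i)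

variable {r : ℕ} {N : Type*} [AddCommGroup N] {Γ : FixedData r N}

/-- The element `∑ i, a i • e i` of `N`. -/
def Seed.vec (𝔰 : Seed Γ) (a : Expo r) : N := ∑ i, a i • 𝔰.e i

lemma Seed.vec_add (𝔰 : Seed Γ) (a b : Expo r) : 𝔰.vec (a + b) = 𝔰.vec a + 𝔰.vec b := by
  simp [Seed.vec, add_smul, Finset.sum_add_distrib]

/-- The form `{∑ a i • e i, ∑ b i • e i}`. -/
def Seed.form (𝔰 : Seed Γ) (a b : Expo r) : ℚ := Γ.form (𝔰.vec a) (𝔰.vec b)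

/-- `d` is the normalization factor `δ(n)`: the smallest positive rational number with
`d n ∈ N°`; for `d = p / s`, the condition `d n ∈ N°` says that `p n = s m` with `m ∈ N°`. -/
def Seed.IsNormalizationFactor (𝔰 : Seed Γ) (n : NPlus r) (d : ℚ) : Prop :=
  IsLeast {d : ℚ | 0 < d ∧ ∃ m ∈ Γ.Ncirc, d.num • 𝔰.vec n.1 = (d.den : ℤ) • m} d

lemma Seed.δ₀_vec_mem (𝔰 : Seed Γ) (a : Expo r) : Γ.δ₀ • 𝔰.vec a ∈ Γ.Ncirc := by
  rw [Seed.vec, Finset.smul_sum]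
  refine AddSubgroup.sum_mem _ fun i _ => ?_
  obtain ⟨k, hk⟩ : Γ.δ i ∣ Γ.δ₀ := Finset.dvd_lcm (Finset.mem_univ i)
  have h : Γ.δ i • 𝔰.e i ∈ Γ.Ncirc := by
    rw [𝔰.Ncirc_eq]
    exact AddSubgroup.subset_closure ⟨i, rfl⟩
  have h2 : Γ.δ₀ • a i • 𝔰.e i = (k * a i) • Γ.δ i • 𝔰.e i := by
    rw [hk]
    simp only [smul_smul]
    congr 1
    ring
  rw [h2]
  exact AddSubgroup.nsmul_mem _ h _

/-- The form takes values in `(1/δ₀)ℤ`. -/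
lemma Seed.form_int (𝔰 : Seed Γ) (a b : Expo r) : ∃ k : ℤ, (Γ.δ₀ : ℚ) * 𝔰.form a b = k := by
  obtain ⟨k, hk⟩ := Γ.form_int _ (𝔰.δ₀_vec_mem a) (𝔰.vec b)
  refine ⟨k, ?_⟩
  rw [← hk, map_nsmul, Seed.form]
  simp

/-! ### The ground field `ℚ(q^{1/δ₀})` -/

/-- The field `ℚ(q^{1/δ₀})`; the variable of `RatFunc ℚ` is `q^{1/δ₀}`. -/
abbrev K := RatFunc ℚ

/-- `q^α`, for `α ∈ (1/δ₀)ℤ` (only such `α` are used). -/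
def FixedData.qpow (Γ : FixedData r N) (α : ℚ) : K := RatFunc.X ^ ⌊(Γ.δ₀ : ℚ) * α⌋

/-- The `q`-number `[α]_q = (q^α - q^{-α}) / (q - q⁻¹)`, for `α ∈ (1/δ₀)ℤ`. -/
def FixedData.qnum (Γ : FixedData r N) (α : ℚ) : K :=
  (Γ.qpow α - Γ.qpow (-α)) / (Γ.qpow 1 - Γ.qpow (-1))

lemma FixedData.qpow_add (Γ : FixedData r N) {α β : ℚ} (hα : ∃ k : ℤ, (Γ.δ₀ : ℚ) * α = k) :
    Γ.qpow (α + β) = Γ.qpow α * Γ.qpow β := by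
  obtain ⟨k, hk⟩ := hα
  rw [FixedData.qpow, FixedData.qpow, FixedData.qpow, ← zpow_add₀ RatFunc.X_ne_zero, mul_add, hk,
    Int.floor_intCast_add, Int.floor_intCast]

lemma FixedData.qpow_zero (Γ : FixedData r N) : Γ.qpow 0 = 1 := by simp [FixedData.qpow]

lemma FixedData.qpow_one_sub_ne_zero (Γ : FixedData r N) : Γ.qpow 1 - Γ.qpow (-1) ≠ 0 := by
  intro h
  have h1 : Γ.qpow 1 = Γ.qpow (-1) := sub_eq_zero.1 h
  have h2 : Γ.qpow 1 * Γ.qpow 1 = 1 := by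
    conv_lhs => rw [h1]
    nth_rewrite 1 [← h1]
    rw [← Γ.qpow_add ⟨Γ.δ₀, by simp⟩]
    simp [FixedData.qpow_zero]
  have h3 : Γ.qpow 1 = RatFunc.X ^ Γ.δ₀ := by simp [FixedData.qpow]
  rw [h3, ← pow_add] at h2
  have h4 : (algebraMap (Polynomial ℚ) (RatFunc ℚ)) (Polynomial.X ^ (Γ.δ₀ + Γ.δ₀)) =
      algebraMap (Polynomial ℚ) (RatFunc ℚ) 1 := by
    simpa [RatFunc.algebraMap_X] using h2
  have h5 := congrArg Polynomial.natDegree (RatFunc.algebraMap_injective ℚ h4)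
  have := Γ.δ₀_pos
  simp at h5
  omega

/-! ### The completed quantum torus

`QTorus 𝔰` consists of the formal sums `∑ c_n y^n` over `n ∈ N⁺ ⊔ {0}`, with
`y^n y^{n'} = q^{ {n, n'} } y^{n + n'}`. -/

/-- Formal sums `∑ c_n y^n`, `n ∈ N⁺ ⊔ {0}`, given by their coefficients. -/
structure QTorus (𝔰 : Seed Γ) where
  coeff : Expo r → K

namespace QTorus

variable {𝔰 : Seed Γ}

@[ext] lemma ext' {f g : QTorus 𝔰} (h : ∀ n, f.coeff n = g.coeff n) : f = g := by
  cases f; cases g; congr; exact funext h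

instance : Zero (QTorus 𝔰) := ⟨⟨fun _ => 0⟩⟩
instance : One (QTorus 𝔰) := ⟨⟨fun n => if n = 0 then 1 else 0⟩⟩
instance : Add (QTorus 𝔰) := ⟨fun f g => ⟨fun n => f.coeff n + g.coeff n⟩⟩
instance : Neg (QTorus 𝔰) := ⟨fun f => ⟨fun n => -f.coeff n⟩⟩
instance : Mul (QTorus 𝔰) := ⟨fun f g => ⟨fun n =>
  ∑ p ∈ Finset.HasAntidiagonal.antidiagonal n, Γ.qpow (𝔰.form p.1 p.2) * f.coeff p.1 * g.coeff p.2⟩⟩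

lemma coeff_zero (n : Expo r) : (0 : QTorus 𝔰).coeff n = 0 := rfl
lemma coeff_one (n : Expo r) : (1 : QTorus 𝔰).coeff n = if n = 0 then 1 else 0 := rfl
lemma coeff_add (f g : QTorus 𝔰) (n : Expo r) : (f + g).coeff n = f.coeff n + g.coeff n := rfl
lemma coeff_neg (f : QTorus 𝔰) (n : Expo r) : (-f).coeff n = -f.coeff n := rfl
lemma coeff_mul (f g : QTorus 𝔰) (n : Expo r) : (f * g).coeff n =
    ∑ p ∈ Finset.HasAntidiagonal.antidiagonal n, Γ.qpow (𝔰.form p.1 p.2) * f.coeff p.1 * g.coeff p.2 := rfl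

lemma form_zero_left (a : Expo r) : 𝔰.form 0 a = 0 := by simp [Seed.form, Seed.vec]
lemma form_zero_right (a : Expo r) : 𝔰.form a 0 = 0 := by simp [Seed.form, Seed.vec]
lemma form_add_left (a b c : Expo r) : 𝔰.form (a + b) c = 𝔰.form a c + 𝔰.form b c := by
  simp [Seed.form, Seed.vec_add]
lemma form_add_right (a b c : Expo r) : 𝔰.form a (b + c) = 𝔰.form a b + 𝔰.form a c := by
  simp [Seed.form, Seed.vec_add]

private lemma mul_assoc' (f g h : QTorus 𝔰) : f * g * h = f * (g * h) := by
  ext n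
  simp only [coeff_mul, Finset.sum_mul, Finset.mul_sum, Finset.sum_sigma']
  refine Finset.sum_nbij' (fun ⟨⟨_i, j⟩, ⟨k, l⟩⟩ ↦ ⟨(k, l + j), (l, j)⟩)
    (fun ⟨⟨i, _j⟩, ⟨k, l⟩⟩ ↦ ⟨(i + k, l), (i, k)⟩) ?_ ?_ ?_ ?_ ?_
  · rintro ⟨⟨i, j⟩, ⟨k, l⟩⟩ hx
    simp only [Finset.mem_sigma, Finset.HasAntidiagonal.mem_antidiagonal] at hx ⊢
    obtain ⟨rfl, rfl⟩ := hx
    simp [add_assoc]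
  · rintro ⟨⟨i, j⟩, ⟨k, l⟩⟩ hx
    simp only [Finset.mem_sigma, Finset.HasAntidiagonal.mem_antidiagonal] at hx ⊢
    obtain ⟨rfl, rfl⟩ := hx
    simp [add_assoc]
  · rintro ⟨⟨i, j⟩, ⟨k, l⟩⟩ hx
    simp only [Finset.mem_sigma, Finset.HasAntidiagonal.mem_antidiagonal] at hx ⊢
    obtain ⟨rfl, rfl⟩ := hx
    rfl
  · rintro ⟨⟨i, j⟩, ⟨k, l⟩⟩ hx
    simp only [Finset.mem_sigma, Finset.HasAntidiagonal.mem_antidiagonal] at hx ⊢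
    obtain ⟨rfl, rfl⟩ := hx
    rfl
  · rintro ⟨⟨i, j⟩, ⟨k, l⟩⟩ hx
    simp only [Finset.mem_sigma, Finset.HasAntidiagonal.mem_antidiagonal] at hx ⊢
    obtain ⟨rfl, rfl⟩ := hx
    simp only [form_add_left, form_add_right]
    rw [Γ.qpow_add (𝔰.form_int _ _), Γ.qpow_add (𝔰.form_int _ _)]
    ring

private lemma one_mul' (f : QTorus 𝔰) : 1 * f = f := by
  ext n
  rw [coeff_mul, Finset.sum_eq_single (0, n)]
  · simp [coeff_one, form_zero_left, FixedData.qpow_zero]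
  · rintro ⟨a, b⟩ hab h
    have : a ≠ 0 := by
      rintro rfl
      simp only [Finset.HasAntidiagonal.mem_antidiagonal, zero_add] at hab
      exact h (by rw [hab])
    simp [coeff_one, this]
  · simp

private lemma mul_one' (f : QTorus 𝔰) : f * 1 = f := by
  ext n
  rw [coeff_mul, Finset.sum_eq_single (n, 0)]
  · simp [coeff_one, form_zero_right, FixedData.qpow_zero]
  · rintro ⟨a, b⟩ hab h
    have : b ≠ 0 := by
      rintro rfl
      simp only [Finset.HasAntidiagonal.mem_antidiagonal, add_zero] at hab
      exact h (by rw [hab])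
    simp [coeff_one, this]
  · simp

instance : Ring (QTorus 𝔰) where
  add_assoc f g h := by ext n; simp only [coeff_add]; ring
  zero_add f := by ext n; simp [coeff_add, coeff_zero]
  add_zero f := by ext n; simp [coeff_add, coeff_zero]
  add_comm f g := by ext n; simp only [coeff_add]; ring
  neg_add_cancel f := by ext n; simp [coeff_add, coeff_neg, coeff_zero]
  left_distrib f g h := by
    ext n; simp only [coeff_add, coeff_mul, ← Finset.sum_add_distrib]
    exact Finset.sum_congr rfl fun _ _ => by ring
  right_distrib f g h := by
    ext n; simp only [coeff_add, coeff_mul, ← Finset.sum_add_distrib]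
    exact Finset.sum_congr rfl fun _ _ => by ring
  zero_mul f := by ext n; simp [coeff_mul, coeff_zero]
  mul_zero f := by ext n; simp [coeff_mul, coeff_zero]
  mul_assoc := mul_assoc'
  one_mul := one_mul'
  mul_one := mul_one'
  nsmul := nsmulRec
  zsmul := zsmulRec

lemma coeff_sub (f g : QTorus 𝔰) (n : Expo r) : (f - g).coeff n = f.coeff n - g.coeff n := by
  rw [sub_eq_add_neg, coeff_add, coeff_neg, sub_eq_add_neg]

/-- The exponential series `∑ f^k / k!` of a formal sum without constant term; in degree `d`
only the terms with `k ≤ d` contribute. -/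
def exp (f : QTorus 𝔰) : QTorus 𝔰 :=
  ⟨fun n => ∑ k ∈ Finset.range (deg n + 1), (k.factorial : K)⁻¹ * (f ^ k).coeff n⟩

/-- `f` and `g` have the same coefficients in degrees `< d`. -/
def Agree (d : ℕ) (f g : QTorus 𝔰) : Prop := ∀ n, deg n < d → f.coeff n = g.coeff n

/-- A map that improves agreement by one degree has exactly one fixed point. -/
lemma existsUnique_fixedPoint (T : QTorus 𝔰 → QTorus 𝔰)
    (hT : ∀ d f g, Agree d f g → Agree (d + 1) (T f) (T g)) : ∃! f, T f = f := by
  have key : ∀ d k, Agree d (T^[d] 0) (T^[d + k] 0) := by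
    intro d
    induction d with
    | zero => intro k n hn; omega
    | succ d ih =>
      intro k
      rw [show d + 1 + k = (d + k) + 1 by ring, Function.iterate_succ_apply',
        Function.iterate_succ_apply']
      exact hT _ _ _ (ih k)
  let F : QTorus 𝔰 := ⟨fun n => (T^[deg n + 1] 0).coeff n⟩
  have hF : ∀ d, Agree d (T^[d] 0) F := by
    intro d n hn
    obtain ⟨k, rfl⟩ := Nat.exists_eq_add_of_le (show deg n + 1 ≤ d by omega)
    exact (key _ k n (by omega)).symm
  refine ⟨F, ?_, ?_⟩
  · ext n
    have h1 := hT _ _ _ (hF (deg n)) n (by omega)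
    have h2 := hF (deg n + 1) n (by omega)
    rw [← h1, ← h2, Function.iterate_succ_apply']
  · intro g hg
    have h : ∀ d, Agree d g F := by
      intro d
      induction d with
      | zero => intro n hn; omega
      | succ d ih =>
        intro n hn
        have h1 := hT _ _ _ (fun m hm => (ih m hm).trans (hF d m hm).symm) n hn
        have h2 := hF (d + 1) n hn
        rw [← h2, Function.iterate_succ_apply', ← hg]
        exact h1
    ext n
    exact h (deg n + 1) n (by omega)


lemma coeff_mul_zero (f g : QTorus 𝔰) : (f * g).coeff 0 = f.coeff 0 * g.coeff 0 := by
  simp [coeff_mul, form_zero_left, FixedData.qpow_zero]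

lemma Agree.mul {d : ℕ} {f f' g g' : QTorus 𝔰} (hf : Agree d f f') (hg : Agree d g g') :
    Agree d (f * g) (f' * g') := by
  intro n hn
  rw [coeff_mul, coeff_mul]
  refine Finset.sum_congr rfl fun p hp => ?_
  have hd : deg p.1 + deg p.2 = deg n := by
    rw [← deg_add, Finset.HasAntidiagonal.mem_antidiagonal.1 hp]
  rw [hf p.1 (by omega), hg p.2 (by omega)]

lemma Agree.pow {d : ℕ} {f g : QTorus 𝔰} (h : Agree d f g) (k : ℕ) :
    Agree d (f ^ k) (g ^ k) := by
  induction k with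
  | zero => intro n _; simp
  | succ k ih => rw [pow_succ, pow_succ]; exact ih.mul h

lemma Agree.mul_succ {d : ℕ} {f f' g g' : QTorus 𝔰} (hf : Agree d f f') (hg : Agree d g g')
    (f0 : f.coeff 0 = 0) (f0' : f'.coeff 0 = 0) (g0 : g.coeff 0 = 0) (g0' : g'.coeff 0 = 0) :
    Agree (d + 1) (f * g) (f' * g') := by
  intro n hn
  rw [coeff_mul, coeff_mul]
  refine Finset.sum_congr rfl fun p hp => ?_
  have hd : deg p.1 + deg p.2 = deg n := by
    rw [← deg_add, Finset.HasAntidiagonal.mem_antidiagonal.1 hp]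
  by_cases h1 : p.1 = 0
  · rw [h1, f0, f0']; simp
  by_cases h2 : p.2 = 0
  · rw [h2, g0, g0']; simp
  have := deg_pos h1
  have := deg_pos h2
  rw [hf p.1 (by omega), hg p.2 (by omega)]

lemma pow_coeff_zero {f : QTorus 𝔰} (f0 : f.coeff 0 = 0) (k : ℕ) :
    (f ^ (k + 1)).coeff 0 = 0 := by
  rw [pow_succ, coeff_mul_zero, f0, mul_zero]

lemma exp_coeff_zero (f : QTorus 𝔰) : (exp f).coeff 0 = 1 := by
  simp [exp, deg, coeff_one]

/-- Removal of the constant term. -/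
def aug (f : QTorus 𝔰) : QTorus 𝔰 := ⟨fun n => if n = 0 then 0 else f.coeff n⟩

lemma aug_eq {f : QTorus 𝔰} (f0 : f.coeff 0 = 0) : aug f = f := by
  ext n
  by_cases h : n = 0
  · simp [aug, h, f0]
  · simp [aug, h]

lemma exp_sub_agree {d : ℕ} {f g : QTorus 𝔰} (h : Agree d f g) (f0 : f.coeff 0 = 0)
    (g0 : g.coeff 0 = 0) : Agree (d + 1) (f - exp f) (g - exp g) := by
  intro n hn
  rw [coeff_sub, coeff_sub]
  by_cases hn0 : n = 0
  · rw [hn0, exp_coeff_zero, exp_coeff_zero, f0, g0]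
  have hpos := deg_pos hn0
  have key : (exp f).coeff n - (exp g).coeff n = f.coeff n - g.coeff n := by
    simp only [exp]
    rw [← Finset.sum_sub_distrib, Finset.sum_eq_single 1]
    · simp
    · intro k _ hk
      have : (f ^ k).coeff n = (g ^ k).coeff n := by
        rcases k with _ | _ | k
        · simp
        · exact absurd rfl hk
        · rw [pow_succ f, pow_succ g]
          exact (h.pow (k + 1)).mul_succ h (pow_coeff_zero f0 k) (pow_coeff_zero g0 k) f0 g0 n hn
      rw [this, sub_self]
    · intro h1
      exact absurd (Finset.mem_range.2 (by omega)) h1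
  linear_combination -key

/-- Every formal sum with constant term `1` is the exponential of exactly one formal sum with
constant term `0`. -/
lemma existsUnique_exp (u : QTorus 𝔰) (u0 : u.coeff 0 = 1) :
    ∃! f : QTorus 𝔰, f.coeff 0 = 0 ∧ exp f = u := by
  have hT : ∀ d (f g : QTorus 𝔰), Agree d f g →
      Agree (d + 1) (u + (aug f - exp (aug f))) (u + (aug g - exp (aug g))) := by
    intro d f g h n hn
    have h' : Agree d (aug f) (aug g) := by
      intro m hm
      simp only [aug]
      split_ifs
      · rfl
      · exact h m hm
    rw [coeff_add, coeff_add, exp_sub_agree h' (by simp [aug]) (by simp [aug]) n hn]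
  obtain ⟨f, hf, huniq⟩ := existsUnique_fixedPoint _ hT
  have f0 : f.coeff 0 = 0 := by
    have := congrArg (fun t => QTorus.coeff t 0) hf
    simp only [coeff_add, coeff_sub, exp_coeff_zero, u0] at this
    rw [← this]
    simp [aug]
  refine ⟨f, ⟨f0, ?_⟩, ?_⟩
  · simp only [aug_eq f0] at hf
    have h1 : u - exp f = 0 := by
      have h2 : u - exp f = (u + (f - exp f)) - f := by abel
      rw [h2, hf, sub_self]
    exact (sub_eq_zero.1 h1).symm
  · rintro g ⟨g0, hg⟩
    apply huniq
    simp only [aug_eq g0, hg]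
    abel

lemma exists_right_inv (u : QTorus 𝔰) (u0 : u.coeff 0 = 1) :
    ∃ v : QTorus 𝔰, v.coeff 0 = 1 ∧ u * v = 1 := by
  obtain ⟨v, hv, -⟩ := existsUnique_fixedPoint (fun v => 1 - (u - 1) * v) (by
    intro d f g h n hn
    rw [coeff_sub, coeff_sub, coeff_mul, coeff_mul]
    congr 1
    refine Finset.sum_congr rfl fun p hp => ?_
    have hd : deg p.1 + deg p.2 = deg n := by
      rw [← deg_add, Finset.HasAntidiagonal.mem_antidiagonal.1 hp]
    by_cases h1 : p.1 = 0
    · rw [h1]; simp [coeff_sub, coeff_one, u0]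
    have := deg_pos h1
    rw [h p.2 (by omega)])
  have huv : u * v = 1 := by
    have h2 : u * v = (u - 1) * v + v := by rw [sub_mul, one_mul]; abel
    rw [h2]
    nth_rewrite 2 [← hv]
    abel
  refine ⟨v, ?_, huv⟩
  have := congrArg (fun t => QTorus.coeff t 0) huv
  simpa [coeff_mul_zero, u0, coeff_one] using this

end QTorus

/-- The formal sums with constant term `1`. -/
abbrev OneUnit (𝔰 : Seed Γ) := {u : QTorus 𝔰 // u.coeff 0 = 1}

/-- The formal sums with constant term `1` form a group under multiplication. -/
instance OneUnit.instGroup (𝔰 : Seed Γ) : Group (OneUnit 𝔰) :=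
  letI : Mul (OneUnit 𝔰) :=
    ⟨fun u v => ⟨u.1 * v.1, by rw [QTorus.coeff_mul_zero, u.2, v.2, mul_one]⟩⟩
  letI : One (OneUnit 𝔰) := ⟨⟨1, by simp [QTorus.coeff_one]⟩⟩
  letI : Inv (OneUnit 𝔰) := ⟨fun u =>
    ⟨(QTorus.exists_right_inv u.1 u.2).choose, (QTorus.exists_right_inv u.1 u.2).choose_spec.1⟩⟩
  Group.ofRightAxioms (fun u v w => Subtype.ext (mul_assoc u.1 v.1 w.1))
    (fun u => Subtype.ext (mul_one u.1))
    (fun u => Subtype.ext (QTorus.exists_right_inv u.1 u.2).choose_spec.2)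

/-! ### The Lie algebra `ĝ` -/

/-- The completed Lie algebra `ĝ`: formal sums `∑ c_n X_n` over `n ∈ N⁺`, given by their
coefficients. -/
def LieHat (_𝔰 : Seed Γ) := NPlus r → K

namespace LieHat

variable {𝔰 : Seed Γ}

instance : AddCommGroup (LieHat 𝔰) := inferInstanceAs (AddCommGroup (NPlus r → K))
instance : Module K (LieHat 𝔰) := inferInstanceAs (Module K (NPlus r → K))

/-- The coefficient of `X_n`, and `0` for `n = 0`. -/
def coeff (X : LieHat 𝔰) (n : Expo r) : K := if h : n ≠ 0 then X ⟨n, h⟩ else 0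

/-- The Lie bracket: `[X_n, X_{n'}] = [{n, n'}]_q X_{n + n'}`. -/
instance : Bracket (LieHat 𝔰) (LieHat 𝔰) := ⟨fun X Y n =>
  ∑ p ∈ Finset.HasAntidiagonal.antidiagonal n.1,
    Γ.qnum (𝔰.form p.1 p.2) * X.coeff p.1 * Y.coeff p.2⟩

lemma lie_apply (X Y : LieHat 𝔰) (n : NPlus r) : (⁅X, Y⁆ : LieHat 𝔰) n =
    ∑ p ∈ Finset.HasAntidiagonal.antidiagonal n.1,
      Γ.qnum (𝔰.form p.1 p.2) * X.coeff p.1 * Y.coeff p.2 := rfl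

lemma smul_apply (c : K) (X : LieHat 𝔰) (n : NPlus r) : (c • X) n = c * X n := rfl

/-- The embedding `X_n ↦ y^n / (q - q⁻¹)` of `ĝ` into the completed quantum torus. -/
def emb (X : LieHat 𝔰) : QTorus 𝔰 := ⟨fun n => X.coeff n / (Γ.qpow 1 - Γ.qpow (-1))⟩

lemma emb_coeff_zero (X : LieHat 𝔰) : X.emb.coeff 0 = 0 := by simp [emb, coeff]

lemma emb_coeff (X : LieHat 𝔰) (n : NPlus r) :
    X.emb.coeff n.1 = X n / (Γ.qpow 1 - Γ.qpow (-1)) := by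
  simp [emb, coeff, n.2]

lemma emb_injective : Function.Injective (emb : LieHat 𝔰 → QTorus 𝔰) := by
  intro X Y h
  funext n
  have h1 := congrArg (fun t => QTorus.coeff t n.1) h
  simp only [emb_coeff] at h1
  exact (div_left_inj' Γ.qpow_one_sub_ne_zero).1 h1

lemma emb_add (X Y : LieHat 𝔰) : (X + Y).emb = X.emb + Y.emb := by
  ext n
  rw [QTorus.coeff_add]
  by_cases h : n = 0
  · subst h; simp [emb_coeff_zero]
  · rw [emb_coeff _ ⟨n, h⟩, emb_coeff _ ⟨n, h⟩, emb_coeff _ ⟨n, h⟩, ← add_div]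
    rfl

/-- Under the embedding the Lie bracket is the commutator. -/
lemma emb_lie (X Y : LieHat 𝔰) : (⁅X, Y⁆ : LieHat 𝔰).emb = X.emb * Y.emb - Y.emb * X.emb := by
  have hq := Γ.qpow_one_sub_ne_zero
  ext n
  rw [QTorus.coeff_sub]
  by_cases h : n = 0
  · subst h
    rw [QTorus.coeff_mul_zero, QTorus.coeff_mul_zero]
    simp [emb_coeff_zero]
  · have hswap : ∑ p ∈ Finset.HasAntidiagonal.antidiagonal n,
        Γ.qpow (𝔰.form p.1 p.2) * Y.emb.coeff p.1 * X.emb.coeff p.2 =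
        ∑ p ∈ Finset.HasAntidiagonal.antidiagonal n,
        Γ.qpow (𝔰.form p.2 p.1) * Y.emb.coeff p.2 * X.emb.coeff p.1 :=
      Finsupp.sum_antidiagonal_swap n
        (fun a b => Γ.qpow (𝔰.form a b) * Y.emb.coeff a * X.emb.coeff b)
    rw [emb_coeff _ ⟨n, h⟩, QTorus.coeff_mul, QTorus.coeff_mul, hswap, ← Finset.sum_sub_distrib]
    simp only [lie_apply, Finset.sum_div]
    refine Finset.sum_congr rfl fun p _ => ?_
    have hs : 𝔰.form p.2 p.1 = -𝔰.form p.1 p.2 := Γ.form_skew _ _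
    rw [hs]
    simp only [emb, FixedData.qnum]
    field_simp

lemma coeff_smul (c : K) (X : LieHat 𝔰) (n : Expo r) : (c • X).coeff n = c * X.coeff n := by
  by_cases h : n = 0
  · simp [coeff, h]
  · simp only [coeff, h, ne_eq, not_false_eq_true, dif_pos]
    rfl

instance : LieRing (LieHat 𝔰) where
  add_lie X Y Z := emb_injective (by simp only [emb_lie, emb_add]; noncomm_ring)
  lie_add X Y Z := emb_injective (by simp only [emb_lie, emb_add]; noncomm_ring)
  lie_self X := emb_injective (by
    have h0 : (0 : LieHat 𝔰).emb = 0 := by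
      have := emb_add (0 : LieHat 𝔰) 0
      simpa using this
    rw [emb_lie, sub_self, h0])
  leibniz_lie X Y Z := emb_injective (by simp only [emb_lie, emb_add]; noncomm_ring)

instance : LieAlgebra K (LieHat 𝔰) where
  lie_smul c X Y := by
    funext n
    rw [smul_apply, lie_apply, lie_apply, Finset.mul_sum]
    refine Finset.sum_congr rfl fun p _ => ?_
    rw [coeff_smul]
    ring

/-- The exponential of an element of `ĝ`, as a formal sum with constant term `1`. -/
def expUnit (X : LieHat 𝔰) : OneUnit 𝔰 := ⟨QTorus.exp X.emb, QTorus.exp_coeff_zero _⟩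

lemma expUnit_bijective : Function.Bijective (expUnit : LieHat 𝔰 → OneUnit 𝔰) := by
  constructor
  · intro X Y h
    have h1 : QTorus.exp X.emb = QTorus.exp Y.emb := congrArg Subtype.val h
    exact emb_injective ((QTorus.existsUnique_exp (QTorus.exp Y.emb) (QTorus.exp_coeff_zero _)).unique
      ⟨emb_coeff_zero X, h1⟩ ⟨emb_coeff_zero Y, rfl⟩)
  · rintro ⟨u, u0⟩
    obtain ⟨f, ⟨f0, hf⟩, -⟩ := QTorus.existsUnique_exp u u0
    let X : LieHat 𝔰 := fun n => f.coeff n.1 * (Γ.qpow 1 - Γ.qpow (-1))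
    have hX : ∀ n : NPlus r, X n = f.coeff n.1 * (Γ.qpow 1 - Γ.qpow (-1)) := fun _ => rfl
    refine ⟨X, Subtype.ext (Eq.trans ?_ hf)⟩
    refine congrArg QTorus.exp (QTorus.ext' fun n => ?_)
    by_cases h : n = 0
    · subst h; rw [emb_coeff_zero, f0]
    · rw [emb_coeff _ ⟨n, h⟩, hX, mul_div_cancel_right₀ _ Γ.qpow_one_sub_ne_zero]

end LieHat

/-! ### The structure group -/

/-- The structure group `G = exp(ĝ)`; the element `⟨X⟩` is `exp X`. -/
structure StructureGroup (𝔰 : Seed Γ) where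
  log : LieHat 𝔰

namespace StructureGroup

variable {𝔰 : Seed Γ}

/-- The bijection `exp X ↦ e^X` onto the formal sums with constant term `1` in the completed
quantum torus, an associative algebra whose commutator restricts to the bracket of `ĝ`. -/
def equivUnit (𝔰 : Seed Γ) : StructureGroup 𝔰 ≃ OneUnit 𝔰 :=
  (⟨StructureGroup.log, StructureGroup.mk, fun _ => rfl, fun _ => rfl⟩ :
    StructureGroup 𝔰 ≃ LieHat 𝔰).trans (Equiv.ofBijective _ LieHat.expUnit_bijective)

/-- The product of `G` is given by the Baker-Campbell-Hausdorff formula: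
`exp X * exp Y = exp Z` with `Z = log (e^X e^Y)`. -/
instance : Group (StructureGroup 𝔰) := (equivUnit 𝔰).group

/-- The power `g^c = exp (c X)` of `g = exp X`, for `c` in the ground field. -/
def power (g : StructureGroup 𝔰) (c : K) : StructureGroup 𝔰 := ⟨c • g.log⟩

/-- The normal subgroup `G^{>l}`. -/
def Gtail (𝔰 : Seed Γ) (l : ℕ) : Set (StructureGroup 𝔰) :=
  {g | ∀ n : NPlus r, deg n.1 ≤ l → g.log n = 0}

/-- Equality of the images in the quotient `G^{≤l} = G / G^{>l}`. -/
def EqMod (l : ℕ) (g h : StructureGroup 𝔰) : Prop := g⁻¹ * h ∈ Gtail 𝔰 l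

/-- The subgroup of the elements `exp (∑ j ≥ 1, c_j X_{j n})`. -/
def Gpar (𝔰 : Seed Γ) (n : NPlus r) : Set (StructureGroup 𝔰) :=
  {g | ∀ m : NPlus r, g.log m ≠ 0 → ∃ j : ℕ, m.1 = j • n.1}

/-- The quantum dilogarithm element
`Ψ_{a,b}[n] = exp (∑ j ≥ 1, (-1)^{j+1} / (j [j a]_q) * q^{j b} X_{j n})`, for
`a ∈ (1/δ₀)ℤ_{>0}` and `b ∈ (1/δ₀)ℤ`. -/
def dilog (𝔰 : Seed Γ) (a b : ℚ) (n : NPlus r) : StructureGroup 𝔰 :=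
  ⟨fun m => ∑ j ∈ Finset.Icc 1 (deg m.1), if m.1 = j • n.1 then
    (-1) ^ (j + 1) / ((j : K) * Γ.qnum (j * a)) * Γ.qpow (j * b) else 0⟩

end StructureGroup

/-! ### Scattering diagrams -/

/-- `M_ℝ`, in the coordinates with respect to the basis dual to the seed. -/
abbrev MR (r : ℕ) := Fin r → ℝ

/-- The pairing of `N⁺ ⊔ {0}` with `M_ℝ`. -/
def pairing {r : ℕ} (n : Expo r) (z : MR r) : ℝ := ∑ i, (n i : ℝ) * z i

/-- Cones: convex rational polyhedral cones, not necessarily strictly convex. -/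
def IsRationalCone {r : ℕ} (C : PointedCone ℝ (MR r)) : Prop :=
  ∃ S : Finset (Fin r → ℤ), C = PointedCone.hull ℝ ((fun v i => (v i : ℝ)) '' (S : Set (Fin r → ℤ)))

/-- The dimension of a cone. -/
def coneDim {r : ℕ} (C : PointedCone ℝ (MR r)) : ℕ :=
  Module.finrank ℝ (Submodule.span ℝ (C : Set (MR r)))

/-- `p^*(n) = {·, n}`. -/
def Seed.pstar (𝔰 : Seed Γ) (n : Expo r) : MR r :=
  fun i => (𝔰.form (Finsupp.single i 1) n : ℝ)

/-- The seed vector `e i` as an element of `N⁺`. -/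
def NPlus.e {r : ℕ} (i : Fin r) : NPlus r := ⟨Finsupp.single i 1, by simp⟩

/-- A wall: primitive normal vector, support (a cone of codimension one in `n^⊥`),
wall element. -/
structure Wall (𝔰 : Seed Γ) where
  normal : NPlus r
  support : PointedCone ℝ (MR r)
  elt : StructureGroup 𝔰
  normal_primitive : IsPrimitive normal
  support_rational : IsRationalCone support
  support_perp : ∀ z ∈ support, pairing normal.1 z = 0
  support_codim : coneDim support + 1 = r
  elt_mem : elt ∈ StructureGroup.Gpar 𝔰 normal

/-- A wall is incoming if `p^*(n)` lies in its support. -/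
def Wall.IsIncoming {𝔰 : Seed Γ} (w : Wall 𝔰) : Prop := 𝔰.pstar w.normal.1 ∈ w.support

/-- A scattering diagram: an indexed collection of walls such that, for every degree `l`, only
finitely many wall elements are nontrivial in `G^{≤l}`. -/
structure ScatteringDiagram (𝔰 : Seed Γ) where
  Index : Type*
  wall : Index → Wall 𝔰
  finite : ∀ l : ℕ, {i | (wall i).elt ∉ StructureGroup.Gtail 𝔰 l}.Finite

namespace ScatteringDiagram

variable {𝔰 : Seed Γ}

/-- The support of a scattering diagram. -/
def Supp (D : ScatteringDiagram 𝔰) : Set (MR r) := ⋃ i, ((D.wall i).support : Set (MR r))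

/-- The singular locus: (relative) boundaries of the supports of the walls, and their pairwise
intersections of dimension `r - 2`. -/
def Sing (D : ScatteringDiagram 𝔰) : Set (MR r) :=
  (⋃ i, intrinsicFrontier ℝ ((D.wall i).support : Set (MR r))) ∪
  {z | ∃ i j, coneDim ((D.wall i).support ⊓ (D.wall j).support) + 2 = r ∧
    z ∈ (D.wall i).support ∧ z ∈ (D.wall j).support}

/-- Admissible curves `γ : [0,1] → M_ℝ`. -/
structure IsAdmissible (D : ScatteringDiagram 𝔰) (γ : ℝ → MR r) : Prop where
  smooth : ContDiffOn ℝ ∞ γ (Set.Icc 0 1)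
  source : γ 0 ∉ D.Supp
  target : γ 1 ∉ D.Supp
  transversal : ∀ t ∈ Set.Icc (0 : ℝ) 1, ∀ i, γ t ∈ (D.wall i).support →
    pairing (D.wall i).normal.1 (deriv γ t) ≠ 0
  avoids : ∀ t ∈ Set.Icc (0 : ℝ) 1, γ t ∉ D.Sing

open Classical in
/-- The factor `g_i^ε` contributed by a crossing of the wall `i` at time `t`: the intersection
sign `ε` is `1` if `⟨n_i, γ'(t)⟩ < 0` and `-1` if `⟨n_i, γ'(t)⟩ > 0`. -/
def factor (D : ScatteringDiagram 𝔰) (γ : ℝ → MR r) (x : ℝ × D.Index) : StructureGroup 𝔰 :=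
  if pairing (D.wall x.2).normal.1 (deriv γ x.1) < 0 then (D.wall x.2).elt
  else (D.wall x.2).elt⁻¹

/-- `p` is the path-ordered product of the admissible curve `γ`: for every `l`, its image in
`G^{≤l}` is the product of the factors of the finitely many crossings `(t, i)` of walls that are
nontrivial in `G^{≤l}`, ordered so that later crossings stand to the left of earlier ones.
(Walls that are crossed at the same time have the same normal vector, so that their elements
commute.) -/
def HasPathProduct (D : ScatteringDiagram 𝔰) (γ : ℝ → MR r) (p : StructureGroup 𝔰) : Prop :=
  ∀ l : ℕ, ∃ L : List (ℝ × D.Index), L.Nodup ∧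
    (∀ x, x ∈ L ↔ x.1 ∈ Set.Icc (0 : ℝ) 1 ∧ γ x.1 ∈ (D.wall x.2).support ∧
      (D.wall x.2).elt ∉ StructureGroup.Gtail 𝔰 l) ∧
    L.Pairwise (fun x y => y.1 ≤ x.1) ∧
    StructureGroup.EqMod l p (L.map (D.factor γ)).prod

/-- Two scattering diagrams are equivalent if they have the same path-ordered products along all
curves that are admissible for both. -/
def Equivalent (D D' : ScatteringDiagram 𝔰) : Prop :=
  ∀ γ : ℝ → MR r, D.IsAdmissible γ → D'.IsAdmissible γ →
    ∃ p, D.HasPathProduct γ p ∧ D'.HasPathProduct γ p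

/-- A scattering diagram is consistent if its path-ordered products along admissible loops are
trivial. -/
def IsConsistent (D : ScatteringDiagram 𝔰) : Prop :=
  ∀ γ : ℝ → MR r, D.IsAdmissible γ → γ 0 = γ 1 → D.HasPathProduct γ 1

/-- Quantum cluster scattering diagrams: consistent scattering diagrams whose incoming walls are
exactly the walls `(e_i^⊥, Ψ_{1/δ_i}[e_i])_{e_i}`, each occurring once. -/
def IsQCSD (D : ScatteringDiagram 𝔰) : Prop :=
  D.IsConsistent ∧ ∃ ι : Fin r → D.Index, Function.Injective ι ∧
    (∀ j, (D.wall j).IsIncoming ↔ j ∈ Set.range ι) ∧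
    ∀ i, (D.wall (ι i)).normal = NPlus.e i ∧
      ((D.wall (ι i)).support : Set (MR r)) = {z | pairing (NPlus.e i).1 z = 0} ∧
      (D.wall (ι i)).elt = StructureGroup.dilog 𝔰 (1 / Γ.δ i) 0 (NPlus.e i)

end ScatteringDiagram

end QCSD

end

open scoped ContDiff

noncomputable section

namespace QCSD

variable {r : ℕ} {N : Type*} [AddCommGroup N] {Γ : FixedData r N}

/-! ### The quantum torus as an algebra -/

/-! The map `exp X ↦ e^X` identifies `G` with the group of series of constant term `1` in the
completed quantum torus. What characterizes the products of the elements `Ψ_{1/δ(n),b}[n]` inside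
`G_n^∥` is an integrality property of cocycles. For `φ` in the dual lattice of `N°` let `τ_φ` be the
automorphism `y^n ↦ q^{2⟨n,φ⟩} y^n`, and call `u` integral if all cocycles `u τ_φ(u)⁻¹` (`defect φ
u`) have coefficients in `ℤ[q^{±1/δ₀}]`. The logarithm of a quantum dilogarithm has the denominators
`[j/δ(n)]_q`, but `τ_φ` changes it by a finite geometric sum, so its cocycle is a finite product of
binomials `(1 + q^{c/δ₀} y^n)^{±1}` (`isIntegral_dilogLog`).

Integral elements form a group. In `defect φ (u v) = u · defect φ v · τ_φ(u)⁻¹`, moving a monomial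
`y^m` of the middle factor to the right twists the last factor by `q^{2{m,·}}`. Since `{N°, N} ⊆ ℤ`,
this twist also belongs to the dual of `N°`, and what remains on the left is another cocycle of `u`.
The same computation shows that in the first degree where integrality may fail, the coefficients of
the cocycles are additive modulo `ℤ[q^{±1/δ₀}]` (`IsIntegral.coeff_defect_mul`).

Consistency propagates integrality. By induction on the degree, the product of the wall elements at
every nonsingular point is integral (`IsQCSD.isIntegral`). A nonsingular point `z` of `n^⊥` is
joined to a point `z₀` of `n^⊥` near `p^*(n)` by a generic ellipse that meets `n^⊥` only in these
two points. The path-ordered product along it is `1`, so the next coefficients of the cocycles at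
the crossings have an integral sum. Crossings of other hyperplanes contribute nothing at multiples
of `n`, and at `z₀` only incoming walls matter, whose elements are quantum dilogarithms. Hence the
contribution of `z` is integral as well.

An integral element of `G_n^∥` factors. If its logarithm starts at `X_m`, the coefficient there is
an element of `ℤ[q^{±1/δ₀}]` divided by `[1/δ(m)]_q`, which is also the leading coefficient of a
product of integer powers of the `Ψ_{1/δ(m),b}[m]`. Dividing this product out and continuing gives
the factorization (`sum_dilogComb_exponents`).

It remains to realize these pointwise factorizations by walls. Up to a given degree, the exponents
at a point depend only on which of finitely many old supports contain it. Möbius inversion over sets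
of supports turns this dependence into a sum over walls carried by intersections of supports.
Path-ordered products depend only on the total product of the wall elements at each point
(`HasPathProduct.of_total_eq`), so both consistency and equivalence follow. -/

/-- The integer `δ₀ {a, b}`. -/
def Seed.iform (𝔰 : Seed Γ) (a b : Expo r) : ℤ := ⌊(Γ.δ₀ : ℚ) * 𝔰.form a b⌋

lemma Seed.iform_cast (𝔰 : Seed Γ) (a b : Expo r) :
    (𝔰.iform a b : ℚ) = (Γ.δ₀ : ℚ) * 𝔰.form a b := by
  obtain ⟨k, hk⟩ := 𝔰.form_int a b
  rw [Seed.iform, hk, Int.floor_intCast]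

lemma Seed.iform_add_left (𝔰 : Seed Γ) (a b c : Expo r) :
    𝔰.iform (a + b) c = 𝔰.iform a c + 𝔰.iform b c := by
  have : (𝔰.iform (a + b) c : ℚ) = 𝔰.iform a c + 𝔰.iform b c := by
    simp only [Seed.iform_cast, QTorus.form_add_left, mul_add]
  exact_mod_cast this

lemma Seed.iform_skew (𝔰 : Seed Γ) (a b : Expo r) : 𝔰.iform a b = -𝔰.iform b a := by
  have : (𝔰.iform a b : ℚ) = -𝔰.iform b a := by
    simp only [Seed.iform_cast, Seed.form, Γ.form_skew (𝔰.vec a)]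
    ring
  exact_mod_cast this

lemma Seed.iform_add_right (𝔰 : Seed Γ) (a b c : Expo r) :
    𝔰.iform a (b + c) = 𝔰.iform a b + 𝔰.iform a c := by
  rw [𝔰.iform_skew, 𝔰.iform_add_left, 𝔰.iform_skew b, 𝔰.iform_skew c]
  ring

lemma Seed.iform_zero_right (𝔰 : Seed Γ) (a : Expo r) : 𝔰.iform a 0 = 0 := by
  simp [Seed.iform, QTorus.form_zero_right]

lemma Seed.iform_zero_left (𝔰 : Seed Γ) (a : Expo r) : 𝔰.iform 0 a = 0 := by
  simp [Seed.iform, QTorus.form_zero_left]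

lemma Seed.iform_self (𝔰 : Seed Γ) (a : Expo r) : 𝔰.iform a a = 0 := by
  have := 𝔰.iform_skew a a
  omega

lemma Seed.iform_nsmul_left (𝔰 : Seed Γ) (j : ℕ) (a b : Expo r) :
    𝔰.iform (j • a) b = j * 𝔰.iform a b := by
  induction j with
  | zero => simp [Seed.iform_zero_left]
  | succ j ih =>
    rw [add_smul, one_smul, 𝔰.iform_add_left, ih]
    push_cast
    ring

lemma Seed.iform_nsmul_nsmul (𝔰 : Seed Γ) (j k : ℕ) (a : Expo r) :
    𝔰.iform (j • a) (k • a) = 0 := by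
  rw [𝔰.iform_nsmul_left, 𝔰.iform_skew, 𝔰.iform_nsmul_left, 𝔰.iform_self]
  simp

lemma Seed.qpow_form (𝔰 : Seed Γ) (a b : Expo r) :
    Γ.qpow (𝔰.form a b) = RatFunc.X ^ 𝔰.iform a b := rfl

lemma deg_zero : deg (0 : Expo r) = 0 := by simp [deg]

lemma deg_eq_zero {a : Expo r} : deg a = 0 ↔ a = 0 :=
  ⟨fun h => by
    by_contra h0
    have := deg_pos h0
    omega, fun h => by rw [h, deg_zero]⟩

lemma deg_nsmul (j : ℕ) (a : Expo r) : deg (j • a) = j * deg a := by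
  simp [deg, Finset.mul_sum]

lemma nsmul_left_injective {n : Expo r} (hn : n ≠ 0) {j k : ℕ} (h : j • n = k • n) : j = k := by
  have h1 := congrArg deg h
  rw [deg_nsmul, deg_nsmul] at h1
  exact Nat.eq_of_mul_eq_mul_right (deg_pos hn) h1

lemma deg_fst_add_snd {n : Expo r} {p : Expo r × Expo r}
    (hp : p ∈ Finset.HasAntidiagonal.antidiagonal n) : deg p.1 + deg p.2 = deg n := by
  rw [← deg_add, Finset.HasAntidiagonal.mem_antidiagonal.1 hp]

namespace QTorus

variable {𝔰 : Seed Γ}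

instance : SMul K (QTorus 𝔰) := ⟨fun c f => ⟨fun n => c * f.coeff n⟩⟩

lemma coeff_smul (c : K) (f : QTorus 𝔰) (n : Expo r) : (c • f).coeff n = c * f.coeff n := rfl

instance : Module K (QTorus 𝔰) where
  one_smul f := by ext n; simp [coeff_smul]
  mul_smul c d f := by ext n; simp [coeff_smul, mul_assoc]
  smul_zero c := by ext n; simp [coeff_smul, coeff_zero]
  smul_add c f g := by ext n; simp [coeff_smul, coeff_add, mul_add]
  add_smul c d f := by ext n; simp [coeff_smul, coeff_add, add_mul]
  zero_smul f := by ext n; simp [coeff_smul, coeff_zero]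

instance : Algebra K (QTorus 𝔰) := Algebra.ofModule
  (fun c f g => by
    ext n
    simp only [coeff_smul, coeff_mul, Finset.mul_sum]
    exact Finset.sum_congr rfl fun _ _ => by ring)
  (fun c f g => by
    ext n
    simp only [coeff_smul, coeff_mul, Finset.mul_sum]
    exact Finset.sum_congr rfl fun _ _ => by ring)

/-- The coefficient of `y^n` as a linear functional. -/
def coeffL (n : Expo r) : QTorus 𝔰 →ₗ[K] K where
  toFun f := f.coeff n
  map_add' _ _ := rfl
  map_smul' _ _ := rfl

lemma coeff_sum {ι : Type*} (s : Finset ι) (f : ι → QTorus 𝔰) (n : Expo r) :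
    (∑ i ∈ s, f i).coeff n = ∑ i ∈ s, (f i).coeff n :=
  map_sum (coeffL n) f s

lemma coeff_mul' (f g : QTorus 𝔰) (n : Expo r) : (f * g).coeff n =
    ∑ p ∈ Finset.HasAntidiagonal.antidiagonal n,
      RatFunc.X ^ 𝔰.iform p.1 p.2 * f.coeff p.1 * g.coeff p.2 := rfl

/-- Each factor raises the degree by at least one. Hence the exponential series may be cut off at
any bound above the degree, which allows a common bound for different coefficients in `exp_coeff`.
-/
lemma pow_coeff_eq_zero {f : QTorus 𝔰} (f0 : f.coeff 0 = 0) {k : ℕ} {n : Expo r}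
    (h : deg n < k) : (f ^ k).coeff n = 0 := by
  induction k generalizing n with
  | zero => omega
  | succ k ih =>
    rw [pow_succ, coeff_mul]
    refine Finset.sum_eq_zero fun p hp => ?_
    have hd := deg_fst_add_snd hp
    by_cases h2 : p.2 = 0
    · rw [h2, f0, mul_zero]
    · have := deg_pos h2
      rw [ih (by omega)]
      ring

lemma exp_coeff {f : QTorus 𝔰} (f0 : f.coeff 0 = 0) {n : Expo r} {d : ℕ} (h : deg n < d) :
    (exp f).coeff n = ∑ k ∈ Finset.range d, (k.factorial : K)⁻¹ * (f ^ k).coeff n := by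
  change ∑ k ∈ Finset.range (deg n + 1), (k.factorial : K)⁻¹ * (f ^ k).coeff n = _
  refine Finset.sum_subset (fun k hk => ?_) fun k _ hk => ?_
  · simp only [Finset.mem_range] at hk ⊢
    omega
  · rw [Finset.mem_range, not_lt] at hk
    rw [pow_coeff_eq_zero f0 (by omega), mul_zero]

lemma exp_zero : exp (0 : QTorus 𝔰) = 1 := by
  ext n
  rw [exp_coeff (coeff_zero 0) (Nat.lt_succ_self _), Finset.sum_eq_single 0]
  · simp
  · intro k _ hk
    simp [zero_pow hk, coeff_zero]
  · simp

/-! ### Euler derivation and the exponential -/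

/-- The Euler operator `y^n ↦ deg(n) y^n`. -/
def euler (f : QTorus 𝔰) : QTorus 𝔰 := ⟨fun n => deg n * f.coeff n⟩

lemma euler_coeff (f : QTorus 𝔰) (n : Expo r) : (euler f).coeff n = deg n * f.coeff n := rfl

lemma euler_coeff_zero (f : QTorus 𝔰) : (euler f).coeff 0 = 0 := by
  simp [euler_coeff, deg_zero]

lemma euler_add (f g : QTorus 𝔰) : euler (f + g) = euler f + euler g := by
  ext n
  simp only [euler_coeff, coeff_add]
  ring

lemma euler_mul (f g : QTorus 𝔰) : euler (f * g) = euler f * g + f * euler g := by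
  ext n
  simp only [euler_coeff, coeff_add, coeff_mul, Finset.mul_sum, ← Finset.sum_add_distrib]
  refine Finset.sum_congr rfl fun p hp => ?_
  rw [← deg_fst_add_snd hp]
  push_cast
  ring

lemma euler_one : euler (1 : QTorus 𝔰) = 0 := by
  ext n
  rw [euler_coeff, coeff_one, coeff_zero]
  split_ifs with h
  · simp [h, deg_zero]
  · simp

lemma euler_pow_succ {f : QTorus 𝔰} (h : Commute f (euler f)) (k : ℕ) :
    euler (f ^ (k + 1)) = ((k + 1 : ℕ) : K) • (euler f * f ^ k) := by
  induction k with
  | zero => simp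
  | succ k ih =>
    have h2 : f ^ (k + 1) * euler f = euler f * f ^ (k + 1) := (h.pow_left (k + 1)).eq
    rw [pow_succ f (k + 1), euler_mul, ih, h2, smul_mul_assoc, mul_assoc, ← pow_succ]
    push_cast
    rw [add_smul ((k : K) + 1), one_smul]

/-- Termwise differentiation: as `f` commutes with its derivative, `f^{k+1}/(k+1)!` is sent to
`euler f * f^k/k!`. The index shift matches the truncations because `euler f` has no constant term.
-/
lemma euler_exp {f : QTorus 𝔰} (f0 : f.coeff 0 = 0) (h : Commute f (euler f)) :
    euler (exp f) = euler f * exp f := by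
  ext n
  have h1 : (euler (exp f)).coeff n =
      ∑ k ∈ Finset.range (deg n), (k.factorial : K)⁻¹ * (euler f * f ^ k).coeff n := by
    rw [euler_coeff, exp_coeff f0 (Nat.lt_succ_self _), Finset.mul_sum, Finset.sum_range_succ']
    have h0 : (deg n : K) * ((Nat.factorial 0 : K)⁻¹ * (f ^ 0).coeff n) = 0 := by
      have := congrArg (fun t => QTorus.coeff t n) (euler_one (𝔰 := 𝔰))
      simp only [euler_coeff, coeff_zero] at this
      simpa using this
    rw [h0, add_zero]
    refine Finset.sum_congr rfl fun k _ => ?_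
    have h2 := congrArg (fun t => QTorus.coeff t n) (euler_pow_succ h k)
    simp only [euler_coeff, coeff_smul] at h2
    rw [mul_left_comm, h2, Nat.factorial_succ]
    have : ((k + 1 : ℕ) : K) ≠ 0 := Nat.cast_ne_zero.2 (Nat.succ_ne_zero k)
    push_cast at this ⊢
    field_simp
  rw [h1, coeff_mul]
  simp only [coeff_mul, Finset.mul_sum]
  rw [Finset.sum_comm]
  refine Finset.sum_congr rfl fun p hp => ?_
  by_cases hp1 : p.1 = 0
  · rw [hp1, euler_coeff_zero]
    simp
  · have := deg_pos hp1
    have hd := deg_fst_add_snd hp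
    rw [exp_coeff f0 (show deg p.2 < deg n by omega), Finset.mul_sum]
    exact Finset.sum_congr rfl fun _ _ => by ring

/-- Since `g` has no constant term, the equation is a recursion that expresses `deg n` times the
coefficient at `n` by coefficients in lower degrees, and `deg n` is invertible in `K` for `n ≠ 0`.
Identities between exponentials are proved below by checking that both sides solve the same
equation. -/
lemma eq_of_euler_eq_mul {g u v : QTorus 𝔰} (g0 : g.coeff 0 = 0) (hu : euler u = g * u)
    (hv : euler v = g * v) (h0 : u.coeff 0 = v.coeff 0) : u = v := by
  have key : ∀ d, Agree d u v := by
    intro d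
    induction d with
    | zero => intro n hn; omega
    | succ d ih =>
      intro n hn
      by_cases hn0 : n = 0
      · rw [hn0, h0]
      have h1 := congrArg (fun t => QTorus.coeff t n) hu
      have h2 := congrArg (fun t => QTorus.coeff t n) hv
      have h3 : (g * u).coeff n = (g * v).coeff n := by
        rw [coeff_mul, coeff_mul]
        refine Finset.sum_congr rfl fun p hp => ?_
        by_cases hp1 : p.1 = 0
        · rw [hp1, g0]
          simp
        · have := deg_pos hp1
          have hd := deg_fst_add_snd hp
          rw [ih p.2 (by omega)]
      simp only [euler_coeff] at h1 h2
      have hd : (deg n : K) ≠ 0 := Nat.cast_ne_zero.2 (deg_pos hn0).ne'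
      exact mul_left_cancel₀ hd (by rw [h1, h2, h3])
  ext n
  exact key (deg n + 1) n (Nat.lt_succ_self _)

/-- The commutative subalgebra of the formal sums in the powers of `y^n`. -/
def par (𝔰 : Seed Γ) (n : Expo r) : Subalgebra K (QTorus 𝔰) where
  carrier := {f | ∀ m, f.coeff m ≠ 0 → ∃ j : ℕ, m = j • n}
  mul_mem' := by
    intro f g hf hg m hm
    rw [coeff_mul] at hm
    obtain ⟨p, hp, hne⟩ := Finset.exists_ne_zero_of_sum_ne_zero hm
    obtain ⟨j, hj⟩ := hf p.1 (fun h => hne (by rw [h]; ring))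
    obtain ⟨k, hk⟩ := hg p.2 (fun h => hne (by rw [h]; ring))
    exact ⟨j + k, by rw [← Finset.HasAntidiagonal.mem_antidiagonal.1 hp, hj, hk, add_smul]⟩
  add_mem' := by
    intro f g hf hg m hm
    by_cases h : f.coeff m = 0
    · exact hg m fun h' => hm (by rw [coeff_add, h, h', add_zero])
    · exact hf m h
  algebraMap_mem' := by
    intro c m hm
    refine ⟨0, ?_⟩
    by_contra h
    refine hm ?_
    rw [Algebra.algebraMap_eq_smul_one, coeff_smul, coeff_one, if_neg (by simpa using h), mul_zero]

/-- By skew-symmetry `{j n, k n} = 0`, so no power of `q` appears. -/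
lemma par_commute {n : Expo r} {f g : QTorus 𝔰} (hf : f ∈ par 𝔰 n) (hg : g ∈ par 𝔰 n) :
    Commute f g := by
  ext m
  have hswap := Finsupp.sum_antidiagonal_swap m
    (fun a b => Γ.qpow (𝔰.form a b) * g.coeff a * f.coeff b)
  rw [coeff_mul, coeff_mul, hswap]
  refine Finset.sum_congr rfl fun p _ => ?_
  by_cases h1 : f.coeff p.1 = 0
  · rw [h1]; ring
  by_cases h2 : g.coeff p.2 = 0
  · rw [h2]; ring
  obtain ⟨j, hj⟩ := hf _ h1
  obtain ⟨k, hk⟩ := hg _ h2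
  rw [𝔰.qpow_form, 𝔰.qpow_form, hj, hk, 𝔰.iform_nsmul_nsmul, 𝔰.iform_nsmul_nsmul]
  ring

lemma euler_mem_par {n : Expo r} {f : QTorus 𝔰} (hf : f ∈ par 𝔰 n) : euler f ∈ par 𝔰 n :=
  fun m hm => hf m fun h => hm (by rw [euler_coeff, h, mul_zero])

lemma exp_mem_par {n : Expo r} {f : QTorus 𝔰} (hf : f ∈ par 𝔰 n) : exp f ∈ par 𝔰 n := by
  intro m hm
  change ∑ k ∈ Finset.range (deg m + 1), (k.factorial : K)⁻¹ * (f ^ k).coeff m ≠ 0 at hm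
  obtain ⟨k, _, hne⟩ := Finset.exists_ne_zero_of_sum_ne_zero hm
  exact (par 𝔰 n).pow_mem hf k m fun h => hne (by rw [h, mul_zero])

/-- Both sides have constant term `1` and logarithmic derivative `euler (f + g)`. -/
lemma exp_add_of_mem_par {n : Expo r} {f g : QTorus 𝔰} (hf : f ∈ par 𝔰 n) (hg : g ∈ par 𝔰 n)
    (f0 : f.coeff 0 = 0) (g0 : g.coeff 0 = 0) : exp (f + g) = exp f * exp g := by
  have hfg := (par 𝔰 n).add_mem hf hg
  refine eq_of_euler_eq_mul (g := euler (f + g)) (euler_coeff_zero _)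
    (euler_exp (by rw [coeff_add, f0, g0, add_zero]) (par_commute hfg (euler_mem_par hfg))) ?_ ?_
  · rw [euler_mul, euler_exp f0 (par_commute hf (euler_mem_par hf)),
      euler_exp g0 (par_commute hg (euler_mem_par hg)), euler_add, add_mul, ← mul_assoc, ← mul_assoc,
      (par_commute (exp_mem_par hf) (euler_mem_par hg)).eq, ← mul_assoc]
  · simp [coeff_mul_zero, exp_coeff_zero]

lemma Agree.symm {d : ℕ} {f g : QTorus 𝔰} (h : Agree d f g) : Agree d g f :=
  fun n hn => (h n hn).symm

/-- The difference `f - exp f` depends in each degree only on lower degrees of `f`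
(`exp_sub_agree`), so agreement passes in either direction one degree at a time. -/
lemma exp_agree_iff {d : ℕ} {f g : QTorus 𝔰} (f0 : f.coeff 0 = 0) (g0 : g.coeff 0 = 0) :
    Agree d (exp f) (exp g) ↔ Agree d f g := by
  have key : ∀ k ≤ d, Agree d (exp f) (exp g) → Agree k f g := by
    intro k
    induction k with
    | zero => intro _ _ n hn; omega
    | succ k ih =>
      intro hk h n hn
      have h1 := exp_sub_agree (ih (by omega) h) f0 g0 n hn
      rw [coeff_sub, coeff_sub, h n (by omega)] at h1
      exact sub_left_injective h1
  refine ⟨key d le_rfl, fun h n hn => ?_⟩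
  have h1 := exp_sub_agree h f0 g0 n (by omega)
  rw [coeff_sub, coeff_sub, h n hn] at h1
  exact sub_right_injective h1

end QTorus

lemma OneUnit.coe_mul {𝔰 : Seed Γ} (u v : OneUnit 𝔰) :
    ((u * v : OneUnit 𝔰) : QTorus 𝔰) = (u : QTorus 𝔰) * v := rfl

lemma OneUnit.coe_one {𝔰 : Seed Γ} : ((1 : OneUnit 𝔰) : QTorus 𝔰) = 1 := rfl

/-- Compare `u⁻¹ v v⁻¹` with `u⁻¹ u v⁻¹`, which differ only in the middle factor. -/
lemma OneUnit.agree_inv {𝔰 : Seed Γ} {d : ℕ} {u v : OneUnit 𝔰} (h : QTorus.Agree d u.1 v.1) :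
    QTorus.Agree d (u⁻¹).1 (v⁻¹).1 := by
  have h1 : u⁻¹ = u⁻¹ * v * v⁻¹ := by group
  have h2 : v⁻¹ = u⁻¹ * u * v⁻¹ := by group
  rw [h1]
  nth_rewrite 2 [h2]
  simp only [OneUnit.coe_mul]
  have hr : ∀ f : QTorus 𝔰, QTorus.Agree d f f := fun _ _ _ => rfl
  exact ((hr _).mul h.symm).mul (hr _)

namespace LieHat

variable {𝔰 : Seed Γ}

lemma add_apply (X Y : LieHat 𝔰) (n : NPlus r) : (X + Y) n = X n + Y n := rfl

lemma zero_apply (n : NPlus r) : (0 : LieHat 𝔰) n = 0 := rfl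

lemma sum_apply {ι : Type*} (s : Finset ι) (X : ι → LieHat 𝔰) (n : NPlus r) :
    (∑ i ∈ s, X i) n = ∑ i ∈ s, X i n := Finset.sum_apply n s X

lemma emb_zero : (0 : LieHat 𝔰).emb = 0 := by
  have := emb_add (0 : LieHat 𝔰) 0
  simpa using this

/-- The abelian subalgebra of the sums `∑ c_j X_{j n}`. -/
def par (𝔰 : Seed Γ) (n : Expo r) : Submodule K (LieHat 𝔰) where
  carrier := {X | ∀ m : NPlus r, X m ≠ 0 → ∃ j : ℕ, m.1 = j • n}
  add_mem' := by
    intro X Y hX hY m hm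
    by_cases h : X m = 0
    · exact hY m fun h' => hm (by rw [add_apply, h, h', add_zero])
    · exact hX m h
  zero_mem' := fun m hm => absurd rfl hm
  smul_mem' := by
    intro c X hX m hm
    exact hX m fun h => hm (by rw [smul_apply, h, mul_zero])

lemma emb_mem_par {n : Expo r} {X : LieHat 𝔰} (hX : X ∈ par 𝔰 n) : X.emb ∈ QTorus.par 𝔰 n := by
  intro m hm
  by_cases h : m = 0
  · exact ⟨0, by simp [h]⟩
  · refine hX ⟨m, h⟩ fun h0 => hm ?_
    rw [emb_coeff _ ⟨m, h⟩, h0, zero_div]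

lemma emb_agree_iff {l : ℕ} {X Y : LieHat 𝔰} :
    QTorus.Agree (l + 1) X.emb Y.emb ↔ ∀ m : NPlus r, deg m.1 ≤ l → X m = Y m := by
  constructor
  · intro h m hm
    have h1 := h m.1 (by omega)
    rw [emb_coeff, emb_coeff] at h1
    exact (div_left_inj' Γ.qpow_one_sub_ne_zero).1 h1
  · intro h n hn
    by_cases hn0 : n = 0
    · rw [hn0, emb_coeff_zero, emb_coeff_zero]
    · rw [emb_coeff _ ⟨n, hn0⟩, emb_coeff _ ⟨n, hn0⟩, h ⟨n, hn0⟩ (by omega : deg n ≤ l)]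

end LieHat

/-! ### Truncations of the structure group, seen in the quantum torus -/

namespace StructureGroup

variable {𝔰 : Seed Γ}

@[ext] lemma ext' {g h : StructureGroup 𝔰} (e : g.log = h.log) : g = h := by
  cases g; cases h; congr

/-- The isomorphism `exp X ↦ e^X` onto the formal sums with constant term `1`. -/
def toUnit (𝔰 : Seed Γ) : StructureGroup 𝔰 ≃* OneUnit 𝔰 :=
  { equivUnit 𝔰 with
    map_mul' := fun _ _ => (equivUnit 𝔰).apply_symm_apply _ }

lemma toUnit_coe (g : StructureGroup 𝔰) : (toUnit 𝔰 g).1 = QTorus.exp g.log.emb := rfl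

lemma log_one : (1 : StructureGroup 𝔰).log = 0 := by
  have h : toUnit 𝔰 ⟨0⟩ = 1 := Subtype.ext (by
    rw [toUnit_coe, LieHat.emb_zero, QTorus.exp_zero, OneUnit.coe_one])
  rw [← map_one (toUnit 𝔰)] at h
  rw [← (toUnit 𝔰).injective h]

/-- On an abelian subalgebra all brackets in the Baker–Campbell–Hausdorff series vanish. -/
lemma mk_mul_mk {n : Expo r} {X Y : LieHat 𝔰} (hX : X ∈ LieHat.par 𝔰 n)
    (hY : Y ∈ LieHat.par 𝔰 n) : (⟨X⟩ * ⟨Y⟩ : StructureGroup 𝔰) = ⟨X + Y⟩ := by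
  refine (toUnit 𝔰).injective (Subtype.ext ?_)
  rw [map_mul, OneUnit.coe_mul, toUnit_coe, toUnit_coe, toUnit_coe, LieHat.emb_add,
    QTorus.exp_add_of_mem_par (LieHat.emb_mem_par hX) (LieHat.emb_mem_par hY)
      (LieHat.emb_coeff_zero _) (LieHat.emb_coeff_zero _)]

lemma mk_zero : (⟨0⟩ : StructureGroup 𝔰) = 1 := ext' log_one.symm

lemma mk_inv {n : Expo r} {X : LieHat 𝔰} (hX : X ∈ LieHat.par 𝔰 n) :
    (⟨X⟩⁻¹ : StructureGroup 𝔰) = ⟨-X⟩ := by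
  rw [inv_eq_iff_mul_eq_one, mk_mul_mk hX ((LieHat.par 𝔰 n).neg_mem hX), add_neg_cancel, mk_zero]

lemma mk_list_prod {n : Expo r} (L : List (LieHat 𝔰)) (hL : ∀ X ∈ L, X ∈ LieHat.par 𝔰 n) :
    (L.map StructureGroup.mk).prod = ⟨L.sum⟩ := by
  induction L with
  | nil => simp [mk_zero]
  | cons X L ih =>
    rw [List.map_cons, List.prod_cons, List.sum_cons, ih fun Y hY => hL Y (List.mem_cons_of_mem _ hY),
      mk_mul_mk (hL X List.mem_cons_self)]
    exact list_sum_mem fun Y hY => hL Y (List.mem_cons_of_mem _ hY)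

/-- Truncated equality can be tested on series, where products are explicit, or on logarithms, where
the subgroups `G^{>l}` are defined. -/
lemma agree_iff {l : ℕ} {g h : StructureGroup 𝔰} :
    QTorus.Agree (l + 1) (toUnit 𝔰 g).1 (toUnit 𝔰 h).1 ↔
      ∀ m : NPlus r, deg m.1 ≤ l → g.log m = h.log m := by
  rw [toUnit_coe, toUnit_coe, QTorus.exp_agree_iff (LieHat.emb_coeff_zero _)
    (LieHat.emb_coeff_zero _), LieHat.emb_agree_iff]

lemma mem_Gtail_iff {l : ℕ} {g : StructureGroup 𝔰} :
    g ∈ Gtail 𝔰 l ↔ QTorus.Agree (l + 1) (toUnit 𝔰 g).1 1 := by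
  rw [← OneUnit.coe_one, ← map_one (toUnit 𝔰), agree_iff, log_one]
  rfl

lemma eqMod_iff_agree {l : ℕ} {g h : StructureGroup 𝔰} :
    EqMod l g h ↔ QTorus.Agree (l + 1) (toUnit 𝔰 g).1 (toUnit 𝔰 h).1 := by
  have hr : ∀ f : QTorus 𝔰, QTorus.Agree (l + 1) f f := fun _ _ _ => rfl
  rw [EqMod, mem_Gtail_iff, map_mul, OneUnit.coe_mul]
  constructor
  · intro h1
    have h2 := (hr (toUnit 𝔰 g).1).mul h1
    rw [← mul_assoc, ← OneUnit.coe_mul, ← map_mul, mul_inv_cancel, map_one, OneUnit.coe_one,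
      one_mul, mul_one] at h2
    exact h2.symm
  · intro h1
    have h2 := (hr (toUnit 𝔰 g⁻¹).1).mul h1.symm
    rwa [← OneUnit.coe_mul _ (toUnit 𝔰 g), ← map_mul, inv_mul_cancel, map_one,
      OneUnit.coe_one] at h2

lemma eqMod_iff {l : ℕ} {g h : StructureGroup 𝔰} :
    EqMod l g h ↔ ∀ m : NPlus r, deg m.1 ≤ l → g.log m = h.log m :=
  eqMod_iff_agree.trans agree_iff

lemma EqMod.refl (l : ℕ) (g : StructureGroup 𝔰) : EqMod l g g :=
  eqMod_iff.2 fun _ _ => rfl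

lemma EqMod.symm {l : ℕ} {g h : StructureGroup 𝔰} (e : EqMod l g h) : EqMod l h g :=
  eqMod_iff.2 fun m hm => (eqMod_iff.1 e m hm).symm

lemma EqMod.trans {l : ℕ} {g h k : StructureGroup 𝔰} (e : EqMod l g h) (e' : EqMod l h k) :
    EqMod l g k :=
  eqMod_iff.2 fun m hm => (eqMod_iff.1 e m hm).trans (eqMod_iff.1 e' m hm)

lemma EqMod.mul {l : ℕ} {g g' h h' : StructureGroup 𝔰} (e : EqMod l g g') (e' : EqMod l h h') :
    EqMod l (g * h) (g' * h') := by
  rw [eqMod_iff_agree] at *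
  rw [map_mul, map_mul, OneUnit.coe_mul, OneUnit.coe_mul]
  exact e.mul e'

lemma EqMod.mono {l l' : ℕ} (hl : l ≤ l') {g h : StructureGroup 𝔰} (e : EqMod l' g h) :
    EqMod l g h :=
  eqMod_iff.2 fun m hm => eqMod_iff.1 e m (hm.trans hl)

lemma eqMod_one_iff {l : ℕ} {g : StructureGroup 𝔰} : EqMod l g 1 ↔ g ∈ Gtail 𝔰 l := by
  rw [eqMod_iff, log_one]
  rfl

end StructureGroup

/-! ### Integral Laurent polynomials in `q^{1/δ₀}` -/

lemma X_zpow_sub_ne_zero {k : ℕ} (hk : 0 < k) :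
    (RatFunc.X : K) ^ (k : ℤ) - RatFunc.X ^ (-(k : ℤ)) ≠ 0 := by
  intro h
  have h1 : (RatFunc.X : K) ^ (k : ℤ) = RatFunc.X ^ (-(k : ℤ)) := sub_eq_zero.1 h
  have h2 : (RatFunc.X : K) ^ (k + k) = 1 := by
    rw [pow_add, ← zpow_natCast]
    nth_rewrite 1 [h1]
    rw [← zpow_add₀ RatFunc.X_ne_zero, neg_add_cancel, zpow_zero]
  have h4 : (algebraMap (Polynomial ℚ) (RatFunc ℚ)) (Polynomial.X ^ (k + k)) =
      algebraMap (Polynomial ℚ) (RatFunc ℚ) 1 := by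
    simpa [RatFunc.algebraMap_X] using h2
  have h5 := congrArg Polynomial.natDegree (RatFunc.algebraMap_injective ℚ h4)
  simp at h5
  omega

/-- The subring `ℤ[q^{±1/δ₀}]` of `K`. -/
def intRing : Subring K := Subring.closure (Set.range fun b : ℤ => (RatFunc.X : K) ^ b)

lemma X_zpow_mem (b : ℤ) : (RatFunc.X : K) ^ b ∈ intRing := Subring.subset_closure ⟨b, rfl⟩

/-- The Laurent polynomial `∑ c_b q^{b/δ₀}`. -/
def laurent (c : ℤ →₀ ℤ) : K := c.sum fun b k => (k : K) * RatFunc.X ^ b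

lemma exists_laurent_eq {x : K} (hx : x ∈ intRing) : ∃ c, laurent c = x := by
  -- Products of monomials are monomials, so the subring is the additive group generated by them.
  have hM : (Submonoid.closure (Set.range fun b : ℤ => (RatFunc.X : K) ^ b) : Set K) ⊆
      Set.range fun b : ℤ => (RatFunc.X : K) ^ b := by
    intro y hy
    induction hy using Submonoid.closure_induction with
    | mem y hy => exact hy
    | one => exact ⟨0, by simp⟩
    | mul y z _ _ hy hz =>
      obtain ⟨a, rfl⟩ := hy
      obtain ⟨b, rfl⟩ := hz
      exact ⟨a + b, zpow_add₀ RatFunc.X_ne_zero a b⟩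
  rw [intRing, Subring.mem_closure_iff] at hx
  have hadd : ∀ c d : ℤ →₀ ℤ, laurent (c + d) = laurent c + laurent d := fun c d =>
    Finsupp.sum_add_index' (by simp) (by intros; push_cast; ring)
  induction hx using AddSubgroup.closure_induction with
  | mem x hx =>
    obtain ⟨b, rfl⟩ := hM hx
    exact ⟨Finsupp.single b 1, by simp [laurent]⟩
  | zero => exact ⟨0, by simp [laurent]⟩
  | add x y _ _ hx hy =>
    obtain ⟨c, rfl⟩ := hx
    obtain ⟨d, rfl⟩ := hy
    exact ⟨c + d, hadd c d⟩
  | neg x _ hx =>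
    obtain ⟨c, rfl⟩ := hx
    refine ⟨-c, ?_⟩
    rw [eq_neg_iff_add_eq_zero, ← hadd, neg_add_cancel]
    simp [laurent]

/-! ### Twists of the quantum torus -/

/-- The integer `δ₀ / δ_i`. -/
def FixedData.cofactor (Γ : FixedData r N) (i : Fin r) : ℕ := Γ.δ₀ / Γ.δ i

lemma FixedData.δ_mul_cofactor (Γ : FixedData r N) (i : Fin r) :
    Γ.δ i * Γ.cofactor i = Γ.δ₀ :=
  Nat.mul_div_cancel' (Finset.dvd_lcm (Finset.mem_univ i))

/-- The character `n ↦ 2 δ₀ ⟨n, φ⟩` for the element `φ` of the dual lattice of `N°` with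
`⟨e_i, φ⟩ = φ_i / δ_i`. -/
def charOf (Γ : FixedData r N) (φ : Fin r → ℤ) : Expo r →+ ℤ where
  toFun n := 2 * ∑ i, (n i : ℤ) * (φ i * Γ.cofactor i)
  map_zero' := by simp
  map_add' a b := by
    simp only [Finsupp.add_apply, Nat.cast_add, add_mul, Finset.sum_add_distrib, mul_add]

lemma charOf_apply (φ : Fin r → ℤ) (n : Expo r) :
    charOf Γ φ n = 2 * ∑ i, (n i : ℤ) * (φ i * Γ.cofactor i) := rfl

/-- The character `n ↦ 2 δ₀ {m, n}`. -/
def Seed.formChar (𝔰 : Seed Γ) (m : Expo r) : Expo r →+ ℤ where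
  toFun n := 2 * 𝔰.iform m n
  map_zero' := by rw [𝔰.iform_zero_right, mul_zero]
  map_add' a b := by rw [𝔰.iform_add_right, mul_add]

/-- From `{δ_i e_i, N} ⊆ ℤ` the number `{m, e_i}` lies in `(1/δ_i)ℤ`, so `{m, ·}` belongs to the
dual lattice of `N°`. Conjugation by monomials therefore stays within the twists that define
integrality. -/
lemma Seed.exists_charOf_eq_formChar (𝔰 : Seed Γ) (m : Expo r) :
    ∃ φ, charOf Γ φ = 𝔰.formChar m := by
  have h : ∀ i, ∃ k : ℤ, 𝔰.iform m (Finsupp.single i 1) = k * Γ.cofactor i := by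
    intro i
    have hmem : Γ.δ i • 𝔰.e i ∈ Γ.Ncirc := by
      rw [𝔰.Ncirc_eq]
      exact AddSubgroup.subset_closure ⟨i, rfl⟩
    obtain ⟨k, hk⟩ := Γ.form_int _ hmem (𝔰.vec m)
    refine ⟨-k, ?_⟩
    have hv : 𝔰.vec (Finsupp.single i 1) = 𝔰.e i := by
      rw [Seed.vec, Finset.sum_eq_single i]
      · simp
      · intro j _ hj
        simp [Finsupp.single_eq_of_ne hj]
      · simp
    have h1 : (𝔰.iform m (Finsupp.single i 1) : ℚ) = (-k : ℤ) * Γ.cofactor i := by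
      rw [𝔰.iform_cast, Seed.form, hv, Γ.form_skew, ← Γ.δ_mul_cofactor i]
      push_cast
      rw [← hk, map_nsmul, AddMonoidHom.nsmul_apply, nsmul_eq_mul]
      ring
    exact_mod_cast h1
  choose φ hφ using h
  refine ⟨φ, Finsupp.addHom_ext' fun i => AddMonoidHom.ext_nat ?_⟩
  change charOf Γ φ (Finsupp.single i 1) = 2 * 𝔰.iform m (Finsupp.single i 1)
  rw [hφ, charOf_apply, Finset.sum_eq_single i]
  · simp
  · intro j _ hj
    simp [Finsupp.single_eq_of_ne hj]
  · simp

lemma charOf_add (φ ψ : Fin r → ℤ) : charOf Γ (φ + ψ) = charOf Γ φ + charOf Γ ψ := by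
  ext i
  simp [charOf_apply, add_mul, mul_add, Finset.sum_add_distrib]

namespace QTorus

variable {𝔰 : Seed Γ}

/-- The ring automorphism `y^n ↦ q^{χ(n)/δ₀} y^n`. -/
def tau (χ : Expo r →+ ℤ) : QTorus 𝔰 →+* QTorus 𝔰 where
  toFun f := ⟨fun n => RatFunc.X ^ χ n * f.coeff n⟩
  map_one' := by
    ext n
    change RatFunc.X ^ χ n * (1 : QTorus 𝔰).coeff n = _
    rw [coeff_one]
    split_ifs with h
    · simp [h]
    · simp
  map_zero' := by
    ext n
    exact mul_zero _
  map_add' f g := by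
    ext n
    exact mul_add _ _ _
  map_mul' f g := by
    ext n
    change RatFunc.X ^ χ n * (f * g).coeff n = _
    rw [coeff_mul, coeff_mul, Finset.mul_sum]
    refine Finset.sum_congr rfl fun p hp => ?_
    change _ = _ * (RatFunc.X ^ χ p.1 * f.coeff p.1) * (RatFunc.X ^ χ p.2 * g.coeff p.2)
    rw [← Finset.HasAntidiagonal.mem_antidiagonal.1 hp, map_add, zpow_add₀ RatFunc.X_ne_zero]
    ring

lemma tau_coeff (χ : Expo r →+ ℤ) (f : QTorus 𝔰) (n : Expo r) :
    (tau χ f).coeff n = RatFunc.X ^ χ n * f.coeff n := rfl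

lemma tau_tau (χ ψ : Expo r →+ ℤ) (f : QTorus 𝔰) : tau χ (tau ψ f) = tau (χ + ψ) f := by
  ext n
  rw [tau_coeff, tau_coeff, tau_coeff, AddMonoidHom.add_apply, zpow_add₀ RatFunc.X_ne_zero]
  ring

lemma tau_exp (χ : Expo r →+ ℤ) (f : QTorus 𝔰) : tau χ (exp f) = exp (tau χ f) := by
  ext n
  change RatFunc.X ^ χ n * ∑ k ∈ Finset.range (deg n + 1), (k.factorial : K)⁻¹ * (f ^ k).coeff n =
    ∑ k ∈ Finset.range (deg n + 1), (k.factorial : K)⁻¹ * (tau χ f ^ k).coeff n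
  rw [Finset.mul_sum]
  refine Finset.sum_congr rfl fun k _ => ?_
  rw [← map_pow, tau_coeff]
  ring

lemma tau_mem_par {n : Expo r} {f : QTorus 𝔰} (hf : f ∈ par 𝔰 n) (χ : Expo r →+ ℤ) :
    tau χ f ∈ par 𝔰 n :=
  fun m hm => hf m fun h => hm (by rw [tau_coeff, h, mul_zero])

lemma Agree.tau {d : ℕ} {f g : QTorus 𝔰} (h : Agree d f g) (χ : Expo r →+ ℤ) :
    Agree d (tau χ f) (tau χ g) := fun n hn => by rw [tau_coeff, tau_coeff, h n hn]

/-- The coefficients of a product `u B w`, expressed by those of `B` and of the products of `u`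
with twists of `w`. -/
lemma coeff_mul_mul (u B w : QTorus 𝔰) (n : Expo r) : (u * B * w).coeff n =
    ∑ p ∈ Finset.HasAntidiagonal.antidiagonal n,
      RatFunc.X ^ 𝔰.iform p.2 p.1 * B.coeff p.1 * (u * tau (𝔰.formChar p.1) w).coeff p.2 := by
  simp only [coeff_mul', Finset.sum_mul, Finset.mul_sum, Finset.sum_sigma']
  refine Finset.sum_nbij' (fun ⟨⟨_i, j⟩, ⟨k, l⟩⟩ ↦ ⟨(l, k + j), (k, j)⟩)
    (fun ⟨⟨i, _j⟩, ⟨k, l⟩⟩ ↦ ⟨(k + i, l), (k, i)⟩) ?_ ?_ ?_ ?_ ?_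
  · rintro ⟨⟨i, j⟩, ⟨k, l⟩⟩ hx
    simp only [Finset.mem_sigma, Finset.HasAntidiagonal.mem_antidiagonal] at hx ⊢
    obtain ⟨rfl, rfl⟩ := hx
    simp [add_assoc, add_left_comm]
  · rintro ⟨⟨i, j⟩, ⟨k, l⟩⟩ hx
    simp only [Finset.mem_sigma, Finset.HasAntidiagonal.mem_antidiagonal] at hx ⊢
    obtain ⟨rfl, rfl⟩ := hx
    simp [add_assoc, add_left_comm]
  · rintro ⟨⟨i, j⟩, ⟨k, l⟩⟩ hx
    simp only [Finset.mem_sigma, Finset.HasAntidiagonal.mem_antidiagonal] at hx ⊢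
    obtain ⟨rfl, rfl⟩ := hx
    rfl
  · rintro ⟨⟨i, j⟩, ⟨k, l⟩⟩ hx
    simp only [Finset.mem_sigma, Finset.HasAntidiagonal.mem_antidiagonal] at hx ⊢
    obtain ⟨rfl, rfl⟩ := hx
    rfl
  · rintro ⟨⟨i, j⟩, ⟨k, l⟩⟩ hx
    simp only [Finset.mem_sigma, Finset.HasAntidiagonal.mem_antidiagonal] at hx ⊢
    obtain ⟨rfl, rfl⟩ := hx
    have hf : 𝔰.formChar l j = 2 * 𝔰.iform l j := rfl
    -- Here `y^l` is moved to the right past `y^j`, which costs `q^{2{l,j}}`; this factor is the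
    -- twist of `w`.
    have e : (RatFunc.X : K) ^ 𝔰.iform (k + l) j * RatFunc.X ^ 𝔰.iform k l =
        RatFunc.X ^ 𝔰.iform (k + j) l * RatFunc.X ^ 𝔰.iform k j * RatFunc.X ^ 𝔰.formChar l j := by
      rw [hf, ← zpow_add₀ RatFunc.X_ne_zero, ← zpow_add₀ RatFunc.X_ne_zero,
        ← zpow_add₀ RatFunc.X_ne_zero, 𝔰.iform_add_left, 𝔰.iform_add_left, 𝔰.iform_skew j l]
      congr 1
      ring
    rw [tau_coeff]
    linear_combination (u.coeff k * B.coeff l * w.coeff j) * e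

end QTorus

/-! ### Integral elements of the structure group -/

namespace OneUnit

variable {𝔰 : Seed Γ}

/-- The action of a twist on the formal sums with constant term `1`. -/
def tau (χ : Expo r →+ ℤ) : OneUnit 𝔰 →* OneUnit 𝔰 where
  toFun u := ⟨QTorus.tau χ u.1, by rw [QTorus.tau_coeff, map_zero, u.2, zpow_zero, mul_one]⟩
  map_one' := Subtype.ext (map_one (QTorus.tau χ))
  map_mul' u v := Subtype.ext (map_mul (QTorus.tau χ) u.1 v.1)

lemma tau_coe (χ : Expo r →+ ℤ) (u : OneUnit 𝔰) : (tau χ u).1 = QTorus.tau χ u.1 := rfl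

/-- The cocycle `u · τ_φ(u)⁻¹`. -/
def defect (φ : Fin r → ℤ) (u : OneUnit 𝔰) : OneUnit 𝔰 := u * (tau (charOf Γ φ) u)⁻¹

/-- The cocycles of `u` have integral coefficients in degrees `≤ l`. -/
def IsIntegral (l : ℕ) (u : OneUnit 𝔰) : Prop :=
  ∀ φ n, deg n ≤ l → (defect φ u).1.coeff n ∈ intRing

lemma defect_agree {d : ℕ} {u v : OneUnit 𝔰} (h : QTorus.Agree d u.1 v.1) (φ : Fin r → ℤ) :
    QTorus.Agree d (defect φ u).1 (defect φ v).1 := by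
  rw [defect, defect, coe_mul, coe_mul]
  exact h.mul (agree_inv (h.tau _))

lemma IsIntegral.congr {l : ℕ} {u v : OneUnit 𝔰} (hu : IsIntegral l u)
    (h : QTorus.Agree (l + 1) u.1 v.1) : IsIntegral l v := fun φ n hn => by
  rw [← defect_agree h φ n (by omega)]
  exact hu φ n hn

lemma IsIntegral.mono {l l' : ℕ} (h : l ≤ l') {u : OneUnit 𝔰} (hu : IsIntegral l' u) :
    IsIntegral l u := fun φ n hn => hu φ n (hn.trans h)

/-- Every cocycle has constant term `1`. This starts the inductions on the degree. -/
lemma isIntegral_zero (u : OneUnit 𝔰) : IsIntegral 0 u := by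
  intro φ n hn
  rw [deg_eq_zero.1 (Nat.le_zero.1 hn), (defect φ u).2]
  exact intRing.one_mem

lemma defect_one (φ : Fin r → ℤ) : defect φ (1 : OneUnit 𝔰) = 1 := by simp [defect]

lemma coeff_one_mem (n : Expo r) : (1 : OneUnit 𝔰).1.coeff n ∈ intRing := by
  rw [coe_one, QTorus.coeff_one]
  split_ifs
  · exact intRing.one_mem
  · exact intRing.zero_mem

lemma isIntegral_one (l : ℕ) : IsIntegral l (1 : OneUnit 𝔰) := fun φ n _ => by
  rw [defect_one]
  exact coeff_one_mem n

/-- Modulo integral elements, the first non-integral coefficients of the cocycles are additive. -/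
lemma IsIntegral.coeff_defect_mul {l : ℕ} {u v : OneUnit 𝔰} (hu : IsIntegral l u)
    (hv : IsIntegral l v) (φ : Fin r → ℤ) {n : Expo r} (hn : deg n ≤ l + 1) :
    (defect φ (u * v)).1.coeff n - (defect φ u).1.coeff n - (defect φ v).1.coeff n ∈ intRing := by
  by_cases hn0 : n = 0
  · rw [hn0, (defect φ _).2, (defect φ _).2, (defect φ _).2]
    exact intRing.sub_mem (intRing.sub_mem intRing.one_mem intRing.one_mem) intRing.one_mem
  -- The cocycle of `v` stands between `u` and `τ_φ(u)⁻¹`, so `coeff_mul_mul` applies with it as the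
  -- middle factor.
  have e : (defect φ (u * v)).1 = u.1 * (defect φ v).1 * ((tau (charOf Γ φ) u)⁻¹).1 := by
    rw [← coe_mul, ← coe_mul]
    congr 1
    rw [defect, defect, map_mul]
    group
  rw [e, QTorus.coeff_mul_mul]
  have hne : ((0, n) : Expo r × Expo r) ≠ (n, 0) := fun h => hn0 (congrArg Prod.snd h)
  have hz : 𝔰.formChar 0 = 0 := by
    ext i
    simp [Seed.formChar, Seed.iform_zero_left]
  have ht : ∀ f : QTorus 𝔰, QTorus.tau 0 f = f := fun f => by
    ext k
    simp [QTorus.tau_coeff]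
  -- The two extreme terms are the coefficients at `n` of the cocycles of `u` and of `v`. All other
  -- terms involve only degrees at most `l`.
  rw [← Finset.add_sum_erase _ _ (show (0, n) ∈ Finset.HasAntidiagonal.antidiagonal n by simp),
    ← Finset.add_sum_erase _ _ (show (n, 0) ∈
      (Finset.HasAntidiagonal.antidiagonal n).erase (0, n) from
      Finset.mem_erase.2 ⟨hne.symm, by simp⟩)]
  have h1 : RatFunc.X ^ 𝔰.iform n 0 * (defect φ v).1.coeff 0 *
      (u.1 * QTorus.tau (𝔰.formChar 0) ((tau (charOf Γ φ) u)⁻¹).1).coeff n =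
      (defect φ u).1.coeff n := by
    rw [𝔰.iform_zero_right, (defect φ v).2, hz, ht, ← coe_mul, zpow_zero, one_mul, one_mul]
    rfl
  have h2 : RatFunc.X ^ 𝔰.iform 0 n * (defect φ v).1.coeff n *
      (u.1 * QTorus.tau (𝔰.formChar n) ((tau (charOf Γ φ) u)⁻¹).1).coeff 0 =
      (defect φ v).1.coeff n := by
    rw [𝔰.iform_zero_left, ← tau_coe, ← coe_mul,
      (u * tau (𝔰.formChar n) (tau (charOf Γ φ) u)⁻¹).2, zpow_zero, one_mul, mul_one]
  rw [h1, h2]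
  have h3 : ∀ a b c : K, a + (b + c) - a - b = c := fun a b c => by ring
  rw [h3]
  refine intRing.sum_mem fun p hp => ?_
  simp only [Finset.mem_erase] at hp
  obtain ⟨hp1, hp2, hp⟩ := hp
  have hd := deg_fst_add_snd hp
  have hs := Finset.HasAntidiagonal.mem_antidiagonal.1 hp
  have h01 : p.1 ≠ 0 := fun h => hp2 (Prod.ext h (by rw [← hs, h, zero_add]))
  have h02 : p.2 ≠ 0 := fun h => hp1 (Prod.ext (by rw [← hs, h, add_zero]) h)
  have := deg_pos h01
  have := deg_pos h02
  refine intRing.mul_mem (intRing.mul_mem (X_zpow_mem _) (hv φ _ (by omega))) ?_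
  -- The twist by `{p.1, ·}` is some `τ_ψ`, and `u · τ_ψ(τ_φ(u))⁻¹` is the cocycle of `u` for `ψ +
  -- φ`, integral in this degree by hypothesis.
  obtain ⟨ψ, hψ⟩ := 𝔰.exists_charOf_eq_formChar p.1
  have h4 : u.1 * QTorus.tau (𝔰.formChar p.1) ((tau (charOf Γ φ) u)⁻¹).1 = (defect (ψ + φ) u).1 := by
    rw [← tau_coe, ← coe_mul, map_inv, defect, charOf_add, hψ]
    congr 3
    exact Subtype.ext (QTorus.tau_tau _ _ _)
  rw [h4]
  exact hu _ _ (by omega)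

lemma IsIntegral.mul {l : ℕ} {u v : OneUnit 𝔰} (hu : IsIntegral l u) (hv : IsIntegral l v) :
    IsIntegral l (u * v) := by
  intro φ n hn
  have h := hu.coeff_defect_mul hv φ (show deg n ≤ l + 1 by omega)
  have h1 := intRing.add_mem (intRing.add_mem h (hv φ n hn)) (hu φ n hn)
  simpa using h1

/-- Apply additivity of the next coefficient to `u u⁻¹ = 1`, whose cocycles are trivial, by
induction on the degree. -/
lemma IsIntegral.inv {l : ℕ} {u : OneUnit 𝔰} (hu : IsIntegral l u) : IsIntegral l u⁻¹ := by
  induction l with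
  | zero => exact isIntegral_zero _
  | succ l ih =>
    have hu' := hu.mono (Nat.le_succ l)
    intro φ n hn
    have h := hu'.coeff_defect_mul (ih hu') φ hn
    rw [mul_inv_cancel, defect_one] at h
    have h1 := intRing.sub_mem (intRing.sub_mem (coeff_one_mem (𝔰 := 𝔰) n) (hu φ n hn)) h
    simpa using h1

lemma isIntegral_inv_iff {l : ℕ} {u : OneUnit 𝔰} : IsIntegral l u⁻¹ ↔ IsIntegral l u :=
  ⟨fun h => inv_inv u ▸ h.inv, IsIntegral.inv⟩

/-- Additivity iterated along a product: for a path-ordered product the order of the crossings has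
no influence on the first coefficients that may fail to be integral. -/
lemma isIntegral_list_prod {l : ℕ} (L : List (OneUnit 𝔰)) (hL : ∀ u ∈ L, IsIntegral l u)
    (φ : Fin r → ℤ) {n : Expo r} (hn : deg n ≤ l + 1) : IsIntegral l L.prod ∧
    (defect φ L.prod).1.coeff n - (L.map fun u => (defect φ u).1.coeff n).sum ∈ intRing := by
  induction L with
  | nil =>
    refine ⟨isIntegral_one l, ?_⟩
    rw [List.prod_nil, defect_one, List.map_nil, List.sum_nil, sub_zero]
    exact coeff_one_mem n
  | cons u L ih =>
    obtain ⟨h1, h2⟩ := ih fun v hv => hL v (List.mem_cons_of_mem _ hv)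
    have hu := hL u List.mem_cons_self
    rw [List.prod_cons, List.map_cons, List.sum_cons]
    refine ⟨hu.mul h1, ?_⟩
    have := intRing.add_mem (hu.coeff_defect_mul h1 φ hn) h2
    convert this using 1
    ring

/-- The formal sums with constant term `1` and integral coefficients. -/
def integralUnits (𝔰 : Seed Γ) : Subgroup (OneUnit 𝔰) where
  carrier := {u | ∀ n, u.1.coeff n ∈ intRing}
  one_mem' := coeff_one_mem
  mul_mem' := fun {u v} hu hv n => intRing.sum_mem fun p _ =>
    intRing.mul_mem (intRing.mul_mem (X_zpow_mem _) (hu _)) (hv _)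
  inv_mem' := by
    intro u hu
    have key : ∀ d n, deg n < d → (u⁻¹).1.coeff n ∈ intRing := by
      intro d
      induction d with
      | zero => intro n hn; omega
      | succ d ih =>
        intro n hn
        have h := congrArg (fun t => QTorus.coeff (Subtype.val t) n) (mul_inv_cancel u)
        simp only [coe_mul, QTorus.coeff_mul'] at h
        -- Solve `u u⁻¹ = 1` for the top coefficient of `u⁻¹`; as `u` has constant term `1`, no
        -- division occurs.
        rw [← Finset.add_sum_erase _ _ (show (0, n) ∈ Finset.HasAntidiagonal.antidiagonal n by simp),
          u.2, 𝔰.iform_zero_left, zpow_zero, one_mul, one_mul] at h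
        rw [eq_sub_of_add_eq h]
        refine intRing.sub_mem (coeff_one_mem n) (intRing.sum_mem fun p hp => ?_)
        rw [Finset.mem_erase] at hp
        have hd := deg_fst_add_snd hp.2
        have h01 : p.1 ≠ 0 := fun h => hp.1 (Prod.ext h (by
          rw [← Finset.HasAntidiagonal.mem_antidiagonal.1 hp.2, h, zero_add]))
        have := deg_pos h01
        exact intRing.mul_mem (intRing.mul_mem (X_zpow_mem _) (hu _)) (ih _ (by omega))
    exact fun n => key (deg n + 1) n (Nat.lt_succ_self _)

end OneUnit

/-! ### Normalization factors -/

/-- The integer `δ₀ / δ(n)`, the greatest common divisor of the `n_i δ₀ / δ_i`. -/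
def FixedData.content (Γ : FixedData r N) (n : Expo r) : ℕ :=
  (Finset.univ.gcd fun i => (n i * Γ.cofactor i : ℤ)).natAbs

lemma FixedData.content_cast (Γ : FixedData r N) (n : Expo r) :
    (Γ.content n : ℤ) = Finset.univ.gcd fun i => (n i * Γ.cofactor i : ℤ) :=
  Int.natAbs_of_nonneg (Int.nonneg_of_normalize_eq_self Finset.normalize_gcd)

lemma FixedData.content_dvd (Γ : FixedData r N) (n : Expo r) (i : Fin r) :
    (Γ.content n : ℤ) ∣ n i * Γ.cofactor i := by
  rw [Γ.content_cast]
  exact Finset.gcd_dvd (Finset.mem_univ i)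

lemma FixedData.cofactor_pos (Γ : FixedData r N) (i : Fin r) : 0 < Γ.cofactor i := by
  have h := Γ.δ_mul_cofactor i
  have := Γ.δ₀_pos
  refine Nat.pos_of_ne_zero fun h0 => ?_
  rw [h0] at h
  omega

lemma FixedData.content_pos (Γ : FixedData r N) (n : NPlus r) : 0 < Γ.content n.1 := by
  refine Nat.pos_of_ne_zero fun h => n.2 ?_
  have h1 : Finset.univ.gcd (fun i => (n.1 i * Γ.cofactor i : ℤ)) = 0 := Int.natAbs_eq_zero.1 h
  ext i
  have h2 := Finset.gcd_eq_zero_iff.1 h1 i (Finset.mem_univ i)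
  have h3 := Γ.cofactor_pos i
  rcases mul_eq_zero.1 h2 with h4 | h4
  · exact_mod_cast h4
  · exfalso
    have : Γ.cofactor i = 0 := by exact_mod_cast h4
    omega

/-- Bézout: some `φ` in the dual of `N°` takes the value `1` on `δ(n) n`. -/
lemma FixedData.exists_sum_eq_content (Γ : FixedData r N) (n : Expo r) :
    ∃ φ : Fin r → ℤ, ∑ i, (n i : ℤ) * (φ i * Γ.cofactor i) = Γ.content n := by
  obtain ⟨φ, hφ⟩ := Finset.gcd_eq_sum_mul Finset.univ fun i => (n i * Γ.cofactor i : ℤ)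
  refine ⟨φ, ?_⟩
  rw [Γ.content_cast, hφ]
  exact Finset.sum_congr rfl fun i _ => by ring

lemma exists_charOf_eq_two_mul_content (Γ : FixedData r N) (n : Expo r) :
    ∃ φ, charOf Γ φ n = 2 * Γ.content n := by
  obtain ⟨φ, hφ⟩ := Γ.exists_sum_eq_content n
  exact ⟨φ, by rw [charOf_apply, hφ]⟩

/-- The integer is `k = ⟨δ(n) n, φ⟩`. Its absolute value is the number of binomials in the cocycle
of a dilogarithm along `n`. -/
lemma exists_charOf_eq_content_mul (φ : Fin r → ℤ) (n : Expo r) :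
    ∃ k : ℤ, charOf Γ φ n = 2 * Γ.content n * k := by
  have h : (Γ.content n : ℤ) ∣ ∑ i, (n i : ℤ) * (φ i * Γ.cofactor i) :=
    Finset.dvd_sum fun i _ => by
      have := (Γ.content_dvd n i).mul_right (φ i)
      convert this using 1
      ring
  obtain ⟨k, hk⟩ := h
  exact ⟨k, by rw [charOf_apply, hk, mul_assoc]⟩

/-- The normalization factor `δ(n)`. -/
def FixedData.normFactor (Γ : FixedData r N) (n : Expo r) : ℚ := Γ.δ₀ / Γ.content n

lemma Seed.mem_Ncirc_iff (𝔰 : Seed Γ) (m : N) :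
    m ∈ Γ.Ncirc ↔ ∀ i, (Γ.δ i : ℤ) ∣ 𝔰.e.repr m i := by
  rw [𝔰.Ncirc_eq]
  constructor
  · intro h i
    induction h using AddSubgroup.closure_induction with
    | mem x hx =>
      obtain ⟨j, rfl⟩ := hx
      simp only [map_nsmul, Module.Basis.repr_self, Finsupp.smul_apply]
      by_cases hij : j = i
      · subst hij; simp
      · simp [Finsupp.single_eq_of_ne (Ne.symm hij)]
    | zero => simp
    | add x y _ _ hx hy => rw [map_add]; exact dvd_add hx hy
    | neg x _ hx => rw [map_neg]; exact dvd_neg.2 hx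
  · intro h
    rw [← 𝔰.e.sum_repr m]
    refine AddSubgroup.sum_mem _ fun i _ => ?_
    obtain ⟨k, hk⟩ := h i
    rw [hk, mul_comm, mul_smul, natCast_zsmul]
    exact AddSubgroup.zsmul_mem _ (AddSubgroup.subset_closure (Set.mem_range_self i)) k

lemma Seed.repr_vec (𝔰 : Seed Γ) (a : Expo r) (i : Fin r) : 𝔰.e.repr (𝔰.vec a) i = a i := by
  rw [Seed.vec, map_sum, Finsupp.finsetSum_apply, Finset.sum_eq_single i]
  · simp
  · intro j _ hj
    simp [Finsupp.single_eq_of_ne (Ne.symm hj)]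
  · simp

/-- The condition `d n ∈ N°`, in coordinates. -/
lemma Seed.smul_mem_Ncirc_iff (𝔰 : Seed Γ) (a : Expo r) (d : ℚ) :
    (∃ m ∈ Γ.Ncirc, d.num • 𝔰.vec a = (d.den : ℤ) • m) ↔
      ∀ i, ∃ k : ℤ, d * (a i * Γ.cofactor i : ℤ) = k * Γ.δ₀ := by
  have hden : (d.den : ℚ) ≠ 0 := Nat.cast_ne_zero.2 d.den_ne_zero
  have hd : (d.num : ℚ) = d * d.den := (Rat.mul_den_eq_num d).symm
  constructor
  · rintro ⟨m, hm, h⟩ i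
    obtain ⟨k, hk⟩ := (𝔰.mem_Ncirc_iff m).1 hm i
    refine ⟨k, ?_⟩
    have h1 := congrArg (fun x => 𝔰.e.repr x i) h
    simp only [map_zsmul, Finsupp.smul_apply, 𝔰.repr_vec, hk, smul_eq_mul] at h1
    have h2 : (d.num : ℚ) * a i = d.den * (Γ.δ i * k) := by exact_mod_cast h1
    rw [hd] at h2
    have h3 : d * a i = Γ.δ i * k := mul_left_cancel₀ hden (by linear_combination h2)
    rw [← Γ.δ_mul_cofactor i]
    push_cast
    linear_combination (Γ.cofactor i : ℚ) * h3
  · intro h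
    choose k hk using h
    refine ⟨∑ i, (k i * Γ.δ i) • 𝔰.e i, ?_, ?_⟩
    · refine AddSubgroup.sum_mem _ fun i _ => ?_
      rw [𝔰.Ncirc_eq, mul_smul, natCast_zsmul]
      exact AddSubgroup.zsmul_mem _ (AddSubgroup.subset_closure (Set.mem_range_self i)) _
    · rw [Seed.vec, Finset.smul_sum, Finset.smul_sum]
      refine Finset.sum_congr rfl fun i _ => ?_
      rw [← natCast_zsmul, smul_smul, smul_smul]
      congr 1
      have hc : (Γ.cofactor i : ℚ) ≠ 0 := Nat.cast_ne_zero.2 (Γ.cofactor_pos i).ne'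
      have h1 := hk i
      rw [← Γ.δ_mul_cofactor i] at h1
      push_cast at h1
      have h2 : d * a i = k i * Γ.δ i := mul_right_cancel₀ hc (by linear_combination h1)
      have h3 : (d.num : ℚ) * a i = d.den * (k i * Γ.δ i) := by
        rw [hd]
        linear_combination (d.den : ℚ) * h2
      exact_mod_cast h3

lemma Seed.isNormalizationFactor (𝔰 : Seed Γ) (n : NPlus r) :
    𝔰.IsNormalizationFactor n (Γ.normFactor n.1) := by
  have hc : (0 : ℚ) < Γ.content n.1 := Nat.cast_pos.2 (Γ.content_pos n)
  have h0 : (0 : ℚ) < Γ.δ₀ := Nat.cast_pos.2 Γ.δ₀_pos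
  constructor
  · refine ⟨div_pos h0 hc, (𝔰.smul_mem_Ncirc_iff n.1 (Γ.normFactor n.1)).2 fun i => ?_⟩
    obtain ⟨k, hk⟩ := Γ.content_dvd n.1 i
    refine ⟨k, ?_⟩
    rw [hk, FixedData.normFactor]
    push_cast
    field_simp
  · rintro d ⟨hd, hm⟩
    have h1 := (𝔰.smul_mem_Ncirc_iff _ _).1 hm
    choose k hk using h1
    obtain ⟨φ, hφ⟩ := Γ.exists_sum_eq_content n.1
    -- Minimality: the Bézout combination of the integrality conditions on the coordinates makes `d`
    -- times the content a positive integer multiple of `δ₀`.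
    have h2 : d * Γ.content n.1 = (∑ i, φ i * k i : ℤ) * Γ.δ₀ := by
      have h3 : (Γ.content n.1 : ℚ) = ∑ i, (φ i : ℚ) * (n.1 i * Γ.cofactor i : ℤ) := by
        have h4 : ((Γ.content n.1 : ℤ) : ℚ) =
            ((∑ i, (n.1 i : ℤ) * (φ i * Γ.cofactor i) : ℤ) : ℚ) := by rw [hφ]
        push_cast at h4 ⊢
        rw [h4]
        exact Finset.sum_congr rfl fun i _ => by ring
      rw [h3, Finset.mul_sum]
      push_cast
      rw [Finset.sum_mul]
      refine Finset.sum_congr rfl fun i _ => ?_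
      have := hk i
      push_cast at this
      linear_combination (φ i : ℚ) * this
    have h3 : (0 : ℚ) < (∑ i, φ i * k i : ℤ) * Γ.δ₀ := h2 ▸ mul_pos hd hc
    have h4 : 0 < ∑ i, φ i * k i := by
      have := (pos_iff_pos_of_mul_pos h3).2 h0
      exact_mod_cast this
    rw [FixedData.normFactor, div_le_iff₀ hc, h2]
    have h5 : (1 : ℚ) ≤ (∑ i, φ i * k i : ℤ) := by exact_mod_cast h4
    nlinarith

/-! ### Integrality of the quantum dilogarithms -/

namespace QTorus

variable {𝔰 : Seed Γ}

open Classical in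
/-- The formal sum `∑_j a_j y^{j n}`. -/
def series (𝔰 : Seed Γ) (n : Expo r) (a : ℕ → K) : QTorus 𝔰 :=
  ⟨fun m => if h : ∃ j : ℕ, m = j • n then a h.choose else 0⟩

lemma series_coeff_nsmul {n : Expo r} (hn : n ≠ 0) (a : ℕ → K) (j : ℕ) :
    (series 𝔰 n a).coeff (j • n) = a j := by
  have h : ∃ k : ℕ, j • n = k • n := ⟨j, rfl⟩
  exact (dif_pos h).trans (by rw [nsmul_left_injective hn h.choose_spec.symm])

lemma series_mem_par (n : Expo r) (a : ℕ → K) : series 𝔰 n a ∈ par 𝔰 n := by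
  intro m hm
  by_contra h
  exact hm (dif_neg h)

lemma par_ext {n : Expo r} {f g : QTorus 𝔰} (hf : f ∈ par 𝔰 n) (hg : g ∈ par 𝔰 n)
    (h : ∀ j : ℕ, f.coeff (j • n) = g.coeff (j • n)) : f = g := by
  ext m
  by_cases hm : ∃ j : ℕ, m = j • n
  · obtain ⟨j, rfl⟩ := hm
    exact h j
  · have h1 : f.coeff m = 0 := by
      by_contra h'
      exact hm (hf m h')
    have h2 : g.coeff m = 0 := by
      by_contra h'
      exact hm (hg m h')
    rw [h1, h2]

/-- The binomial `1 + c y^n`. -/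
def binomial (𝔰 : Seed Γ) (n : Expo r) (c : K) : QTorus 𝔰 :=
  1 + series 𝔰 n fun j => if j = 1 then c else 0

lemma binomial_mem_par (n : Expo r) (c : K) : binomial 𝔰 n c ∈ par 𝔰 n :=
  (par 𝔰 n).add_mem (par 𝔰 n).one_mem (series_mem_par n _)

/-- The series `log (1 + c y^n)`. -/
def logSeries (𝔰 : Seed Γ) (n : Expo r) (c : K) : QTorus 𝔰 :=
  series 𝔰 n fun j => (-1) ^ (j + 1) * c ^ j / j

lemma coeff_zero_of_series {n : Expo r} (hn : n ≠ 0) {a : ℕ → K} (a0 : a 0 = 0) :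
    (series 𝔰 n a).coeff 0 = 0 := by
  have := series_coeff_nsmul (𝔰 := 𝔰) hn a 0
  rwa [zero_smul, a0] at this

/-- At `j = 0` the defining formula is a quotient by `0`, which has the value `0`. -/
lemma logSeries_coeff_zero {n : Expo r} (hn : n ≠ 0) (c : K) :
    (logSeries 𝔰 n c).coeff 0 = 0 := coeff_zero_of_series hn (by simp)

/-- Applied to the binomial `1 + c y^n`: only two pairs of exponents contribute, without powers of
`q`. -/
lemma coeff_mul_of_mem_par {n : Expo r} (hn : n ≠ 0) {f g : QTorus 𝔰} (hf : f ∈ par 𝔰 n)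
    (j : ℕ) (hg : g ∈ par 𝔰 n) (h2 : ∀ k, 1 < k → g.coeff (k • n) = 0) :
    (f * g).coeff ((j + 1) • n) =
      f.coeff ((j + 1) • n) * g.coeff 0 + f.coeff (j • n) * g.coeff n := by
  have hne : (((j + 1) • n, 0) : Expo r × Expo r) ≠ (j • n, n) :=
    fun h => hn (congrArg Prod.snd h).symm
  rw [coeff_mul', Finset.sum_eq_add_of_mem ((j + 1) • n, 0) (j • n, n) (by simp)
    (by simp [add_smul]) hne]
  · have h3 : 𝔰.iform (j • n) n = 0 := by rw [𝔰.iform_nsmul_left, 𝔰.iform_self, mul_zero]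
    rw [𝔰.iform_zero_right, h3]
    simp
  · rintro ⟨a, b⟩ hab ⟨hne1, hne2⟩
    by_cases h1 : g.coeff b = 0
    · rw [h1, mul_zero]
    by_cases h0 : f.coeff a = 0
    · rw [h0]; ring
    exfalso
    obtain ⟨k, rfl⟩ := hg b h1
    obtain ⟨i, rfl⟩ := hf a h0
    have hab' := Finset.HasAntidiagonal.mem_antidiagonal.1 hab
    dsimp only at hab' h1
    rw [← add_smul] at hab'
    have hij := nsmul_left_injective hn hab'
    have hk : k ≤ 1 := by
      by_contra hk
      exact h1 (h2 k (by omega))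
    interval_cases k
    · exact hne1 (by rw [show i = j + 1 by omega]; simp)
    · exact hne2 (by rw [show i = j by omega]; simp)

/-- Compare logarithmic derivatives: that of the left side is `deg n` times the geometric series `∑
(-1)^i c^{i+1} y^{(i+1)n}`, which telescopes against `1 + c y^n`. -/
lemma exp_logSeries {n : Expo r} (hn : n ≠ 0) (c : K) :
    exp (logSeries 𝔰 n c) = binomial 𝔰 n c := by
  have hL : logSeries 𝔰 n c ∈ par 𝔰 n := series_mem_par n _
  have hE := euler_mem_par hL
  have hB := binomial_mem_par (𝔰 := 𝔰) n c
  have b0 : (binomial 𝔰 n c).coeff 0 = 1 := by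
    rw [binomial, coeff_add, coeff_one, coeff_zero_of_series hn (by simp)]
    simp
  have bj : ∀ j : ℕ, (binomial 𝔰 n c).coeff ((j + 1) • n) = if j = 0 then c else 0 := by
    intro j
    have : (j + 1) • n ≠ 0 := by simp [hn]
    rw [binomial, coeff_add, coeff_one, if_neg this, series_coeff_nsmul hn, zero_add]
    simp
  refine eq_of_euler_eq_mul (euler_coeff_zero _)
    (euler_exp (logSeries_coeff_zero hn c) (par_commute hL hE)) ?_
    (by rw [exp_coeff_zero, b0])
  refine par_ext (euler_mem_par hB) ((par 𝔰 n).mul_mem hE hB) fun j => ?_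
  rcases j with _ | j
  · rw [zero_smul, euler_coeff_zero, coeff_mul_zero, euler_coeff_zero, zero_mul]
  · have bn := bj 0
    rw [zero_add, one_smul, if_pos rfl] at bn
    have ec : ∀ i : ℕ, (euler (logSeries 𝔰 n c)).coeff ((i + 1) • n) =
        deg n * ((-1) ^ i * c ^ (i + 1)) := by
      intro i
      have hi : ((i + 1 : ℕ) : K) ≠ 0 := Nat.cast_ne_zero.2 (Nat.succ_ne_zero i)
      rw [euler_coeff, logSeries, series_coeff_nsmul hn, deg_nsmul]
      push_cast at hi ⊢
      field_simp
      ring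
    rw [coeff_mul_of_mem_par hn hE j hB fun k hk => ?_, b0, bn, ec, euler_coeff, bj, deg_nsmul]
    · rcases j with _ | j
      · rw [zero_smul, euler_coeff_zero]
        simp
      · rw [ec, if_neg (Nat.succ_ne_zero j)]
        ring
    · obtain ⟨k, rfl⟩ : ∃ i, k = i + 1 := ⟨k - 1, by omega⟩
      rw [bj, if_neg (by omega)]

/-- Generators exponentiate to integral binomials, and on commuting series `exp` turns sums into
products and negatives into inverses. The integral units form a group. -/
lemma exp_mem_integral_of_mem_closure {n : Expo r} (hn : n ≠ 0) {f : QTorus 𝔰}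
    (hf : f ∈ AddSubgroup.closure (Set.range fun b : ℤ => logSeries 𝔰 n (RatFunc.X ^ b))) :
    f ∈ par 𝔰 n ∧ f.coeff 0 = 0 ∧
      (⟨exp f, exp_coeff_zero f⟩ : OneUnit 𝔰) ∈ OneUnit.integralUnits 𝔰 := by
  induction hf using AddSubgroup.closure_induction with
  | mem x hx =>
    obtain ⟨b, rfl⟩ := hx
    refine ⟨series_mem_par n _, logSeries_coeff_zero hn _, fun m => ?_⟩
    change (exp (logSeries 𝔰 n _)).coeff m ∈ intRing
    rw [exp_logSeries hn, binomial, coeff_add]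
    refine intRing.add_mem (OneUnit.coeff_one_mem (𝔰 := 𝔰) m) ?_
    by_cases h : ∃ j : ℕ, m = j • n
    · obtain ⟨j, rfl⟩ := h
      rw [series_coeff_nsmul hn]
      split_ifs
      · exact X_zpow_mem b
      · exact intRing.zero_mem
    · have h0 : (series 𝔰 n fun j => if j = 1 then (RatFunc.X : K) ^ b else 0).coeff m = 0 :=
        dif_neg h
      rw [h0]
      exact intRing.zero_mem
  | zero =>
    refine ⟨(par 𝔰 n).zero_mem, rfl, fun m => ?_⟩
    change (exp (0 : QTorus 𝔰)).coeff m ∈ intRing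
    rw [exp_zero]
    exact OneUnit.coeff_one_mem (𝔰 := 𝔰) m
  | add x y _ _ hx hy =>
    obtain ⟨hx, x0, hxi⟩ := hx
    obtain ⟨hy, y0, hyi⟩ := hy
    refine ⟨(par 𝔰 n).add_mem hx hy, by rw [coeff_add, x0, y0, add_zero], ?_⟩
    convert (OneUnit.integralUnits 𝔰).mul_mem hxi hyi using 1
    exact Subtype.ext (exp_add_of_mem_par hx hy x0 y0)
  | neg x _ hx =>
    obtain ⟨hx, x0, hxi⟩ := hx
    have h0 : (-x).coeff 0 = 0 := by rw [coeff_neg, x0, neg_zero]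
    refine ⟨(par 𝔰 n).neg_mem hx, h0, ?_⟩
    convert (OneUnit.integralUnits 𝔰).inv_mem hxi using 1
    refine eq_inv_of_mul_eq_one_left (Subtype.ext ?_)
    rw [OneUnit.coe_mul, ← exp_add_of_mem_par ((par 𝔰 n).neg_mem hx) hx h0 x0, neg_add_cancel,
      exp_zero, OneUnit.coe_one]

end QTorus

/-- Twists commute with `exp`, and on commuting series `exp` is a homomorphism; the cocycle thus
becomes additive on logarithms. -/
lemma OneUnit.defect_exp {𝔰 : Seed Γ} {n : Expo r} {f : QTorus 𝔰} (hf : f ∈ QTorus.par 𝔰 n)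
    (f0 : f.coeff 0 = 0) (φ : Fin r → ℤ) :
    (defect φ ⟨QTorus.exp f, QTorus.exp_coeff_zero f⟩).1 =
      QTorus.exp (f - QTorus.tau (charOf Γ φ) f) := by
  have ht := QTorus.tau_mem_par hf (charOf Γ φ)
  have t0 : (QTorus.tau (charOf Γ φ) f).coeff 0 = 0 := by rw [QTorus.tau_coeff, f0, mul_zero]
  have h : defect φ ⟨QTorus.exp f, QTorus.exp_coeff_zero f⟩ =
      ⟨QTorus.exp (f - QTorus.tau (charOf Γ φ) f), QTorus.exp_coeff_zero _⟩ := by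
    rw [defect, mul_inv_eq_iff_eq_mul]
    refine Subtype.ext ?_
    rw [OneUnit.coe_mul, OneUnit.tau_coe, QTorus.tau_exp, ← QTorus.exp_add_of_mem_par
      ((QTorus.par 𝔰 n).sub_mem hf ht) ht (by rw [QTorus.coeff_sub, f0, t0, sub_zero]) t0,
      sub_add_cancel]
  rw [h]

/-- With `x = q^{j/δ(m)}` this removes the denominator `[j/δ(m)]_q` of the dilogarithm from its
cocycle. -/
lemma sub_inv_mul_geom_sum {x : K} (hx : x ≠ 0) (k : ℕ) :
    (x - x⁻¹) * ∑ i ∈ Finset.range k, x ^ (2 * i + 1) = x ^ (2 * k) - 1 := by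
  induction k with
  | zero => simp
  | succ k ih =>
    rw [Finset.sum_range_succ, mul_add, ih]
    field_simp
    ring

namespace StructureGroup

variable {𝔰 : Seed Γ}

/-- The logarithm of `Ψ_{1/δ(m), b/δ₀}[m]`. -/
def dilogLog (𝔰 : Seed Γ) (m : NPlus r) (b : ℤ) : LieHat 𝔰 :=
  (dilog 𝔰 (1 / Γ.normFactor m.1) (b / Γ.δ₀) m).log

lemma dilogLog_apply (m : NPlus r) (b : ℤ) {j : ℕ} (hj : 0 < j) (h : j • m.1 ≠ 0) :
    dilogLog 𝔰 m b ⟨j • m.1, h⟩ =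
      (-1) ^ (j + 1) / ((j : K) * (((RatFunc.X : K) ^ (j * Γ.content m.1) -
        ((RatFunc.X : K) ^ (j * Γ.content m.1))⁻¹) / (Γ.qpow 1 - Γ.qpow (-1)))) *
        (RatFunc.X ^ b) ^ j := by
  have h0 : (Γ.δ₀ : ℚ) ≠ 0 := Nat.cast_ne_zero.2 Γ.δ₀_pos.ne'
  have e1 : (Γ.δ₀ : ℚ) * (j * (1 / Γ.normFactor m.1)) = ((j * Γ.content m.1 : ℕ) : ℤ) := by
    rw [FixedData.normFactor]
    push_cast
    field_simp
  have e2 : (Γ.δ₀ : ℚ) * (j * (b / Γ.δ₀)) = ((b * j : ℤ) : ℚ) := by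
    push_cast
    field_simp
  have hdeg : j ≤ deg (j • m.1) := by
    rw [deg_nsmul]
    exact Nat.le_mul_of_pos_right j (deg_pos m.2)
  have q1 : Γ.qpow (j * (1 / Γ.normFactor m.1)) = RatFunc.X ^ (j * Γ.content m.1) := by
    rw [FixedData.qpow, e1, Int.floor_intCast, zpow_natCast]
  have q2 : Γ.qpow (-(j * (1 / Γ.normFactor m.1))) = (RatFunc.X ^ (j * Γ.content m.1))⁻¹ := by
    rw [FixedData.qpow, mul_neg, e1, ← Int.cast_neg, Int.floor_intCast, zpow_neg, zpow_natCast]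
  have q3 : Γ.qpow (j * (b / Γ.δ₀)) = (RatFunc.X ^ b) ^ j := by
    rw [FixedData.qpow, e2, Int.floor_intCast, zpow_mul, zpow_natCast]
  change ∑ i ∈ Finset.Icc 1 (deg (j • m.1)), (if j • m.1 = i • m.1 then
    (-1) ^ (i + 1) / ((i : K) * Γ.qnum (i * (1 / Γ.normFactor m.1))) *
      Γ.qpow (i * (b / Γ.δ₀)) else 0) = _
  rw [Finset.sum_eq_single j, if_pos rfl, FixedData.qnum, q1, q2, q3]
  · intro i _ hi
    exact if_neg fun h' => hi (nsmul_left_injective m.2 h').symm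
  · intro h'
    exact absurd (Finset.mem_Icc.2 ⟨hj, hdeg⟩) h'

lemma dilogLog_eq_zero (m : NPlus r) (b : ℤ) {m' : NPlus r}
    (h : ∀ j : ℕ, 0 < j → m'.1 ≠ j • m.1) : dilogLog 𝔰 m b m' = 0 :=
  Finset.sum_eq_zero fun j hj => if_neg (h j (Finset.mem_Icc.1 hj).1)

lemma dilogLog_mem_par (m : NPlus r) (b : ℤ) : dilogLog 𝔰 m b ∈ LieHat.par 𝔰 m.1 := by
  intro m' hm
  by_contra h
  exact hm (dilogLog_eq_zero m b fun j _ h' => h ⟨j, h'⟩)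

lemma emb_dilogLog (m : NPlus r) (b : ℤ) : (dilogLog 𝔰 m b).emb =
    QTorus.series 𝔰 m.1 fun j => (-1) ^ (j + 1) / ((j : K) * ((RatFunc.X : K) ^ (j * Γ.content m.1) -
        ((RatFunc.X : K) ^ (j * Γ.content m.1))⁻¹)) * (RatFunc.X ^ b) ^ j := by
  refine QTorus.par_ext (LieHat.emb_mem_par (dilogLog_mem_par m b)) (QTorus.series_mem_par _ _)
    fun j => ?_
  rw [QTorus.series_coeff_nsmul m.2]
  rcases j with _ | j
  -- At `j = 0` the right side is a quotient by `0`, hence `0`.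
  · rw [zero_smul, LieHat.emb_coeff_zero, Nat.cast_zero]
    simp
  · have h : (j + 1) • m.1 ≠ 0 := by simp [m.2]
    rw [LieHat.emb_coeff _ ⟨_, h⟩, dilogLog_apply m b (Nat.succ_pos j)]
    have := Γ.qpow_one_sub_ne_zero
    field_simp

/-- Used with `A = q^{j/δ(m)}`, `D = A^{2s} - 1`, `c = j`: the `j`-th coefficient of the logarithm
of the cocycle becomes a sum of `s` coefficients of series `log (1 + q^{c_i/δ₀} y^m)`, up to sign.
-/
lemma geom_identity {A D Y e c : K} (hc : c ≠ 0) (hA : A - A⁻¹ ≠ 0) (s : ℕ)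
    (h : (A - A⁻¹) * ∑ i ∈ Finset.range s, A ^ (2 * i + 1) = D) :
    e / (c * (A - A⁻¹)) * Y * D = ∑ i ∈ Finset.range s, e * (Y * A ^ (2 * i + 1)) / c := by
  have h1 : ∑ i ∈ Finset.range s, e * (Y * A ^ (2 * i + 1)) / c =
      e * Y / c * ∑ i ∈ Finset.range s, A ^ (2 * i + 1) := by
    rw [Finset.mul_sum]
    exact Finset.sum_congr rfl fun i _ => by ring
  rw [h1, ← h]
  generalize ∑ i ∈ Finset.range s, A ^ (2 * i + 1) = S
  generalize A - A⁻¹ = B at hA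
  field_simp

/-- The quantum dilogarithm satisfies a `q`-difference equation. The twist scales `y^m` by
`q^{2k/δ(m)}` with `k` an integer, and the quotient of the dilogarithm by its twist is a product of
`|k|` binomials or of their inverses. -/
lemma isIntegral_dilogLog (m : NPlus r) (b : ℤ) (l : ℕ) :
    OneUnit.IsIntegral l (toUnit 𝔰 ⟨dilogLog 𝔰 m b⟩) := by
  intro φ n _
  set g := Γ.content m.1 with hgdef
  obtain ⟨k, hk⟩ := exists_charOf_eq_content_mul (Γ := Γ) φ m.1
  have hpar := LieHat.emb_mem_par (dilogLog_mem_par (𝔰 := 𝔰) m b)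
  have hτ := QTorus.tau_mem_par hpar (charOf Γ φ)
  have hx : (RatFunc.X : K) ≠ 0 := RatFunc.X_ne_zero
  -- For `k = s ≥ 0` the cocycle consists of inverse binomials (`ε = -1`), for `k = -s` of binomials
  -- (`ε = 1`). The exponents `c i` come from the odd powers in the geometric sum, shifted by `-2gs`
  -- in the second case.
  suffices h : ∃ (c : ℕ → ℤ) (s : ℕ) (ε : ℤ), (dilogLog 𝔰 m b).emb -
      QTorus.tau (charOf Γ φ) (dilogLog 𝔰 m b).emb =
      ε • ∑ i ∈ Finset.range s, QTorus.logSeries 𝔰 m.1 (RatFunc.X ^ c i) by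
    obtain ⟨c, s, ε, h⟩ := h
    have h3 : (dilogLog 𝔰 m b).emb - QTorus.tau (charOf Γ φ) (dilogLog 𝔰 m b).emb ∈
        AddSubgroup.closure (Set.range fun b : ℤ => QTorus.logSeries 𝔰 m.1 (RatFunc.X ^ b)) := by
      rw [h]
      exact AddSubgroup.zsmul_mem _ (AddSubgroup.sum_mem _ fun i _ =>
        AddSubgroup.subset_closure (Set.mem_range_self (c i))) ε
    have h1 := (QTorus.exp_mem_integral_of_mem_closure m.2 h3).2.2 n
    change (QTorus.exp _).coeff n ∈ intRing at h1
    rw [← OneUnit.defect_exp hpar (LieHat.emb_coeff_zero _) φ] at h1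
    exact h1
  have hsum : ∀ (c : ℕ → ℤ) (s : ℕ),
      ∑ i ∈ Finset.range s, QTorus.logSeries 𝔰 m.1 (RatFunc.X ^ c i) ∈ QTorus.par 𝔰 m.1 :=
    fun c s => (QTorus.par 𝔰 m.1).sum_mem fun i _ => QTorus.series_mem_par _ _
  have hA : ∀ j : ℕ, (RatFunc.X : K) ^ ((j + 1) * g) - ((RatFunc.X : K) ^ ((j + 1) * g))⁻¹ ≠ 0 :=
    fun j => by
      have := X_zpow_sub_ne_zero (k := (j + 1) * g) (Nat.mul_pos (Nat.succ_pos j) (Γ.content_pos m))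
      rwa [zpow_neg, zpow_natCast] at this
  have hj : ∀ j : ℕ, ((j + 1 : ℕ) : K) ≠ 0 := fun j => Nat.cast_ne_zero.2 (Nat.succ_ne_zero j)
  have hchar : ∀ j : ℕ, charOf Γ φ (j • m.1) = j * (2 * g * k) := fun j => by
    rw [map_nsmul, hk, nsmul_eq_mul]
  have e2 : ∀ (i j : ℕ) (t : ℤ), ((RatFunc.X : K) ^ (b + g * (2 * i + 1) + t)) ^ (j + 1) =
      (RatFunc.X ^ b) ^ (j + 1) * ((RatFunc.X : K) ^ ((j + 1) * g)) ^ (2 * i + 1) *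
        (RatFunc.X ^ t) ^ (j + 1) := by
    intro i j t
    rw [zpow_add₀ hx, zpow_add₀ hx, mul_pow, mul_pow, ← pow_mul, ← zpow_natCast _ (_ * _),
      ← zpow_natCast (_ ^ (g * (2 * i + 1) : ℤ)), ← zpow_mul]
    congr 3
    push_cast
    ring
  rcases Int.eq_nat_or_neg k with ⟨s, rfl | rfl⟩
  · refine ⟨fun i => b + g * (2 * i + 1) + 0, s, -1, ?_⟩
    rw [neg_smul, one_smul]
    refine QTorus.par_ext ((QTorus.par 𝔰 m.1).sub_mem hpar hτ)
      ((QTorus.par 𝔰 m.1).neg_mem (hsum _ _)) fun j => ?_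
    rw [QTorus.coeff_sub, QTorus.tau_coeff, QTorus.coeff_neg, QTorus.coeff_sum, emb_dilogLog,
      QTorus.series_coeff_nsmul m.2, hchar, ← hgdef]
    simp only [QTorus.logSeries, QTorus.series_coeff_nsmul m.2]
    rcases j with _ | j
    · simp
    have e1 : (RatFunc.X : K) ^ (((j + 1 : ℕ) : ℤ) * (2 * g * s)) =
        (RatFunc.X ^ ((j + 1) * g)) ^ (2 * s) := by
      rw [← pow_mul, ← zpow_natCast]
      congr 1
      push_cast
      ring
    simp only [e1, e2, zpow_zero, one_pow, mul_one]
    rw [← geom_identity (hj j) (hA j) s (sub_inv_mul_geom_sum (pow_ne_zero _ hx) s)]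
    ring
  · refine ⟨fun i => b + g * (2 * i + 1) + -(2 * g * s), s, 1, ?_⟩
    rw [one_smul]
    refine QTorus.par_ext ((QTorus.par 𝔰 m.1).sub_mem hpar hτ) (hsum _ _) fun j => ?_
    rw [QTorus.coeff_sub, QTorus.tau_coeff, QTorus.coeff_sum, emb_dilogLog,
      QTorus.series_coeff_nsmul m.2, hchar, ← hgdef]
    simp only [QTorus.logSeries, QTorus.series_coeff_nsmul m.2]
    rcases j with _ | j
    · simp
    have e1 : (RatFunc.X : K) ^ (((j + 1 : ℕ) : ℤ) * (2 * g * -s)) =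
        ((RatFunc.X ^ ((j + 1) * g)) ^ (2 * s))⁻¹ := by
      rw [← pow_mul, ← zpow_natCast, ← zpow_neg]
      congr 1
      push_cast
      ring
    have e3 : ((RatFunc.X : K) ^ (-(2 * g * s : ℤ))) ^ (j + 1) =
        ((RatFunc.X ^ ((j + 1) * g)) ^ (2 * s))⁻¹ := by
      rw [← pow_mul, ← zpow_natCast, ← zpow_natCast, ← zpow_neg, ← zpow_mul]
      congr 1
      push_cast
      ring
    simp only [e1, e2, e3]
    have hg := geom_identity (Y := (RatFunc.X ^ b) ^ (j + 1) *
      ((RatFunc.X ^ ((j + 1) * g)) ^ (2 * s))⁻¹) (e := (-1) ^ (j + 1 + 1)) (hj j) (hA j) s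
      (sub_inv_mul_geom_sum (pow_ne_zero _ hx) s)
    have hne : ((RatFunc.X : K) ^ ((j + 1) * g)) ^ (2 * s) ≠ 0 := pow_ne_zero _ (pow_ne_zero _ hx)
    trans ∑ i ∈ Finset.range s, (-1) ^ (j + 1 + 1) * ((RatFunc.X ^ b) ^ (j + 1) *
      ((RatFunc.X ^ ((j + 1) * g)) ^ (2 * s))⁻¹ * ((RatFunc.X : K) ^ ((j + 1) * g)) ^ (2 * i + 1)) /
        ((j + 1 : ℕ) : K)
    · rw [← hg]
      generalize ((RatFunc.X : K) ^ ((j + 1) * g)) ^ (2 * s) = P at hne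
      generalize (RatFunc.X : K) ^ ((j + 1) * g) - (RatFunc.X ^ ((j + 1) * g))⁻¹ = B
      field_simp
    · exact Finset.sum_congr rfl fun i _ => by ring

end StructureGroup

/-! ### Factorization of integral elements into quantum dilogarithms -/

/-- The multiple `(j + 1) n`. -/
def NPlus.mult (n : NPlus r) (j : ℕ) : NPlus r := ⟨(j + 1) • n.1, by simp [n.2]⟩

lemma NPlus.mult_coe (n : NPlus r) (j : ℕ) : (n.mult j).1 = (j + 1) • n.1 := rfl

lemma NPlus.deg_mult_le {n : NPlus r} {i j : ℕ} :
    deg (n.mult i).1 ≤ deg (n.mult j).1 ↔ i ≤ j := by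
  rw [mult_coe, mult_coe, deg_nsmul, deg_nsmul, Nat.mul_le_mul_right_iff (deg_pos n.2)]
  omega

lemma NPlus.exists_eq_mult {n m : NPlus r} {j : ℕ} (h : m.1 = j • n.1) :
    ∃ i, m = n.mult i := by
  rcases j with _ | j
  · exact absurd (by rw [h, zero_smul]) m.2
  · exact ⟨j, Subtype.ext h⟩

/-- In the lowest degree of `f` only the linear term of the exponential series contributes. -/
lemma QTorus.exp_coeff_of_agree_zero {𝔰 : Seed Γ} {f : QTorus 𝔰} (f0 : f.coeff 0 = 0) {m : Expo r}
    (hm : m ≠ 0) (h : Agree (deg m) f 0) : (exp f).coeff m = f.coeff m := by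
  have h1 := exp_sub_agree h f0 (coeff_zero 0) m (Nat.lt_succ_self _)
  rw [coeff_sub, coeff_sub, exp_zero, coeff_one, if_neg hm, coeff_zero, sub_zero] at h1
  exact (sub_eq_zero.1 h1).symm

namespace StructureGroup

variable {𝔰 : Seed Γ}

/-- The logarithms of the integral elements of `G_n^∥`. -/
def integralPar (𝔰 : Seed Γ) (n : Expo r) : AddSubgroup (LieHat 𝔰) where
  carrier := {X | X ∈ LieHat.par 𝔰 n ∧ ∀ l, OneUnit.IsIntegral l (toUnit 𝔰 ⟨X⟩)}
  zero_mem' := ⟨(LieHat.par 𝔰 n).zero_mem, fun l => by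
    rw [mk_zero, map_one]
    exact OneUnit.isIntegral_one l⟩
  add_mem' := fun {X Y} hX hY => ⟨(LieHat.par 𝔰 n).add_mem hX.1 hY.1, fun l => by
    rw [← mk_mul_mk hX.1 hY.1, map_mul]
    exact (hX.2 l).mul (hY.2 l)⟩
  neg_mem' := fun {X} hX => ⟨(LieHat.par 𝔰 n).neg_mem hX.1, fun l => by
    rw [← mk_inv hX.1, map_inv]
    exact (hX.2 l).inv⟩

lemma mem_integralPar {n : Expo r} {X : LieHat 𝔰} : X ∈ integralPar 𝔰 n ↔
    X ∈ LieHat.par 𝔰 n ∧ ∀ l, OneUnit.IsIntegral l (toUnit 𝔰 ⟨X⟩) := Iff.rfl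

lemma par_mult_le (n : NPlus r) (j : ℕ) : LieHat.par 𝔰 (n.mult j).1 ≤ LieHat.par 𝔰 n.1 := by
  intro X hX m hm
  obtain ⟨k, hk⟩ := hX m hm
  exact ⟨k * (j + 1), by rw [hk, n.mult_coe, smul_smul]⟩

lemma dilogLog_mem_integralPar (n : NPlus r) (j : ℕ) (b : ℤ) :
    dilogLog 𝔰 (n.mult j) b ∈ integralPar 𝔰 n.1 :=
  ⟨par_mult_le n j (dilogLog_mem_par _ b), isIntegral_dilogLog _ b⟩

/-- The `q`-number `[1/δ(m)]_q`. -/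
def leading (Γ : FixedData r N) (m : Expo r) : K :=
  ((RatFunc.X : K) ^ Γ.content m - ((RatFunc.X : K) ^ Γ.content m)⁻¹) / (Γ.qpow 1 - Γ.qpow (-1))

lemma leading_ne_zero (m : NPlus r) : leading Γ m.1 ≠ 0 := by
  have := X_zpow_sub_ne_zero (Γ.content_pos m)
  rw [zpow_neg, zpow_natCast] at this
  exact div_ne_zero this Γ.qpow_one_sub_ne_zero

/-- Varying `b` yields all monomials over the common denominator `[1/δ(m)]_q`, so integer
combinations realize every Laurent polynomial as a numerator. -/
lemma dilogLog_self (m : NPlus r) (b : ℤ) :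
    dilogLog 𝔰 m b m = RatFunc.X ^ b / leading Γ m.1 := by
  have h := dilogLog_apply (𝔰 := 𝔰) m b (j := 1) Nat.one_pos (by rw [one_smul]; exact m.2)
  simp only [one_smul] at h
  rw [h, leading]
  simp [div_eq_mul_inv, mul_comm]

/-- The first nonzero coefficient of the logarithm of an integral element. -/
lemma mul_leading_mem {n : NPlus r} {X : LieHat 𝔰} (hX : X ∈ integralPar 𝔰 n.1) (m : NPlus r)
    (h0 : ∀ m' : NPlus r, deg m'.1 < deg m.1 → X m' = 0) : X m * leading Γ m.1 ∈ intRing := by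
  -- This `φ` gives the smallest nontrivial twist of `y^m`, namely `q^{2/δ(m)}`, and so the sharpest
  -- bound on the denominator.
  obtain ⟨φ, hφ⟩ := exists_charOf_eq_two_mul_content Γ m.1
  have hpar := LieHat.emb_mem_par hX.1
  have e0 := LieHat.emb_coeff_zero X
  have ha : QTorus.Agree (deg m.1) X.emb 0 := by
    intro k hk
    by_cases hk0 : k = 0
    · rw [hk0, e0, QTorus.coeff_zero]
    · rw [LieHat.emb_coeff X ⟨k, hk0⟩, h0 _ hk, zero_div, QTorus.coeff_zero]
  have ha2 : QTorus.Agree (deg m.1) (X.emb - QTorus.tau (charOf Γ φ) X.emb) 0 := by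
    intro k hk
    rw [QTorus.coeff_sub, QTorus.tau_coeff, ha k hk]
    simp [QTorus.coeff_zero]
  have h1 := hX.2 (deg m.1) φ m.1 le_rfl
  have h2 := OneUnit.defect_exp hpar e0 φ
  have h3 : (OneUnit.defect φ (toUnit 𝔰 ⟨X⟩)).1.coeff m.1 =
      X.emb.coeff m.1 - RatFunc.X ^ charOf Γ φ m.1 * X.emb.coeff m.1 := by
    refine (congrArg (fun t => QTorus.coeff t m.1) h2).trans ?_
    rw [QTorus.exp_coeff_of_agree_zero (by
      rw [QTorus.coeff_sub, QTorus.tau_coeff, e0, mul_zero, sub_zero]) m.2 ha2, QTorus.coeff_sub,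
      QTorus.tau_coeff]
  rw [h3, LieHat.emb_coeff, hφ] at h1
  -- The unit `-q^{-1/δ(m)}` turns the factor `1 - q^{2/δ(m)}` into `q^{1/δ(m)} - q^{-1/δ(m)}`.
  have h4 := intRing.mul_mem (intRing.neg_mem (X_zpow_mem (-(Γ.content m.1 : ℤ)))) h1
  convert h4 using 1
  have hX : (RatFunc.X : K) ^ Γ.content m.1 ≠ 0 := pow_ne_zero _ RatFunc.X_ne_zero
  rw [leading, zpow_neg, zpow_natCast, zpow_mul, zpow_natCast,
    show (RatFunc.X : K) ^ (2 : ℤ) = RatFunc.X ^ 2 from by norm_cast, ← pow_mul, mul_comm 2, pow_mul]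
  generalize (RatFunc.X : K) ^ Γ.content m.1 = A at hX
  generalize Γ.qpow 1 - Γ.qpow (-1) = B
  field_simp
  ring

/-- The logarithm of `∏_b Ψ_{1/δ(m), b/δ₀}[m]^{c_b}`. -/
def dilogComb (𝔰 : Seed Γ) (m : NPlus r) (c : ℤ →₀ ℤ) : LieHat 𝔰 :=
  c.sum fun b k => k • dilogLog 𝔰 m b

lemma zsmul_apply (k : ℤ) (X : LieHat 𝔰) (m : NPlus r) : (k • X) m = k * X m := by
  rw [← Int.cast_smul_eq_zsmul K, LieHat.smul_apply]

lemma dilogComb_apply (m : NPlus r) (c : ℤ →₀ ℤ) (m' : NPlus r) :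
    dilogComb 𝔰 m c m' = c.sum fun b k => (k : K) * dilogLog 𝔰 m b m' := by
  rw [dilogComb, Finsupp.sum, LieHat.sum_apply, Finsupp.sum]
  exact Finset.sum_congr rfl fun b _ => zsmul_apply _ _ _

lemma dilogComb_self (m : NPlus r) (c : ℤ →₀ ℤ) :
    dilogComb 𝔰 m c m = laurent c / leading Γ m.1 := by
  rw [dilogComb_apply, laurent, Finsupp.sum, Finsupp.sum, Finset.sum_div]
  exact Finset.sum_congr rfl fun b _ => by rw [dilogLog_self, mul_div_assoc]

lemma dilogComb_mem (n : NPlus r) (j : ℕ) (c : ℤ →₀ ℤ) :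
    dilogComb 𝔰 (n.mult j) c ∈ integralPar 𝔰 n.1 :=
  (integralPar 𝔰 n.1).sum_mem fun b _ =>
    (integralPar 𝔰 n.1).zsmul_mem (dilogLog_mem_integralPar n j b) _

lemma dilogComb_eq_zero (m : NPlus r) (c : ℤ →₀ ℤ) {m' : NPlus r}
    (h : ∀ j : ℕ, 0 < j → m'.1 ≠ j • m.1) : dilogComb 𝔰 m c m' = 0 := by
  rw [dilogComb_apply]
  exact Finset.sum_eq_zero fun b _ => mul_eq_zero_of_right _ (dilogLog_eq_zero m b h)

lemma dilogComb_eq_zero_of_deg_lt (m : NPlus r) (c : ℤ →₀ ℤ) {m' : NPlus r}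
    (h : deg m'.1 < deg m.1) : dilogComb 𝔰 m c m' = 0 := by
  refine dilogComb_eq_zero m c fun j hj h' => ?_
  rw [h', deg_nsmul] at h
  have := Nat.le_mul_of_pos_left (deg m.1) hj
  omega

open Classical in
/-- A choice of the coefficients of an element of `ℤ[q^{±1/δ₀}]`. -/
def laurentCoeff (x : K) : ℤ →₀ ℤ :=
  if x = 0 then 0 else if h : ∃ c, laurent c = x then h.choose else 0

lemma laurent_laurentCoeff {x : K} (hx : x ∈ intRing) : laurent (laurentCoeff x) = x := by
  rw [laurentCoeff]
  split_ifs with h0 h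
  · simp [laurent, h0]
  · exact h.choose_spec
  · exact absurd (exists_laurent_eq hx) h

lemma laurentCoeff_zero : laurentCoeff 0 = 0 := if_pos rfl

/-- The exponents in the factorization of `exp Y ∈ G_n^∥` into elements
`Ψ_{1/δ(m), b/δ₀}[m]`, `m = (j + 1) n`. -/
def exponents (n : NPlus r) (Y : LieHat 𝔰) (j : ℕ) : ℤ →₀ ℤ :=
  laurentCoeff ((Y (n.mult j) -
    ∑ i : Fin j, dilogComb 𝔰 (n.mult i) (exponents n Y i) (n.mult j)) * leading Γ (n.mult j).1)
  termination_by j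
  decreasing_by exact i.2

lemma exponents_eq (n : NPlus r) (Y : LieHat 𝔰) (j : ℕ) : exponents n Y j =
    laurentCoeff ((Y (n.mult j) - ∑ i ∈ Finset.range j,
      dilogComb 𝔰 (n.mult i) (exponents n Y i) (n.mult j)) * leading Γ (n.mult j).1) := by
  rw [exponents, ← Fin.sum_univ_eq_sum_range
    (fun i => dilogComb 𝔰 (n.mult i) (exponents n Y i) (n.mult j))]

/-- The recursion for the `j`-th exponents only reads coefficients at multiples up to `(j + 1) n`,
so equality in a truncation of `G` suffices. -/
lemma exponents_congr (n : NPlus r) {Y Y' : LieHat 𝔰} (j : ℕ)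
    (h : ∀ i ≤ j, Y (n.mult i) = Y' (n.mult i)) : exponents n Y j = exponents n Y' j := by
  induction j using Nat.strong_induction_on with
  | _ j ih =>
    rw [exponents_eq, exponents_eq, h j le_rfl]
    congr 3
    refine Finset.sum_congr rfl fun i hi => ?_
    have hi := Finset.mem_range.1 hi
    rw [ih i hi fun k hk => h k (by omega)]

/-- Relies on the choice of Laurent coefficients sending `0` to `0`. It makes points off all
relevant walls contribute no exponents. -/
lemma exponents_zero (n : NPlus r) (j : ℕ) : exponents n (0 : LieHat 𝔰) j = 0 := by
  induction j using Nat.strong_induction_on with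
  | _ j ih =>
    rw [exponents_eq, Finset.sum_eq_zero, LieHat.zero_apply, sub_zero, zero_mul, laurentCoeff_zero]
    intro i hi
    rw [ih i (Finset.mem_range.1 hi)]
    simp [dilogComb, LieHat.zero_apply]

/-- An integral element of `G_n^∥` is a product of powers of quantum dilogarithms. -/
lemma sum_dilogComb_exponents {n : NPlus r} {Y : LieHat 𝔰} (hY : Y ∈ integralPar 𝔰 n.1) (j : ℕ) :
    ∑ i ∈ Finset.range (j + 1), dilogComb 𝔰 (n.mult i) (exponents n Y i) (n.mult j) =
      Y (n.mult j) := by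
  induction j using Nat.strong_induction_on with
  | _ j ih =>
    -- `Z` is the logarithm after the first `j` factors have been divided out. It is still integral,
    -- and by induction it vanishes below the degree of `(j + 1) n`, so its coefficient there is a
    -- Laurent polynomial over `[1/δ]_q`.
    set Z : LieHat 𝔰 := Y - ∑ i ∈ Finset.range j, dilogComb 𝔰 (n.mult i) (exponents n Y i)
    have hZm : ∀ m, Z m = Y m - ∑ i ∈ Finset.range j,
        dilogComb 𝔰 (n.mult i) (exponents n Y i) m := by
      intro m
      rw [← LieHat.sum_apply]
      rfl
    have hZ : Z ∈ integralPar 𝔰 n.1 :=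
      (integralPar 𝔰 n.1).sub_mem hY ((integralPar 𝔰 n.1).sum_mem fun i _ => dilogComb_mem n i _)
    have hZ0 : ∀ m : NPlus r, deg m.1 < deg (n.mult j).1 → Z m = 0 := by
      intro m hm
      by_contra hne
      obtain ⟨k, hk⟩ := hZ.1 m hne
      obtain ⟨i, rfl⟩ := NPlus.exists_eq_mult hk
      have hij : i < j := by
        by_contra hij
        have := (NPlus.deg_mult_le (n := n)).2 (not_lt.1 hij)
        omega
      refine hne ?_
      rw [hZm, ← ih i hij, sub_eq_zero]
      refine Finset.sum_subset (fun k hk => ?_) fun k _ hk => ?_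
      · simp only [Finset.mem_range] at hk ⊢
        omega
      · refine dilogComb_eq_zero_of_deg_lt _ _ ?_
        rw [Finset.mem_range] at hk
        by_contra h
        have := (NPlus.deg_mult_le (n := n)).1 (not_lt.1 h)
        omega
    have h1 := laurent_laurentCoeff (mul_leading_mem hZ (n.mult j) hZ0)
    rw [hZm, ← exponents_eq] at h1
    rw [Finset.sum_range_succ, dilogComb_self, h1, mul_div_cancel_right₀ _ (leading_ne_zero _)]
    ring

end StructureGroup

/-! ### Finitely generated cones -/

open Classical in
lemma sum_eq_sum_sign {ι M : Type*} [AddCommGroup M] {S : Finset ι} (l : ι → ℝ) (f : ι → M) :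
    ∑ s ∈ S, f s = ∑ s ∈ S.filter (fun s => l s = 0), f s +
      (∑ s ∈ S.filter (fun s => 0 < l s), f s + ∑ s ∈ S.filter (fun s => l s < 0), f s) := by
  rw [← Finset.sum_filter_add_sum_filter_not S (fun s => l s = 0) f,
    ← Finset.sum_filter_add_sum_filter_not (S.filter fun s => ¬ l s = 0) (fun s => 0 < l s) f,
    Finset.filter_filter, Finset.filter_filter]
  congr 2
  · refine congrArg (fun t => Finset.sum t f) (Finset.filter_congr fun s _ => ?_)
    exact ⟨fun h => h.2, fun h => ⟨h.ne', h⟩⟩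
  · refine congrArg (fun t => Finset.sum t f) (Finset.filter_congr fun s _ => ?_)
    exact ⟨fun h => lt_of_le_of_ne (not_lt.1 h.2) h.1, fun h => ⟨h.ne, not_lt.2 h.le⟩⟩

section Cones

variable {V : Type*} [AddCommGroup V] [Module ℝ V]

lemma mem_hull_insert {s : V} {S : Set V} {z : V} :
    z ∈ PointedCone.hull ℝ (insert s S) ↔ ∃ a : ℝ, 0 ≤ a ∧ z - a • s ∈ PointedCone.hull ℝ S := by
  rw [PointedCone.hull, Submodule.mem_span_insert]
  constructor
  · rintro ⟨a, y, hy, rfl⟩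
    refine ⟨a.1, a.2, ?_⟩
    convert hy using 1
    exact add_sub_cancel_left _ _
  · rintro ⟨a, ha, h⟩
    exact ⟨⟨a, ha⟩, _, h, (add_sub_cancel _ _).symm⟩

lemma mem_hull_finset {S : Finset V} {z : V} :
    z ∈ PointedCone.hull ℝ (S : Set V) ↔
      ∃ a : V → ℝ, (∀ s, 0 ≤ a s) ∧ ∑ s ∈ S, a s • s = z := by
  rw [PointedCone.hull]
  constructor
  · intro h
    obtain ⟨f, -, hf⟩ := Submodule.mem_span_finset.1 h
    exact ⟨fun s => (f s).1, fun s => (f s).2, hf⟩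
  · rintro ⟨a, ha, rfl⟩
    exact Submodule.sum_mem _ fun s hs =>
      Submodule.smul_mem _ (⟨a s, ha s⟩ : {c : ℝ // 0 ≤ c}) (Submodule.subset_span hs)

/-- A finitely generated cone is a finite intersection of half spaces. -/
lemma exists_halfspaces [FiniteDimensional ℝ V] (S : Finset V) :
    ∃ F : Finset (Module.Dual ℝ V), ∀ z, z ∈ PointedCone.hull ℝ (S : Set V) ↔ ∀ l ∈ F, 0 ≤ l z := by
  classical
  induction S using Finset.induction_on with
  | empty =>
    let B := Module.finBasis ℝ V
    refine ⟨(Finset.univ.image fun i => B.coord i) ∪ Finset.univ.image fun i => -B.coord i,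
      fun z => ?_⟩
    simp only [Finset.coe_empty, PointedCone.hull, Submodule.span_empty, Submodule.mem_bot,
      Finset.mem_union, Finset.mem_image, Finset.mem_univ, true_and]
    constructor
    · rintro rfl l _
      rw [map_zero]
    · intro h
      refine B.ext_elem fun i => ?_
      have h1 := h _ (Or.inl ⟨i, rfl⟩)
      have h2 := h _ (Or.inr ⟨i, rfl⟩)
      rw [LinearMap.neg_apply] at h2
      rw [map_zero]
      exact le_antisymm (by linarith : B.coord i z ≤ 0) h1
  | insert s S _ ih =>
    obtain ⟨F, hF⟩ := ih
    -- Fourier–Motzkin elimination of `a` from the inequalities `0 ≤ l (z - a s)`: each lower bound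
    -- for `a` is paired with each upper bound.
    refine ⟨F.filter (fun l => 0 ≤ l s) ∪
      Finset.image₂ (fun l m : Module.Dual ℝ V => l s • m - m s • l) (F.filter fun l => 0 < l s)
        (F.filter fun m => m s < 0), fun z => ?_⟩
    rw [Finset.coe_insert, mem_hull_insert]
    simp only [hF, map_sub, map_smul, smul_eq_mul, Finset.mem_union, Finset.mem_filter,
      Finset.mem_image₂]
    constructor
    · rintro ⟨a, ha, h⟩ l (⟨hl, hls⟩ | ⟨p, ⟨hp, hps⟩, m, ⟨hm, hms⟩, rfl⟩)
      · have := h l hl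
        nlinarith [mul_nonneg ha hls]
      · have h1 := h p hp
        have h2 := h m hm
        simp only [LinearMap.sub_apply, LinearMap.smul_apply, smul_eq_mul]
        nlinarith
    · intro h
      -- The lower bounds for `a`, including `0`; their maximum satisfies all upper bounds by the
      -- paired inequalities.
      let A : Finset ℝ := insert 0 ((F.filter fun m => m s < 0).image fun m => m z / m s)
      have hA : A.Nonempty := Finset.insert_nonempty _ _
      refine ⟨A.max' hA, A.le_max' 0 (Finset.mem_insert_self _ _), fun l hl => ?_⟩
      rcases lt_trichotomy (l s) 0 with hs | hs | hs
      · have h1 : l z / l s ≤ A.max' hA := A.le_max' _ (Finset.mem_insert_of_mem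
          (Finset.mem_image.2 ⟨l, Finset.mem_filter.2 ⟨hl, hs⟩, rfl⟩))
        rw [div_le_iff_of_neg hs] at h1
        linarith
      · have := h l (Or.inl ⟨hl, hs.ge⟩)
        rw [hs, mul_zero, sub_zero]
        exact this
      · have h1 : A.max' hA ≤ l z / l s := by
          refine A.max'_le hA _ fun x hx => ?_
          rcases Finset.mem_insert.1 hx with rfl | hx
          · exact div_nonneg (h l (Or.inl ⟨hl, hs.le⟩)) hs.le
          · obtain ⟨m, hm, rfl⟩ := Finset.mem_image.1 hx
            obtain ⟨hm, hms⟩ := Finset.mem_filter.1 hm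
            have := h _ (Or.inr ⟨l, ⟨hl, hs⟩, m, ⟨hm, hms⟩, rfl⟩)
            simp only [LinearMap.sub_apply, LinearMap.smul_apply, smul_eq_mul] at this
            rw [div_le_iff_of_neg hms, div_mul_eq_mul_div, div_le_iff₀ hs]
            linarith
        rw [le_div_iff₀ hs] at h1
        linarith

/-- The intersection of a finitely generated cone with a hyperplane is finitely generated. -/
lemma exists_hull_eq_inter_ker (Λ : AddSubgroup V) (S : Finset V) (hS : (S : Set V) ⊆ Λ)
    (l : Module.Dual ℝ V) (hl : ∀ x ∈ Λ, ∃ k : ℤ, l x = k) :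
    ∃ S' : Finset V, (S' : Set V) ⊆ Λ ∧
      ∀ z, z ∈ PointedCone.hull ℝ (S' : Set V) ↔ z ∈ PointedCone.hull ℝ (S : Set V) ∧ l z = 0 := by
  classical
  let P := S.filter fun s => 0 < l s
  let Q := S.filter fun s => l s < 0
  let Z := S.filter fun s => l s = 0
  -- Generators already on the hyperplane, together with the point of the hyperplane on each segment
  -- joining opposite sides, scaled by integers so as to stay in `Λ`.
  let T := Z ∪ Finset.image₂ (fun s t : V => l s • t - l t • s) P Q
  have hT : ∀ x ∈ T, x ∈ Λ ∧ x ∈ PointedCone.hull ℝ (S : Set V) ∧ l x = 0 := by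
    intro x hx
    have hsub : ∀ y ∈ S, y ∈ PointedCone.hull ℝ (S : Set V) := fun y hy => PointedCone.subset_hull hy
    rcases Finset.mem_union.1 hx with hx | hx
    · obtain ⟨hx, h0⟩ := Finset.mem_filter.1 hx
      exact ⟨hS hx, hsub x hx, h0⟩
    · obtain ⟨s, hs, t, ht, rfl⟩ := Finset.mem_image₂.1 hx
      obtain ⟨hs, hs0⟩ := Finset.mem_filter.1 hs
      obtain ⟨ht, ht0⟩ := Finset.mem_filter.1 ht
      refine ⟨?_, ?_, ?_⟩
      · obtain ⟨k, hk⟩ := hl s (hS hs)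
        obtain ⟨m, hm⟩ := hl t (hS ht)
        rw [hk, hm, Int.cast_smul_eq_zsmul, Int.cast_smul_eq_zsmul]
        exact Λ.sub_mem (Λ.zsmul_mem (hS ht) k) (Λ.zsmul_mem (hS hs) m)
      · rw [sub_eq_add_neg, ← neg_smul]
        exact Submodule.add_mem _ (PointedCone.smul_mem _ hs0.le (hsub t ht))
          (PointedCone.smul_mem _ (neg_nonneg.2 ht0.le) (hsub s hs))
      · simp only [map_sub, map_smul, smul_eq_mul]
        ring
  refine ⟨T, fun x hx => (hT x hx).1, fun z => ⟨fun hz => ?_, fun ⟨hz, hz0⟩ => ?_⟩⟩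
  · obtain ⟨a, ha, rfl⟩ := mem_hull_finset.1 hz
    refine ⟨Submodule.sum_mem _ fun s hs => PointedCone.smul_mem _ (ha s) (hT s hs).2.1, ?_⟩
    rw [map_sum]
    exact Finset.sum_eq_zero fun s hs => by rw [map_smul, (hT s hs).2.2, smul_zero]
  · obtain ⟨a, ha, rfl⟩ := mem_hull_finset.1 hz
    have hmem : ∀ x ∈ T, x ∈ PointedCone.hull ℝ (T : Set V) := fun x hx => PointedCone.subset_hull hx
    rw [map_sum, sum_eq_sum_sign l] at hz0
    simp only [map_smul, smul_eq_mul] at hz0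
    rw [Finset.sum_eq_zero (s := Z) fun s hs => by
      rw [(Finset.mem_filter.1 hs).2, mul_zero], zero_add] at hz0
    set p := ∑ s ∈ P, a s * l s with hp
    have hP : ∀ s ∈ P, 0 ≤ a s * l s := fun s hs =>
      mul_nonneg (ha s) (Finset.mem_filter.1 hs).2.le
    have hQ : ∀ s ∈ Q, 0 ≤ -(a s * l s) := fun s hs => by
      have := mul_nonneg (ha s) (neg_nonneg.2 (Finset.mem_filter.1 hs).2.le)
      linarith
    have hq : ∑ s ∈ Q, a s * l s = -p := by linarith
    rw [sum_eq_sum_sign l]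
    refine Submodule.add_mem _ (Submodule.sum_mem _ fun s hs =>
      PointedCone.smul_mem _ (ha s) (hmem s (Finset.mem_union_left _ hs))) ?_
    -- The total weight `p` of the positive side equals that of the negative side. If it is `0`,
    -- neither side occurs.
    rcases (Finset.sum_nonneg hP).eq_or_lt with h0 | h0
    · have hP0 : ∀ s ∈ P, a s = 0 := fun s hs => by
        have := (Finset.sum_eq_zero_iff_of_nonneg hP).1 h0.symm s hs
        exact (mul_eq_zero.1 this).resolve_right (Finset.mem_filter.1 hs).2.ne'
      have hQ0 : ∀ s ∈ Q, a s = 0 := fun s hs => by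
        have h1 : ∑ s ∈ Q, -(a s * l s) = 0 := by
          rw [Finset.sum_neg_distrib, hq, hp, ← h0]
          simp
        have := (Finset.sum_eq_zero_iff_of_nonneg hQ).1 h1 s hs
        exact (mul_eq_zero.1 (neg_eq_zero.1 this)).resolve_right (Finset.mem_filter.1 hs).2.ne
      rw [Finset.sum_eq_zero fun s hs => by rw [hP0 s hs, zero_smul],
        Finset.sum_eq_zero fun s hs => by rw [hQ0 s hs, zero_smul], add_zero]
      exact Submodule.zero_mem _
    -- Otherwise distribute each positive generator over the negative ones in proportion to their
    -- weights; the normalization `p⁻¹` comes from the common total weight.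
    · have e : ∑ s ∈ P, a s • s + ∑ t ∈ Q, a t • t =
          p⁻¹ • ∑ s ∈ P, ∑ t ∈ Q, (a s * a t) • (l s • t - l t • s) := by
        have e1 : ∑ s ∈ P, ∑ t ∈ Q, (a s * a t) • (l s • t - l t • s) =
            p • ∑ t ∈ Q, a t • t + p • ∑ s ∈ P, a s • s := by
          have e2 : p • ∑ t ∈ Q, a t • t = ∑ s ∈ P, ∑ t ∈ Q, (a s * a t) • (l s • t) := by
            rw [hp, Finset.sum_smul]
            refine Finset.sum_congr rfl fun s _ => ?_
            rw [Finset.smul_sum]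
            refine Finset.sum_congr rfl fun t _ => ?_
            rw [smul_smul, smul_smul]
            congr 1
            ring
          have e3 : p • ∑ s ∈ P, a s • s = -∑ s ∈ P, ∑ t ∈ Q, (a s * a t) • (l t • s) := by
            rw [← neg_neg p, ← hq, neg_smul, Finset.smul_sum]
            congr 1
            refine Finset.sum_congr rfl fun s _ => ?_
            rw [Finset.sum_smul]
            refine Finset.sum_congr rfl fun t _ => ?_
            rw [smul_smul, smul_smul]
            congr 1
            ring
          simp only [smul_sub, Finset.sum_sub_distrib]
          rw [e2, e3, sub_eq_add_neg]
        rw [e1, ← smul_add, smul_smul, inv_mul_cancel₀ h0.ne', one_smul, add_comm]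
      rw [e]
      refine PointedCone.smul_mem _ (inv_nonneg.2 h0.le) (Submodule.sum_mem _ fun s hs =>
        Submodule.sum_mem _ fun t ht => PointedCone.smul_mem _ (mul_nonneg (ha s) (ha t)) (hmem _ ?_))
      exact Finset.mem_union_right _ (Finset.mem_image₂.2 ⟨s, hs, t, ht, rfl⟩)

end Cones

/-! ### Rational cones -/

/-- The integral points of `M_ℝ`. -/
def intPoints (r : ℕ) : AddSubgroup (MR r) where
  carrier := {x | ∀ i, ∃ k : ℤ, x i = k}
  zero_mem' := fun i => ⟨0, by simp⟩
  add_mem' := fun {x y} hx hy i => by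
    obtain ⟨k, hk⟩ := hx i
    obtain ⟨m, hm⟩ := hy i
    exact ⟨k + m, by simp [hk, hm]⟩
  neg_mem' := fun {x} hx i => by
    obtain ⟨k, hk⟩ := hx i
    exact ⟨-k, by simp [hk]⟩

lemma isRationalCone_iff {C : PointedCone ℝ (MR r)} : IsRationalCone C ↔
    ∃ S : Finset (MR r), (S : Set (MR r)) ⊆ intPoints r ∧
      C = PointedCone.hull ℝ (S : Set (MR r)) := by
  classical
  constructor
  · rintro ⟨S, hS⟩
    refine ⟨S.image fun v i => (v i : ℝ), ?_, by rw [hS, Finset.coe_image]⟩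
    intro x hx
    obtain ⟨v, _, rfl⟩ := Finset.mem_image.1 (Finset.mem_coe.1 hx)
    exact fun i => ⟨v i, rfl⟩
  · rintro ⟨S, hS, rfl⟩
    refine ⟨S.image fun x i => ⌊x i⌋, ?_⟩
    rw [Finset.coe_image, Set.image_image]
    congr 1
    have h : ∀ x ∈ (S : Set (MR r)), (fun i => ((⌊x i⌋ : ℤ) : ℝ)) = x := fun x hx => by
      funext i
      obtain ⟨k, hk⟩ := hS hx i
      rw [hk, Int.floor_intCast]
    exact ((Set.image_congr h).trans (Set.image_id' _)).symm

/-- The intersection is the projection of the product cone cut with the diagonal. The diagonal is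
imposed one coordinate at a time, each time cutting with a hyperplane that is integral on lattice
points. -/
lemma IsRationalCone.inf {C C' : PointedCone ℝ (MR r)} (hC : IsRationalCone C)
    (hC' : IsRationalCone C') : IsRationalCone (C ⊓ C') := by
  classical
  obtain ⟨S, hS, rfl⟩ := isRationalCone_iff.1 hC
  obtain ⟨S', hS', rfl⟩ := isRationalCone_iff.1 hC'
  let Λ : AddSubgroup (MR r × MR r) := (intPoints r).prod (intPoints r)
  let T₀ : Finset (MR r × MR r) := S.image (fun s => (s, 0)) ∪ S'.image fun s => (0, s)
  have hT₀ : (T₀ : Set (MR r × MR r)) ⊆ Λ := by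
    intro x hx
    rcases Finset.mem_union.1 (Finset.mem_coe.1 hx) with hx | hx
    · obtain ⟨s, hs, rfl⟩ := Finset.mem_image.1 hx
      exact ⟨hS hs, (intPoints r).zero_mem⟩
    · obtain ⟨s, hs, rfl⟩ := Finset.mem_image.1 hx
      exact ⟨(intPoints r).zero_mem, hS' hs⟩
  have hmem₀ : ∀ w : MR r × MR r, w ∈ PointedCone.hull ℝ (T₀ : Set (MR r × MR r)) ↔
      w.1 ∈ PointedCone.hull ℝ (S : Set (MR r)) ∧ w.2 ∈ PointedCone.hull ℝ (S' : Set (MR r)) := by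
    intro w
    constructor
    · intro hw
      obtain ⟨a, ha, rfl⟩ := mem_hull_finset.1 hw
      rw [Prod.fst_sum, Prod.snd_sum]
      refine ⟨Submodule.sum_mem _ fun x hx => PointedCone.smul_mem _ (ha x) ?_,
        Submodule.sum_mem _ fun x hx => PointedCone.smul_mem _ (ha x) ?_⟩
      · rcases Finset.mem_union.1 hx with hx | hx
        · obtain ⟨s, hs, rfl⟩ := Finset.mem_image.1 hx
          exact PointedCone.subset_hull hs
        · obtain ⟨s, hs, rfl⟩ := Finset.mem_image.1 hx
          exact Submodule.zero_mem _
      · rcases Finset.mem_union.1 hx with hx | hx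
        · obtain ⟨s, hs, rfl⟩ := Finset.mem_image.1 hx
          exact Submodule.zero_mem _
        · obtain ⟨s, hs, rfl⟩ := Finset.mem_image.1 hx
          exact PointedCone.subset_hull hs
    · rintro ⟨h1, h2⟩
      obtain ⟨a, ha, h1⟩ := mem_hull_finset.1 h1
      obtain ⟨b, hb, h2⟩ := mem_hull_finset.1 h2
      have e : w = ∑ s ∈ S, a s • ((s, 0) : MR r × MR r) +
          ∑ s ∈ S', b s • ((0, s) : MR r × MR r) := by
        refine Prod.ext ?_ ?_
        · rw [Prod.fst_add, Prod.fst_sum, Prod.fst_sum]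
          simp [← h1]
        · rw [Prod.snd_add, Prod.snd_sum, Prod.snd_sum]
          simp [← h2]
      rw [e]
      refine Submodule.add_mem _ (Submodule.sum_mem _ fun s hs => PointedCone.smul_mem _ (ha s) ?_)
        (Submodule.sum_mem _ fun s hs => PointedCone.smul_mem _ (hb s) ?_)
      · exact PointedCone.subset_hull (Finset.mem_union_left _ (Finset.mem_image_of_mem _ hs))
      · exact PointedCone.subset_hull (Finset.mem_union_right _ (Finset.mem_image_of_mem _ hs))
  have hdiag : ∀ J : Finset (Fin r), ∃ T : Finset (MR r × MR r), (T : Set (MR r × MR r)) ⊆ Λ ∧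
      ∀ w : MR r × MR r, w ∈ PointedCone.hull ℝ (T : Set (MR r × MR r)) ↔
        (w.1 ∈ PointedCone.hull ℝ (S : Set (MR r)) ∧
          w.2 ∈ PointedCone.hull ℝ (S' : Set (MR r))) ∧ ∀ i ∈ J, w.1 i = w.2 i := by
    intro J
    induction J using Finset.induction_on with
    | empty => exact ⟨T₀, hT₀, fun w => by rw [hmem₀]; simp⟩
    | insert j J _ ih =>
      obtain ⟨T, hT, hw⟩ := ih
      obtain ⟨T', hT', hw'⟩ := exists_hull_eq_inter_ker Λ T hT
        (LinearMap.proj j ∘ₗ LinearMap.fst ℝ (MR r) (MR r) -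
          LinearMap.proj j ∘ₗ LinearMap.snd ℝ (MR r) (MR r)) (by
          rintro ⟨x, y⟩ ⟨hx, hy⟩
          obtain ⟨k, hk⟩ := hx j
          obtain ⟨m, hm⟩ := hy j
          dsimp only at hk hm
          exact ⟨k - m, by simp [hk, hm]⟩)
      refine ⟨T', hT', fun w => ?_⟩
      rw [hw', hw]
      simp only [LinearMap.sub_apply, LinearMap.comp_apply, LinearMap.fst_apply,
        LinearMap.snd_apply, LinearMap.proj_apply, sub_eq_zero, Finset.forall_mem_insert]
      tauto
  obtain ⟨T, hT, hw⟩ := hdiag Finset.univ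
  refine isRationalCone_iff.2 ⟨T.image Prod.fst, ?_, ?_⟩
  · intro x hx
    obtain ⟨w, hw', rfl⟩ := Finset.mem_image.1 (Finset.mem_coe.1 hx)
    exact (hT hw').1
  · refine PointedCone.ext fun z => ?_
    have hmap : PointedCone.hull ℝ ((T.image Prod.fst : Finset (MR r)) : Set (MR r)) =
        (PointedCone.hull ℝ (T : Set (MR r × MR r))).map (LinearMap.fst ℝ (MR r) (MR r)) := by
      rw [PointedCone.map, PointedCone.hull, PointedCone.hull, Submodule.map_span, Finset.coe_image]
      rfl
    rw [hmap, PointedCone.mem_map]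
    constructor
    · rintro ⟨h1, h2⟩
      exact ⟨(z, z), (hw _).2 ⟨⟨h1, h2⟩, fun _ _ => rfl⟩, rfl⟩
    · rintro ⟨w, hw', rfl⟩
      obtain ⟨⟨h1, h2⟩, h3⟩ := (hw w).1 hw'
      have h4 : w.1 = w.2 := funext fun i => h3 i (Finset.mem_univ i)
      exact ⟨h1, show w.1 ∈ _ from h4 ▸ h2⟩

lemma IsRationalCone.finset_inf {T : Finset (PointedCone ℝ (MR r))} (hT : T.Nonempty)
    (h : ∀ C ∈ T, IsRationalCone C) : IsRationalCone (T.inf id) := by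
  induction hT using Finset.Nonempty.cons_induction with
  | singleton C => simpa using h C (Finset.mem_singleton_self C)
  | cons C T hC hT ih =>
    rw [Finset.inf_cons]
    exact (h C (Finset.mem_cons_self C T)).inf (ih fun D hD => h D (Finset.mem_cons_of_mem hD))

lemma IsRationalCone.isClosed {C : PointedCone ℝ (MR r)} (hC : IsRationalCone C) :
    IsClosed (C : Set (MR r)) := by
  obtain ⟨S, -, rfl⟩ := isRationalCone_iff.1 hC
  obtain ⟨F, hF⟩ := exists_halfspaces S
  have e : (PointedCone.hull ℝ (S : Set (MR r)) : Set (MR r)) = ⋂ l ∈ F, {z | 0 ≤ l z} := by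
    ext z
    simp only [SetLike.mem_coe, hF, Set.mem_iInter, Set.mem_ofPred_eq]
  rw [e]
  exact isClosed_biInter fun l _ =>
    isClosed_le continuous_const (LinearMap.continuous_of_finiteDimensional l)

/-- The relative boundary of a rational cone lies in the spans of sets of generators of smaller
dimension. -/
lemma exists_span_of_mem_intrinsicFrontier {S : Finset (Fin r → ℤ)} {z : MR r}
    (hz : z ∈ intrinsicFrontier ℝ (PointedCone.hull ℝ
      ((fun (v : Fin r → ℤ) i => (v i : ℝ)) '' (S : Set (Fin r → ℤ))) : Set (MR r))) :
    ∃ S' : Finset (Fin r → ℤ),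
      z ∈ Submodule.span ℝ ((fun (v : Fin r → ℤ) i => (v i : ℝ)) '' (S' : Set (Fin r → ℤ))) ∧
      Module.finrank ℝ (Submodule.span ℝ
        ((fun (v : Fin r → ℤ) i => (v i : ℝ)) '' (S' : Set (Fin r → ℤ)))) <
      coneDim (PointedCone.hull ℝ ((fun (v : Fin r → ℤ) i => (v i : ℝ)) '' (S : Set (Fin r → ℤ)))) := by
  classical
  set ι : (Fin r → ℤ) → MR r := fun v i => (v i : ℝ)
  set C := PointedCone.hull ℝ (ι '' (S : Set (Fin r → ℤ)))
  have hCS : C = PointedCone.hull ℝ ((S.image ι : Finset (MR r)) : Set (MR r)) := by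
    rw [Finset.coe_image]
  have hzC : z ∈ C :=
    intrinsicFrontier_subset (IsRationalCone.isClosed ⟨S, rfl⟩) hz
  obtain ⟨F, hF⟩ := exists_halfspaces (S.image ι)
  rw [← hCS] at hF
  have hspan : (C : Set (MR r)) ⊆ Submodule.span ℝ (ι '' (S : Set (Fin r → ℤ))) :=
    fun _ hx => PointedCone.hull_le_span ℝ _ hx
  -- Some inequality is an equality at `z` without vanishing on the cone. Otherwise each one either
  -- vanishes on the whole span or is strict at `z`, hence near `z`, and `z` is a relative interior
  -- point.
  have key : ∃ l ∈ F, l z = 0 ∧ ∃ s ∈ S, l (ι s) ≠ 0 := by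
    by_contra! hcon
    obtain ⟨y, hy, rfl⟩ := mem_intrinsicFrontier.1 hz
    refine hy.2 (mem_interior.2 ⟨{x | ∀ l ∈ F, 0 < l y.1 → 0 < l x.1}, ?_, ?_, fun _ _ h => h⟩)
    · intro x hx
      refine (hF _).2 fun l hl => ?_
      rcases ((hF _).1 hzC l hl).eq_or_lt with h0 | h0
      · have h1 : Submodule.span ℝ (ι '' (S : Set (Fin r → ℤ))) ≤ LinearMap.ker l := by
          rw [Submodule.span_le]
          rintro _ ⟨s, hs, rfl⟩
          exact hcon l hl h0.symm s hs
        have h2 : x.1 ∈ Submodule.span ℝ (C : Set (MR r)) := affineSpan_subset_span x.2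
        have h3 : x.1 ∈ LinearMap.ker l := h1 (Submodule.span_le.2 hspan h2)
        exact (LinearMap.mem_ker.1 h3).ge
      · exact (hx l hl h0).le
    · have e : {x : affineSpan ℝ (C : Set (MR r)) | ∀ l ∈ F, 0 < l y.1 → 0 < l x.1} =
          ⋂ l ∈ F, {x | 0 < l y.1 → 0 < l x.1} := by
        ext x
        simp only [Set.mem_iInter, Set.mem_ofPred_eq]
      rw [e]
      refine isOpen_biInter_finset fun l _ => ?_
      by_cases h0 : 0 < l y.1
      · simp only [h0, true_imp_iff]
        exact isOpen_lt continuous_const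
          ((LinearMap.continuous_of_finiteDimensional l).comp continuous_subtype_val)
      · simp only [h0, false_imp_iff]
        exact isOpen_univ
  obtain ⟨l, hl, hz0, s₀, hs₀, hne⟩ := key
  -- The face on which `l` vanishes: a nonnegative combination with `l z = 0` uses only generators
  -- with `l = 0`, and `s₀` shows that the dimension drops.
  refine ⟨S.filter fun s => l (ι s) = 0, ?_, ?_⟩
  · rw [hCS] at hzC
    obtain ⟨a, ha, rfl⟩ := mem_hull_finset.1 hzC
    have hnn : ∀ x ∈ S.image ι, 0 ≤ a x * l x := fun x hx => by
      refine mul_nonneg (ha x) ((hF x).1 ?_ l hl)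
      rw [hCS]
      exact PointedCone.subset_hull hx
    have hsum : ∑ x ∈ S.image ι, a x * l x = 0 := by
      rw [← hz0, map_sum]
      simp
    refine Submodule.sum_mem _ fun x hx => ?_
    have h0 := (Finset.sum_eq_zero_iff_of_nonneg hnn).1 hsum x hx
    rcases mul_eq_zero.1 h0 with h | h
    · rw [h, zero_smul]
      exact Submodule.zero_mem _
    · obtain ⟨s, hs, rfl⟩ := Finset.mem_image.1 hx
      exact Submodule.smul_mem _ _ (Submodule.subset_span
        ⟨s, Finset.mem_coe.2 (Finset.mem_filter.2 ⟨hs, h⟩), rfl⟩)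
  · refine Submodule.finrank_lt_finrank_of_lt (lt_of_le_of_ne ?_ fun h => ?_)
    · refine Submodule.span_mono ?_
      rintro _ ⟨s, hs, rfl⟩
      exact PointedCone.subset_hull ⟨s, (Finset.mem_filter.1 (Finset.mem_coe.1 hs)).1, rfl⟩
    · have h1 : ι s₀ ∈ Submodule.span ℝ (C : Set (MR r)) :=
        Submodule.subset_span (PointedCone.subset_hull ⟨s₀, hs₀, rfl⟩)
      rw [← h] at h1
      have h2 : Submodule.span ℝ (ι '' ((S.filter fun s => l (ι s) = 0 : Finset (Fin r → ℤ)) :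
          Set (Fin r → ℤ))) ≤ LinearMap.ker l := by
        rw [Submodule.span_le]
        rintro _ ⟨s, hs, rfl⟩
        exact (Finset.mem_filter.1 (Finset.mem_coe.1 hs)).2
      exact hne (h2 h1)

/-! ### Hyperplanes and walls -/

/-- The pairing with an element of `N⁺` as a linear functional on `M_ℝ`. -/
def pairingL (n : Expo r) : Module.Dual ℝ (MR r) where
  toFun := pairing n
  map_add' x y := by simp [pairing, mul_add, Finset.sum_add_distrib]
  map_smul' c x := by
    simp only [pairing, Pi.smul_apply, smul_eq_mul, RingHom.id_apply, Finset.mul_sum]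
    exact Finset.sum_congr rfl fun i _ => by ring

lemma pairingL_apply (n : Expo r) (z : MR r) : pairingL n z = pairing n z := rfl

lemma pairingL_single (n : Expo r) (i : Fin r) : pairingL n (Pi.single i 1) = n i := by
  rw [pairingL_apply, pairing, Finset.sum_eq_single i]
  · simp
  · intro j _ hj
    simp [Pi.single_eq_of_ne hj]
  · simp

lemma pairing_nsmul (j : ℕ) (n : Expo r) (z : MR r) : pairing (j • n) z = j * pairing n z := by
  rw [pairing, pairing, Finset.mul_sum]
  refine Finset.sum_congr rfl fun i _ => ?_
  rw [Finsupp.smul_apply, smul_eq_mul]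
  push_cast
  ring

lemma pairingL_ne_zero (n : NPlus r) : pairingL n.1 ≠ 0 := by
  intro h
  refine n.2 (Finsupp.ext fun i => ?_)
  have h1 := pairingL_single n.1 i
  rw [h, LinearMap.zero_apply] at h1
  exact_mod_cast h1.symm

/-- The hyperplane `n^⊥`. -/
def perp (n : Expo r) : Submodule ℝ (MR r) := LinearMap.ker (pairingL n)

lemma mem_perp {n : Expo r} {z : MR r} : z ∈ perp n ↔ pairing n z = 0 := LinearMap.mem_ker

lemma finrank_perp (n : NPlus r) : Module.finrank ℝ (perp n.1) + 1 = r := by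
  rw [perp, Module.Dual.finrank_ker_add_one_of_ne_zero (pairingL_ne_zero n), Module.finrank_fin_fun]

/-- After division by the greatest common divisor, `p'` is coprime to `q'` and divides every
coordinate of the primitive vector `n'`, so `p' = 1`. -/
lemma IsPrimitive.dvd {n n' : NPlus r} (hn' : IsPrimitive n') {p q : ℕ} (hq : 0 < q)
    (h : ∀ i, q * n'.1 i = p * n.1 i) : p ∣ q := by
  have hg : 0 < Nat.gcd p q := Nat.gcd_pos_of_pos_right p hq
  obtain ⟨p', hp'⟩ := Nat.gcd_dvd_left p q
  obtain ⟨q', hq'⟩ := Nat.gcd_dvd_right p q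
  have hco : Nat.Coprime p' q' := by
    have := Nat.coprime_div_gcd_div_gcd hg
    rwa [Nat.div_eq_of_eq_mul_right hg hp', Nat.div_eq_of_eq_mul_right hg hq'] at this
  have h1 : ∀ i, p' ∣ n'.1 i := fun i => by
    have h2 : q' * n'.1 i = p' * n.1 i := by
      refine Nat.eq_of_mul_eq_mul_left hg ?_
      rw [← mul_assoc, ← mul_assoc, ← hp', ← hq', h i]
    exact hco.dvd_of_dvd_mul_left ⟨_, h2⟩
  choose b hb using h1
  have h3 := hn' p' (Finsupp.equivFunOnFinite.symm b) (by
    ext i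
    simp [hb i])
  rw [h3, mul_one] at hp'
  rw [hp']
  exact Nat.gcd_dvd_right p q

/-- Primitive vectors with the same hyperplane are equal. -/
lemma IsPrimitive.eq_of_pairingL {n n' : NPlus r} (hn : IsPrimitive n) (hn' : IsPrimitive n')
    {c : ℝ} (h : pairingL n'.1 = c • pairingL n.1) : n = n' := by
  have h1 : ∀ i, (n'.1 i : ℝ) = c * n.1 i := fun i => by
    have := congrArg (fun l : Module.Dual ℝ (MR r) => l (Pi.single i 1)) h
    simpa [pairingL_single] using this
  obtain ⟨j, hj⟩ : ∃ j, n.1 j ≠ 0 := by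
    by_contra! hcon
    exact n.2 (Finsupp.ext hcon)
  have h2 : ∀ i, n.1 j * n'.1 i = n'.1 j * n.1 i := fun i => by
    have : (n.1 j * n'.1 i : ℝ) = n'.1 j * n.1 i := by
      rw [h1 i, h1 j]
      ring
    exact_mod_cast this
  have hj' : n'.1 j ≠ 0 := by
    intro h0
    refine n'.2 (Finsupp.ext fun i => ?_)
    have := h2 i
    rw [h0, zero_mul] at this
    exact (mul_eq_zero.1 this).resolve_left hj
  have d1 := hn'.dvd (Nat.pos_of_ne_zero hj) h2
  have d2 := hn.dvd (Nat.pos_of_ne_zero hj') fun i => (h2 i).symm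
  have e := Nat.dvd_antisymm d1 d2
  refine Subtype.ext (Finsupp.ext fun i => ?_)
  have := h2 i
  rw [e] at this
  exact (Nat.eq_of_mul_eq_mul_left (Nat.pos_of_ne_zero hj) this).symm

/-- The rays of different primitive vectors have no common point of `N⁺`. This separates the
contributions of different hyperplanes to a given coefficient. -/
lemma IsPrimitive.eq_of_nsmul {n n' : NPlus r} (hn : IsPrimitive n) (hn' : IsPrimitive n')
    {m : NPlus r} {j j' : ℕ} (h : m.1 = j • n.1) (h' : m.1 = j' • n'.1) : n = n' := by
  have hj' : (j' : ℝ) ≠ 0 := Nat.cast_ne_zero.2 fun h0 => m.2 (by rw [h', h0, zero_smul])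
  refine hn.eq_of_pairingL hn' (c := (j' : ℝ)⁻¹ * j) (LinearMap.ext fun z => ?_)
  rw [LinearMap.smul_apply, pairingL_apply, pairingL_apply, smul_eq_mul, mul_assoc,
    ← pairing_nsmul, ← h, h', pairing_nsmul, inv_mul_cancel_left₀ hj']

/-- If one functional vanished on the kernel of the other, the two would be proportional, and
primitivity would make the vectors equal. -/
lemma finrank_perp_inf_perp {n n' : NPlus r} (hn : IsPrimitive n) (hn' : IsPrimitive n')
    (hne : n ≠ n') : Module.finrank ℝ (perp n.1 ⊓ perp n'.1 : Submodule ℝ (MR r)) + 2 = r := by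
  have h1 := finrank_perp n
  set l : Module.Dual ℝ (perp n.1) := pairingL n'.1 ∘ₗ (perp n.1).subtype
  have hl : l ≠ 0 := by
    intro h
    have hker : LinearMap.ker (pairingL n.1) ≤ LinearMap.ker (pairingL n'.1) := fun z hz =>
      congrArg (fun f : Module.Dual ℝ (perp n.1) => f ⟨z, hz⟩) h
    obtain ⟨z, hz⟩ : ∃ z, pairingL n.1 z ≠ 0 := by
      by_contra! hcon
      exact pairingL_ne_zero n (LinearMap.ext hcon)
    refine hne (hn.eq_of_pairingL hn' (c := pairingL n'.1 z / pairingL n.1 z)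
      (LinearMap.ext fun x => ?_))
    have h3 : x - (pairingL n.1 x / pairingL n.1 z) • z ∈ LinearMap.ker (pairingL n.1) := by
      rw [LinearMap.mem_ker, map_sub, map_smul, smul_eq_mul, div_mul_cancel₀ _ hz, sub_self]
    have h4 := LinearMap.mem_ker.1 (hker h3)
    rw [map_sub, map_smul, smul_eq_mul, sub_eq_zero] at h4
    rw [h4, LinearMap.smul_apply, smul_eq_mul]
    ring
  have h2 := Module.Dual.finrank_ker_add_one_of_ne_zero hl
  have h3 : (LinearMap.ker l).map (perp n.1).subtype = perp n.1 ⊓ perp n'.1 := by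
    ext z
    constructor
    · rintro ⟨w, hw, rfl⟩
      exact ⟨w.2, hw⟩
    · rintro ⟨hz, hz'⟩
      exact ⟨⟨z, hz⟩, hz', rfl⟩
  have h4 : Module.finrank ℝ (perp n.1 ⊓ perp n'.1 : Submodule ℝ (MR r)) =
      Module.finrank ℝ (LinearMap.ker l) := by
    rw [← h3]
    exact (Submodule.equivMapOfInjective _ (Submodule.injective_subtype _) _).finrank_eq.symm
  omega

/-- A cone in a subspace `H` that contains a neighbourhood in `H` of one of its points spans `H`. -/
lemma coneDim_eq_of_isOpen {C : PointedCone ℝ (MR r)} {H : Submodule ℝ (MR r)}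
    (hCH : ∀ x ∈ C, x ∈ H) {U : Set (MR r)} (hU : IsOpen U) {z : MR r} (hz : z ∈ U) (hzH : z ∈ H)
    (h : ∀ x ∈ U, x ∈ H → x ∈ C) : coneDim C = Module.finrank ℝ H := by
  have e : Submodule.span ℝ (C : Set (MR r)) = H := by
    refine le_antisymm (Submodule.span_le.2 hCH) fun x hx => ?_
    have hc : Continuous fun t : ℝ => z + t • x := by fun_prop
    have h0 : (fun t : ℝ => z + t • x) ⁻¹' U ∈ nhds (0 : ℝ) :=
      (hU.preimage hc).mem_nhds (by simpa using hz)
    obtain ⟨t, ht, ht0⟩ : ∃ t : ℝ, z + t • x ∈ U ∧ t ≠ 0 := by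
      have h0' : (fun t : ℝ => z + t • x) ⁻¹' U ∈ nhdsWithin (0 : ℝ) {0}ᶜ :=
        mem_nhdsWithin_of_mem_nhds h0
      exact Filter.nonempty_of_mem (Filter.inter_mem h0' self_mem_nhdsWithin)
    have h1 : z + t • x ∈ Submodule.span ℝ (C : Set (MR r)) :=
      Submodule.subset_span (h _ ht (H.add_mem hzH (H.smul_mem t hx)))
    have h2 : z ∈ Submodule.span ℝ (C : Set (MR r)) := Submodule.subset_span (h z hz hzH)
    have h3 := Submodule.smul_mem _ t⁻¹ (Submodule.sub_mem _ h1 h2)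
    rwa [add_sub_cancel_left, smul_smul, inv_mul_cancel₀ ht0, one_smul] at h3
  rw [coneDim, e]

namespace Wall

variable {𝔰 : Seed Γ}

lemma span_support (w : Wall 𝔰) :
    Submodule.span ℝ (w.support : Set (MR r)) = perp w.normal.1 := by
  refine Submodule.eq_of_le_of_finrank_eq (Submodule.span_le.2 fun z hz =>
    mem_perp.2 (w.support_perp z hz)) ?_
  have h1 := finrank_perp w.normal
  have h2 := w.support_codim
  rw [coneDim] at h2
  omega

lemma exists_isOpen (w : Wall 𝔰) {z : MR r} (hz : z ∈ w.support)
    (hz' : z ∉ intrinsicFrontier ℝ (w.support : Set (MR r))) :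
    ∃ U : Set (MR r), IsOpen U ∧ z ∈ U ∧ ∀ x ∈ U, x ∈ perp w.normal.1 → x ∈ w.support := by
  have h1 : z ∈ intrinsicInterior ℝ (w.support : Set (MR r)) := by
    have h2 : z ∈ intrinsicFrontier ℝ (w.support : Set (MR r)) ∪
        intrinsicInterior ℝ (w.support : Set (MR r)) := by
      rw [intrinsicFrontier_union_intrinsicInterior]
      exact subset_intrinsicClosure hz
    exact h2.resolve_left hz'
  obtain ⟨y, hy, rfl⟩ := mem_intrinsicInterior.1 h1
  obtain ⟨U', hU', hU'o, hyU'⟩ := mem_interior.1 hy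
  obtain ⟨U, hU, rfl⟩ := isOpen_induced_iff.1 hU'o
  refine ⟨U, hU, hyU', fun x hx hxn => ?_⟩
  have h3 : x ∈ affineSpan ℝ (w.support : Set (MR r)) := by
    -- The relative interior refers to the affine span. As the cone contains `0`, this is the linear
    -- span, which is `n^⊥`.
    have h4 : insert (0 : MR r) (w.support : Set (MR r)) = w.support :=
      Set.insert_eq_of_mem w.support.zero_mem
    have h5 := affineSpan_insert_zero (k := ℝ) (w.support : Set (MR r))
    rw [h4, w.span_support] at h5
    exact (Set.ext_iff.1 h5 x).2 hxn
  exact hU' (show (⟨x, h3⟩ : affineSpan ℝ (w.support : Set (MR r))) ∈ _ from hx)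

end Wall

/-! ### The singular locus -/

/-- A countable family of subspaces of codimension at least two. -/
def codimTwo (r : ℕ) : Set (Submodule ℝ (MR r)) :=
  {W | Module.finrank ℝ W + 2 ≤ r ∧
    ((∃ S : Finset (Fin r → ℤ), W = Submodule.span ℝ
      ((fun (v : Fin r → ℤ) i => (v i : ℝ)) '' (S : Set (Fin r → ℤ)))) ∨
    ∃ p : NPlus r × NPlus r, W = perp p.1.1 ⊓ perp p.2.1)}

lemma countable_codimTwo (r : ℕ) : (codimTwo r).Countable := by
  refine Set.Countable.mono (s₂ := Set.range (fun S : Finset (Fin r → ℤ) => Submodule.span ℝ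
      ((fun (v : Fin r → ℤ) i => (v i : ℝ)) '' (S : Set (Fin r → ℤ)))) ∪
      Set.range fun p : NPlus r × NPlus r => perp p.1.1 ⊓ perp p.2.1) ?_
      ((Set.countable_range _).union (Set.countable_range _))
  rintro W ⟨-, ⟨S, rfl⟩ | ⟨p, rfl⟩⟩
  · exact Or.inl ⟨S, rfl⟩
  · exact Or.inr ⟨p, rfl⟩

namespace ScatteringDiagram

variable {𝔰 : Seed Γ} {D : ScatteringDiagram 𝔰}

lemma notMem_frontier {z : MR r} (hz : z ∉ D.Sing) (i : D.Index) :
    z ∉ intrinsicFrontier ℝ ((D.wall i).support : Set (MR r)) :=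
  fun h => hz (Or.inl (Set.mem_iUnion.2 ⟨i, h⟩))

lemma exists_isOpen {z : MR r} (hz : z ∉ D.Sing) {i : D.Index} (hi : z ∈ (D.wall i).support) :
    ∃ U : Set (MR r), IsOpen U ∧ z ∈ U ∧
      ∀ x ∈ U, x ∈ perp (D.wall i).normal.1 → x ∈ (D.wall i).support :=
  (D.wall i).exists_isOpen hi (notMem_frontier hz i)

/-- Near a common relative interior point each support fills its hyperplane, so the intersection of
the supports fills that of the hyperplanes. For different normals its dimension is then `r - 2`, as
in the definition of the singular locus. -/
lemma coneDim_inf_of_interior {i j : D.Index} {z : MR r} (hi : z ∈ (D.wall i).support)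
    (hj : z ∈ (D.wall j).support)
    (hfi : z ∉ intrinsicFrontier ℝ ((D.wall i).support : Set (MR r)))
    (hfj : z ∉ intrinsicFrontier ℝ ((D.wall j).support : Set (MR r))) :
    coneDim ((D.wall i).support ⊓ (D.wall j).support) =
      Module.finrank ℝ (perp (D.wall i).normal.1 ⊓ perp (D.wall j).normal.1 :
        Submodule ℝ (MR r)) := by
  obtain ⟨U, hU, hzU, h⟩ := (D.wall i).exists_isOpen hi hfi
  obtain ⟨U', hU', hzU', h'⟩ := (D.wall j).exists_isOpen hj hfj
  exact coneDim_eq_of_isOpen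
    (fun x hx => ⟨mem_perp.2 ((D.wall i).support_perp x hx.1),
      mem_perp.2 ((D.wall j).support_perp x hx.2)⟩) (hU.inter hU') ⟨hzU, hzU'⟩
    ⟨mem_perp.2 ((D.wall i).support_perp z hi), mem_perp.2 ((D.wall j).support_perp z hj)⟩
    fun x hx hxp => ⟨h x hx.1 hxp.1, h' x hx.2 hxp.2⟩

/-- The walls through a nonsingular point have the same normal vector. -/
lemma normal_eq {z : MR r} (hz : z ∉ D.Sing) {i j : D.Index} (hi : z ∈ (D.wall i).support)
    (hj : z ∈ (D.wall j).support) : (D.wall i).normal = (D.wall j).normal := by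
  by_contra hne
  refine hz (Or.inr ⟨i, j, ?_, hi, hj⟩)
  rw [coneDim_inf_of_interior hi hj (notMem_frontier hz i) (notMem_frontier hz j)]
  exact finrank_perp_inf_perp (D.wall i).normal_primitive (D.wall j).normal_primitive hne

lemma exists_codimTwo_of_mem_frontier {z : MR r} {i : D.Index}
    (h : z ∈ intrinsicFrontier ℝ ((D.wall i).support : Set (MR r))) : ∃ W ∈ codimTwo r, z ∈ W := by
  obtain ⟨S, hS⟩ := (D.wall i).support_rational
  have hd := (D.wall i).support_codim
  rw [hS] at h hd
  obtain ⟨S', h1, h2⟩ := exists_span_of_mem_intrinsicFrontier h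
  have h3 := Nat.add_le_add_right (Nat.succ_le_of_lt h2) 1
  rw [hd] at h3
  exact ⟨_, ⟨h3, Or.inl ⟨S', rfl⟩⟩, h1⟩

/-- The singular locus is contained in a countable union of subspaces of codimension two. -/
lemma exists_codimTwo_of_mem_Sing {z : MR r} (hz : z ∈ D.Sing) : ∃ W ∈ codimTwo r, z ∈ W := by
  rcases hz with hz | ⟨i, j, hd, hi, hj⟩
  · obtain ⟨i, hi⟩ := Set.mem_iUnion.1 hz
    exact exists_codimTwo_of_mem_frontier hi
  · by_cases hfi : z ∈ intrinsicFrontier ℝ ((D.wall i).support : Set (MR r))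
    · exact exists_codimTwo_of_mem_frontier hfi
    by_cases hfj : z ∈ intrinsicFrontier ℝ ((D.wall j).support : Set (MR r))
    · exact exists_codimTwo_of_mem_frontier hfj
    rw [coneDim_inf_of_interior hi hj hfi hfj] at hd
    exact ⟨_, ⟨hd.le, Or.inr ⟨((D.wall i).normal, (D.wall j).normal), rfl⟩⟩,
      mem_perp.2 ((D.wall i).support_perp z hi), mem_perp.2 ((D.wall j).support_perp z hj)⟩

end ScatteringDiagram

/-! ### Path-ordered products -/

lemma StructureGroup.EqMod.list_prod {𝔰 : Seed Γ} {l : ℕ} {ι : Type*} (L : List ι)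
    {f g : ι → StructureGroup 𝔰} (h : ∀ x ∈ L, EqMod l (f x) (g x)) :
    EqMod l (L.map f).prod (L.map g).prod := by
  induction L with
  | nil => exact EqMod.refl l _
  | cons x L ih =>
    rw [List.map_cons, List.map_cons, List.prod_cons, List.prod_cons]
    exact (h x List.mem_cons_self).mul (ih fun y hy => h y (List.mem_cons_of_mem _ hy))

lemma StructureGroup.Gtail_anti {𝔰 : Seed Γ} {l l' : ℕ} (h : l ≤ l') : Gtail 𝔰 l' ⊆ Gtail 𝔰 l :=
  fun _ hg m hm => hg m (hm.trans h)

open Classical in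
/-- A product along a list sorted by time can be collected into one factor for each time. -/
lemma exists_times_prod {I G : Type*} [Monoid G] (F : ℝ × I → G) (L : List (ℝ × I))
    (hL : L.Pairwise fun x y => y.1 ≤ x.1) : ∃ ts : List ℝ, ts.Pairwise (· > ·) ∧
      (∀ t, t ∈ ts ↔ ∃ x ∈ L, x.1 = t) ∧
      (L.map F).prod = (ts.map fun t => ((L.filter fun x => x.1 = t).map F).prod).prod := by
  induction L with
  | nil => exact ⟨[], List.Pairwise.nil, by simp, by simp⟩
  | cons x L ih =>
    rw [List.pairwise_cons] at hL
    obtain ⟨ts, hs, hm, hp⟩ := ih hL.2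
    have hle : ∀ t ∈ ts, t ≤ x.1 := fun t ht => by
      obtain ⟨y, hy, rfl⟩ := (hm t).1 ht
      exact hL.1 y hy
    have hne : ∀ t, t ≠ x.1 → (x :: L).filter (fun y => y.1 = t) = L.filter fun y => y.1 = t :=
      fun t ht => List.filter_cons_of_neg (by simpa using ht.symm)
    have heq : (x :: L).filter (fun y => y.1 = x.1) = x :: L.filter fun y => y.1 = x.1 :=
      List.filter_cons_of_pos (by simp)
    by_cases hx : x.1 ∈ ts
    · obtain ⟨u, us, rfl⟩ : ∃ u us, ts = u :: us := by
        cases ts with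
        | nil => simp at hx
        | cons u us => exact ⟨u, us, rfl⟩
      have hs' := List.pairwise_cons.1 hs
      have hu : u = x.1 := by
        rcases List.mem_cons.1 hx with h | h
        · exact h.symm
        · exact absurd (hs'.1 _ h) (not_lt.2 (hle u List.mem_cons_self))
      refine ⟨u :: us, hs, fun t => ?_, ?_⟩
      · rw [hm t]
        constructor
        · rintro ⟨y, hy, rfl⟩
          exact ⟨y, List.mem_cons_of_mem _ hy, rfl⟩
        · rintro ⟨y, hy, rfl⟩
          rcases List.mem_cons.1 hy with rfl | hy
          · exact (hm _).1 hx
          · exact ⟨y, hy, rfl⟩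
      · subst hu
        rw [List.map_cons, List.prod_cons, hp, List.map_cons, List.prod_cons, List.map_cons,
          List.prod_cons, heq, List.map_cons, List.prod_cons, mul_assoc]
        congr 3
        refine List.map_congr_left fun t ht => ?_
        rw [hne t (hs'.1 t ht).ne]
    · refine ⟨x.1 :: ts, List.pairwise_cons.2 ⟨fun t ht => lt_of_le_of_ne (hle t ht) fun h =>
        hx (h ▸ ht), hs⟩, fun t => ?_, ?_⟩
      · rw [List.mem_cons, hm t]
        constructor
        · rintro (rfl | ⟨y, hy, rfl⟩)
          · exact ⟨x, List.mem_cons_self, rfl⟩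
          · exact ⟨y, List.mem_cons_of_mem _ hy, rfl⟩
        · rintro ⟨y, hy, rfl⟩
          rcases List.mem_cons.1 hy with rfl | hy
          · exact Or.inl rfl
          · exact Or.inr ⟨y, hy, rfl⟩
      · have h0 : L.filter (fun y => y.1 = x.1) = [] := by
          rw [List.filter_eq_nil_iff]
          intro y hy h
          exact hx ((hm _).2 ⟨y, hy, by simpa using h⟩)
        rw [List.map_cons, List.prod_cons, hp, List.map_cons, List.prod_cons, heq, h0]
        simp only [List.map_cons, List.map_nil, List.prod_cons, List.prod_nil, mul_one]
        congr 2
        refine List.map_congr_left fun t ht => ?_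
        rw [hne t fun h => hx (h ▸ ht)]

/-- The evaluation of the coefficient of `X_m`. -/
def LieHat.evalHom {𝔰 : Seed Γ} (m : NPlus r) : LieHat 𝔰 →+ K where
  toFun X := X m
  map_zero' := rfl
  map_add' _ _ := rfl

open Classical in
/-- The element `X` or `-X`, according to the direction `v` of a crossing. -/
def LieHat.signed {𝔰 : Seed Γ} (X : LieHat 𝔰) (v : MR r) : LieHat 𝔰 :=
  if ∃ m : NPlus r, X m ≠ 0 ∧ pairing m.1 v < 0 then X else -X

/-- All indices occurring in `X` are positive multiples of `n`, so any of them detects the sign of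
the crossing. Thus `signed` does not require a chosen normal vector, and diagrams with different
walls can be compared. -/
lemma LieHat.pairing_neg_iff {𝔰 : Seed Γ} {n : NPlus r} {X : LieHat 𝔰} (hX : X ∈ par 𝔰 n.1)
    {m : NPlus r} (hm : X m ≠ 0) (v : MR r) : pairing m.1 v < 0 ↔ pairing n.1 v < 0 := by
  obtain ⟨j, hj⟩ := hX m hm
  have hj0 : (0 : ℝ) < j := Nat.cast_pos.2 (Nat.pos_of_ne_zero fun h0 => m.2 (by
    rw [hj, h0, zero_smul]))
  rw [hj, pairing_nsmul]
  exact ⟨fun h => by by_contra hn; exact absurd (mul_nonneg hj0.le (not_lt.1 hn)) (not_le.2 h),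
    fun h => mul_neg_of_pos_of_neg hj0 h⟩

lemma LieHat.signed_of_neg {𝔰 : Seed Γ} {n : NPlus r} {X : LieHat 𝔰} (hX : X ∈ par 𝔰 n.1)
    {v : MR r} (hv : pairing n.1 v < 0) : X.signed v = X := by
  rw [signed]
  split_ifs with h
  · rfl
  · have h0 : X = 0 := by
      funext m
      by_contra hm
      exact h ⟨m, hm, (pairing_neg_iff hX hm v).2 hv⟩
    rw [h0, neg_zero]

lemma LieHat.signed_of_not_neg {𝔰 : Seed Γ} {n : NPlus r} {X : LieHat 𝔰} (hX : X ∈ par 𝔰 n.1)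
    {v : MR r} (hv : ¬ pairing n.1 v < 0) : X.signed v = -X := by
  rw [signed, if_neg]
  rintro ⟨m, hm, h⟩
  exact hv ((pairing_neg_iff hX hm v).1 h)

namespace ScatteringDiagram

open StructureGroup

variable {𝔰 : Seed Γ}

/-- The logarithm of the product of the elements of all walls through `z`. -/
def total (D : ScatteringDiagram 𝔰) (z : MR r) : LieHat 𝔰 :=
  fun m => ∑ᶠ i ∈ {i | z ∈ (D.wall i).support}, (D.wall i).elt.log m

/-- The contribution of time `t` to the path-ordered product along `γ`. -/
def step (D : ScatteringDiagram 𝔰) (γ : ℝ → MR r) (t : ℝ) : StructureGroup 𝔰 :=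
  ⟨(D.total (γ t)).signed (deriv γ t)⟩

variable {D : ScatteringDiagram 𝔰}

/-- A wall element trivial in `G^{≤l}` has zero coefficient at `m`, so any truncation level above
`deg m` computes the formally infinite sum. -/
lemma total_apply {z : MR r} {m : NPlus r} {l : ℕ} (hl : deg m.1 ≤ l) {s : Finset D.Index}
    (hs : ∀ i, i ∈ s ↔ z ∈ (D.wall i).support ∧ (D.wall i).elt ∉ Gtail 𝔰 l) :
    D.total z m = ∑ i ∈ s, (D.wall i).elt.log m := by
  refine finsum_mem_eq_sum_of_inter_support_eq _ ?_
  ext i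
  simp only [Set.mem_inter_iff, Finset.mem_coe, hs]
  constructor
  · rintro ⟨h1, h2⟩
    exact ⟨⟨h1, fun h => h2 (h m hl)⟩, h2⟩
  · rintro ⟨⟨h1, -⟩, h2⟩
    exact ⟨h1, h2⟩

lemma exists_finset (D : ScatteringDiagram 𝔰) (z : MR r) (l : ℕ) : ∃ s : Finset D.Index,
    ∀ i, i ∈ s ↔ z ∈ (D.wall i).support ∧ (D.wall i).elt ∉ Gtail 𝔰 l := by
  classical
  refine ⟨(D.finite l).toFinset.filter fun i => z ∈ (D.wall i).support, fun i => ?_⟩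
  rw [Finset.mem_filter, Set.Finite.mem_toFinset]
  exact and_comm

lemma total_mem_par {z : MR r} {n : NPlus r}
    (h : ∀ i, z ∈ (D.wall i).support → (D.wall i).normal = n) : D.total z ∈ LieHat.par 𝔰 n.1 := by
  intro m hm
  obtain ⟨s, hs⟩ := D.exists_finset z (deg m.1)
  rw [total_apply le_rfl hs] at hm
  obtain ⟨i, hi, hne⟩ := Finset.exists_ne_zero_of_sum_ne_zero hm
  have := (D.wall i).elt_mem m hne
  rwa [h i ((hs i).1 hi).1] at this

lemma total_eq_zero {z : MR r} (h : z ∉ D.Supp) : D.total z = 0 := by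
  funext m
  obtain ⟨s, hs⟩ := D.exists_finset z (deg m.1)
  rw [total_apply le_rfl hs]
  exact Finset.sum_eq_zero fun i hi => absurd (Set.mem_iUnion.2 ⟨i, ((hs i).1 hi).1⟩) h

/-- The product of the factors of all crossings at time `t`. -/
lemma eqMod_step {γ : ℝ → MR r} (hγ : D.IsAdmissible γ) {t : ℝ} (ht : t ∈ Set.Icc (0 : ℝ) 1)
    {l : ℕ} {L : List (ℝ × D.Index)} (hL : L.Nodup) (hmem : ∀ x, x ∈ L ↔ x.1 = t ∧
      γ x.1 ∈ (D.wall x.2).support ∧ (D.wall x.2).elt ∉ Gtail 𝔰 l) :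
    EqMod l (L.map (D.factor γ)).prod (D.step γ t) := by
  classical
  have hsing := hγ.avoids t ht
  have hnd : (L.map Prod.snd).Nodup := hL.map_on fun x hx y hy h =>
    Prod.ext ((((hmem x).1 hx).1).trans (((hmem y).1 hy).1).symm) h
  have hs : ∀ i, i ∈ (L.map Prod.snd).toFinset ↔
      γ t ∈ (D.wall i).support ∧ (D.wall i).elt ∉ Gtail 𝔰 l := by
    intro i
    rw [List.mem_toFinset, List.mem_map]
    constructor
    · rintro ⟨x, hx, rfl⟩
      obtain ⟨rfl, h⟩ := (hmem x).1 hx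
      exact h
    · intro h
      exact ⟨(t, i), (hmem _).2 ⟨rfl, h⟩, rfl⟩
  have hsum : ∀ m : NPlus r, deg m.1 ≤ l →
      (L.map fun x => (D.wall x.2).elt.log).sum m = D.total (γ t) m := by
    intro m hm
    rw [total_apply hm hs, List.sum_toFinset _ hnd, List.map_map]
    have := map_list_sum (LieHat.evalHom (𝔰 := 𝔰) m) (L.map fun x => (D.wall x.2).elt.log)
    rw [List.map_map] at this
    exact this
  rw [eqMod_iff]
  by_cases hsupp : γ t ∈ D.Supp
  swap
  · have hL0 : L = [] := List.eq_nil_iff_forall_not_mem.2 fun x hx => by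
      obtain ⟨h1, h2, -⟩ := (hmem x).1 hx
      rw [h1] at h2
      exact hsupp (Set.mem_iUnion.2 ⟨x.2, h2⟩)
    intro m _
    rw [hL0, List.map_nil, List.prod_nil, log_one, step, LieHat.signed, total_eq_zero hsupp]
    simp
  -- All walls through the nonsingular point `γ t` share one normal vector. Their elements lie in
  -- one abelian group with a common sign, so the product is the exponential of a sum.
  · obtain ⟨i, hi⟩ := Set.mem_iUnion.1 hsupp
    have hpar := total_mem_par fun j hj => normal_eq hsing hj hi
    set n := (D.wall i).normal
    have hnorm : ∀ x ∈ L, (D.wall x.2).normal = n := fun x hx => by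
      obtain ⟨h1, h2, -⟩ := (hmem x).1 hx
      rw [h1] at h2
      exact normal_eq hsing h2 hi
    have hLpar : ∀ x ∈ L, (D.wall x.2).elt.log ∈ LieHat.par 𝔰 n.1 := fun x hx =>
      hnorm x hx ▸ (D.wall x.2).elt_mem
    have htr := hγ.transversal t ht i hi
    by_cases hneg : pairing n.1 (deriv γ t) < 0
    · have hf : L.map (D.factor γ) = (L.map fun x => (D.wall x.2).elt.log).map StructureGroup.mk := by
        rw [List.map_map]
        refine List.map_congr_left fun x hx => ?_
        rw [factor, hnorm x hx, ((hmem x).1 hx).1, if_pos hneg]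
        rfl
      intro m hm
      rw [hf, mk_list_prod (n := n.1) _ (by
        intro X hX
        obtain ⟨x, hx, rfl⟩ := List.mem_map.1 hX
        exact hLpar x hx), step,
        LieHat.signed_of_neg hpar hneg]
      exact hsum m hm
    · have hf : L.map (D.factor γ) = (L.map fun x => -(D.wall x.2).elt.log).map StructureGroup.mk := by
        rw [List.map_map]
        refine List.map_congr_left fun x hx => ?_
        rw [factor, hnorm x hx, ((hmem x).1 hx).1, if_neg hneg]
        exact mk_inv (hLpar x hx)
      have hneg' : (L.map fun x => -(D.wall x.2).elt.log).sum =
          -(L.map fun x => (D.wall x.2).elt.log).sum := by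
        generalize L = L'
        induction L' with
        | nil => simp
        | cons x L' ih => rw [List.map_cons, List.map_cons, List.sum_cons, List.sum_cons, ih, neg_add]
      intro m hm
      rw [hf, mk_list_prod (n := n.1) _ (by
        intro X hX
        obtain ⟨x, hx, rfl⟩ := List.mem_map.1 hX
        exact (LieHat.par 𝔰 n.1).neg_mem (hLpar x hx)), step,
        LieHat.signed_of_not_neg hpar hneg, hneg']
      exact congrArg Neg.neg (hsum m hm)

/-! ### Comparing and constructing path-ordered products -/

/-- A decreasing list of times containing all times with a nontrivial contribution. -/
structure IsTimeList (D : ScatteringDiagram 𝔰) (γ : ℝ → MR r) (l : ℕ) (ts : List ℝ) : Prop where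
  sorted : ts.Pairwise (· > ·)
  mem_Icc : ∀ t ∈ ts, t ∈ Set.Icc (0 : ℝ) 1
  mem_of_notMem : ∀ t ∈ Set.Icc (0 : ℝ) 1, D.step γ t ∉ Gtail 𝔰 l → t ∈ ts

lemma IsTimeList.mono {γ : ℝ → MR r} {l l' : ℕ} (h : l ≤ l') {ts : List ℝ}
    (hts : D.IsTimeList γ l' ts) : D.IsTimeList γ l ts :=
  ⟨hts.sorted, hts.mem_Icc, fun t ht hn => hts.mem_of_notMem t ht fun h' => hn (Gtail_anti h h')⟩

open Classical in
lemma eqMod_filter_prod {l : ℕ} (f : ℝ → StructureGroup 𝔰) (ts : List ℝ) :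
    EqMod l (ts.map f).prod ((ts.filter fun t => f t ∉ Gtail 𝔰 l).map f).prod := by
  induction ts with
  | nil => exact EqMod.refl l _
  | cons t ts ih =>
    by_cases h : f t ∈ Gtail 𝔰 l
    · rw [List.filter_cons_of_neg (by simpa using h), List.map_cons, List.prod_cons]
      have := (eqMod_one_iff.2 h).mul ih
      rwa [one_mul] at this
    · rw [List.filter_cons_of_pos (by simpa using h), List.map_cons, List.prod_cons, List.map_cons,
        List.prod_cons]
      exact (EqMod.refl l _).mul ih

/-- Discarding the times with trivial contribution leaves the same strictly decreasing list from
both. -/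
lemma IsTimeList.eqMod {γ : ℝ → MR r} {l : ℕ} {ts ts' : List ℝ} (h : D.IsTimeList γ l ts)
    (h' : D.IsTimeList γ l ts') :
    EqMod l (ts.map (D.step γ)).prod (ts'.map (D.step γ)).prod := by
  classical
  have e : ts.filter (fun t => D.step γ t ∉ Gtail 𝔰 l) =
      ts'.filter fun t => D.step γ t ∉ Gtail 𝔰 l := by
    refine List.Perm.eq_of_pairwise (le := (· > ·)) (fun a b _ _ hab hba => absurd hab hba.asymm)
      (h.sorted.filter _) (h'.sorted.filter _) ?_
    refine (List.perm_ext_iff_of_nodup ((h.sorted.imp ne_of_gt).filter _)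
      ((h'.sorted.imp ne_of_gt).filter _)).2 fun t => ?_
    simp only [List.mem_filter, decide_eq_true_eq]
    exact ⟨fun ht => ⟨h'.mem_of_notMem t (h.mem_Icc t ht.1) ht.2, ht.2⟩,
      fun ht => ⟨h.mem_of_notMem t (h'.mem_Icc t ht.1) ht.2, ht.2⟩⟩
  refine (eqMod_filter_prod _ ts).trans ?_
  rw [e]
  exact (eqMod_filter_prod _ ts').symm

/-- `L` lists the crossings of nontrivial walls, later ones first. -/
structure IsCrossingList (D : ScatteringDiagram 𝔰) (γ : ℝ → MR r) (l : ℕ)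
    (L : List (ℝ × D.Index)) : Prop where
  nodup : L.Nodup
  mem_iff : ∀ x, x ∈ L ↔ x.1 ∈ Set.Icc (0 : ℝ) 1 ∧ γ x.1 ∈ (D.wall x.2).support ∧
    (D.wall x.2).elt ∉ Gtail 𝔰 l
  sorted : L.Pairwise fun x y => y.1 ≤ x.1

lemma hasPathProduct_iff {γ : ℝ → MR r} {p : StructureGroup 𝔰} : D.HasPathProduct γ p ↔
    ∀ l, ∃ L, D.IsCrossingList γ l L ∧ EqMod l p (L.map (D.factor γ)).prod :=
  forall_congr' fun _ => exists_congr fun _ =>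
    ⟨fun h => ⟨⟨h.1, h.2.1, h.2.2.1⟩, h.2.2.2⟩, fun h => ⟨h.1.1, h.1.2, h.1.3, h.2⟩⟩

/-- Grouping simultaneous crossings replaces the walls by the times at which they are met, a
description that does not mention the indices of the diagram. -/
lemma IsCrossingList.exists_times {γ : ℝ → MR r} (hγ : D.IsAdmissible γ) {l : ℕ}
    {L : List (ℝ × D.Index)} (hL : D.IsCrossingList γ l L) : ∃ ts, D.IsTimeList γ l ts ∧
      EqMod l (L.map (D.factor γ)).prod (ts.map (D.step γ)).prod := by
  classical
  obtain ⟨ts, hs, hm, hp⟩ := exists_times_prod (D.factor γ) L hL.sorted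
  have hblock : ∀ t ∈ Set.Icc (0 : ℝ) 1,
      EqMod l ((L.filter fun x => x.1 = t).map (D.factor γ)).prod (D.step γ t) := fun t ht => by
    refine eqMod_step hγ ht (hL.nodup.filter _) fun x => ?_
    rw [List.mem_filter, hL.mem_iff, decide_eq_true_eq]
    constructor
    · rintro ⟨⟨-, h⟩, h1⟩
      exact ⟨h1, h⟩
    · rintro ⟨h1, h⟩
      exact ⟨⟨h1 ▸ ht, h⟩, h1⟩
  have hIcc : ∀ t ∈ ts, t ∈ Set.Icc (0 : ℝ) 1 := fun t ht => by
    obtain ⟨x, hx, rfl⟩ := (hm t).1 ht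
    exact ((hL.mem_iff x).1 hx).1
  refine ⟨ts, ⟨hs, hIcc, fun t ht hn => ?_⟩, ?_⟩
  · by_contra hts
    have h0 : L.filter (fun x => x.1 = t) = [] := by
      rw [List.filter_eq_nil_iff]
      intro x hx h
      exact hts ((hm t).2 ⟨x, hx, by simpa using h⟩)
    have h1 := hblock t ht
    rw [h0, List.map_nil, List.prod_nil] at h1
    exact hn (eqMod_one_iff.1 h1.symm)
  · rw [hp]
    exact EqMod.list_prod ts fun t ht => hblock t (hIcc t ht)

/-- Crossings are interior times, where smoothness on `[0,1]` gives a two-sided derivative and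
`deriv γ` is the actual velocity. -/
lemma IsAdmissible.mem_Ioo {γ : ℝ → MR r} (hγ : D.IsAdmissible γ) {t : ℝ}
    (ht : t ∈ Set.Icc (0 : ℝ) 1) {i : D.Index} (hi : γ t ∈ (D.wall i).support) :
    t ∈ Set.Ioo (0 : ℝ) 1 := by
  refine ⟨lt_of_le_of_ne ht.1 ?_, lt_of_le_of_ne ht.2 ?_⟩
  · rintro rfl
    exact hγ.source (Set.mem_iUnion.2 ⟨i, hi⟩)
  · rintro rfl
    exact hγ.target (Set.mem_iUnion.2 ⟨i, hi⟩)

/-- An admissible curve crosses a wall finitely many times. -/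
lemma IsAdmissible.finite_crossings {γ : ℝ → MR r} (hγ : D.IsAdmissible γ) (i : D.Index) :
    {t | t ∈ Set.Icc (0 : ℝ) 1 ∧ γ t ∈ (D.wall i).support}.Finite := by
  by_contra hinf
  set A := {t | t ∈ Set.Icc (0 : ℝ) 1 ∧ γ t ∈ (D.wall i).support}
  have hclosed : IsClosed A :=
    hγ.smooth.continuousOn.preimage_isClosed_of_isClosed isClosed_Icc
      (D.wall i).support_rational.isClosed
  have hcomp : IsCompact A := isCompact_Icc.of_isClosed_subset hclosed fun t ht => ht.1
  obtain ⟨t, htA, hacc⟩ := Set.Infinite.exists_accPt_of_subset_isCompact hinf hcomp subset_rfl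
  obtain ⟨ht, hi⟩ := htA
  have hIoo := hγ.mem_Ioo ht hi
  have hd : DifferentiableAt ℝ γ t :=
    (hγ.smooth.contDiffAt (Icc_mem_nhds hIoo.1 hIoo.2)).differentiableAt (by simp)
  have hder : HasDerivAt (fun s => pairingL (D.wall i).normal.1 (γ s))
      (pairingL (D.wall i).normal.1 (deriv γ t)) t :=
    (LinearMap.toContinuousLinearMap (pairingL (D.wall i).normal.1)).hasFDerivAt.comp_hasDerivAt t
      hd.hasDerivAt
  -- At an accumulation point of crossing times, `⟨n, γ⟩` would vanish arbitrarily close by, against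
  -- its nonzero derivative.
  have hev := hder.eventually_ne (c := 0) (hγ.transversal t ht i hi)
  rw [accPt_iff_frequently_nhdsNE] at hacc
  obtain ⟨s, hs1, hs2⟩ := (hacc.and_eventually hev).exists
  exact hs2 ((D.wall i).support_perp _ hs1.2)

lemma IsAdmissible.exists_crossingList {γ : ℝ → MR r} (hγ : D.IsAdmissible γ) (l : ℕ) :
    ∃ L, D.IsCrossingList γ l L := by
  classical
  have hfin : {x : ℝ × D.Index | x.1 ∈ Set.Icc (0 : ℝ) 1 ∧ γ x.1 ∈ (D.wall x.2).support ∧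
      (D.wall x.2).elt ∉ Gtail 𝔰 l}.Finite := by
    refine Set.Finite.subset ((D.finite l).biUnion fun i _ =>
      (hγ.finite_crossings i).image fun t => (t, i)) ?_
    rintro ⟨t, i⟩ ⟨h1, h2, h3⟩
    exact Set.mem_biUnion h3 ⟨t, ⟨h1, h2⟩, rfl⟩
  let R : ℝ × D.Index → ℝ × D.Index → Prop := fun x y => y.1 ≤ x.1
  have : Std.Total R := ⟨fun x y => le_total y.1 x.1⟩
  have : IsTrans (ℝ × D.Index) R := ⟨fun x y z h1 h2 => le_trans h2 h1⟩
  have hperm := List.perm_insertionSort R hfin.toFinset.toList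
  refine ⟨hfin.toFinset.toList.insertionSort R, ⟨hperm.nodup_iff.2 (Finset.nodup_toList _),
    fun x => ?_, List.pairwise_insertionSort R _⟩⟩
  rw [hperm.mem_iff, Finset.mem_toList, Set.Finite.mem_toFinset]
  rfl

/-- Path-ordered products exist. -/
lemma IsAdmissible.exists_hasPathProduct {γ : ℝ → MR r} (hγ : D.IsAdmissible γ) :
    ∃ p, D.HasPathProduct γ p := by
  choose L hL using hγ.exists_crossingList
  choose ts hts hE using fun l => (hL l).exists_times hγ
  have key : ∀ l l', l ≤ l' → EqMod l ((L l').map (D.factor γ)).prod ((L l).map (D.factor γ)).prod :=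
    fun l l' h => (((hE l').mono h).trans (((hts l').mono h).eqMod (hts l))).trans (hE l).symm
  -- The coefficient at `m` is read off from the truncation at level `deg m`; compatibility of the
  -- truncations gives all other levels.
  refine ⟨⟨fun m => ((L (deg m.1)).map (D.factor γ)).prod.log m⟩,
    hasPathProduct_iff.2 fun l => ⟨L l, hL l, eqMod_iff.2 fun m hm => ?_⟩⟩
  exact (eqMod_iff.1 (key _ _ hm) m le_rfl).symm

/-- The path-ordered product depends only on the products of the elements of all walls through the
points of the curve. -/
lemma HasPathProduct.of_total_eq {D' : ScatteringDiagram 𝔰} {γ : ℝ → MR r}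
    (hγ : D.IsAdmissible γ) (hγ' : D'.IsAdmissible γ)
    (h : ∀ t ∈ Set.Icc (0 : ℝ) 1, D'.total (γ t) = D.total (γ t)) {p : StructureGroup 𝔰}
    (hp : D.HasPathProduct γ p) : D'.HasPathProduct γ p := by
  rw [hasPathProduct_iff] at hp ⊢
  intro l
  obtain ⟨L, hL, hE⟩ := hp l
  obtain ⟨ts, hts, hE1⟩ := hL.exists_times hγ
  obtain ⟨L', hL'⟩ := hγ'.exists_crossingList l
  obtain ⟨ts', hts', hE2⟩ := hL'.exists_times hγ'
  have hstep : ∀ t ∈ Set.Icc (0 : ℝ) 1, D'.step γ t = D.step γ t := fun t ht => by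
    rw [step, step, h t ht]
  have hts'' : D.IsTimeList γ l ts' :=
    ⟨hts'.sorted, hts'.mem_Icc, fun t ht hn => hts'.mem_of_notMem t ht (by rwa [hstep t ht])⟩
  have e : ts'.map (D'.step γ) = ts'.map (D.step γ) :=
    List.map_congr_left fun t ht => hstep t (hts'.mem_Icc t ht)
  rw [e] at hE2
  exact ⟨L', hL', ((hE.trans hE1).trans (hts.eqMod hts'')).trans hE2.symm⟩

end ScatteringDiagram

/-! ### Generic points and loops -/

-- A `C¹` image of a space of dimension below `r` has Hausdorff dimension below `r`, and
-- `r`-dimensional Hausdorff measure is Lebesgue measure.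
open MeasureTheory in
lemma ae_notMem_range {E : Type*} [NormedAddCommGroup E] [NormedSpace ℝ E] [FiniteDimensional ℝ E]
    (hE : Module.finrank ℝ E < r) {f : E → MR r} (hf : ContDiff ℝ 1 f) :
    ∀ᵐ v : MR r, v ∉ Set.range f := by
  have h1 : dimH (Set.range f) < ((r : NNReal) : ENNReal) :=
    lt_of_le_of_lt hf.dimH_range_le (by simpa using hE)
  have h2 := hausdorffMeasure_of_dimH_lt h1
  have h3 : (Measure.hausdorffMeasure ((r : NNReal) : ℝ) : Measure (MR r)) = volume := by
    simpa using hausdorffMeasure_pi_real (ι := Fin r)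
  rw [h3] at h2
  exact measure_eq_zero_iff_ae_notMem.1 h2

lemma exists_pairing_eq (n : NPlus r) (c : ℝ) : ∃ z, pairing n.1 z = c :=
  LinearMap.surjective (pairingL_ne_zero n) c

open MeasureTheory in
lemma ae_pairing_ne (n : NPlus r) (c : ℝ) : ∀ᵐ v : MR r, pairing n.1 v ≠ c := by
  obtain ⟨z, hz⟩ := exists_pairing_eq n c
  have h := ae_notMem_range (r := r) (E := perp n.1) (f := fun x => z + (x : MR r))
    (by have := finrank_perp n; omega)
    (contDiff_const.add (perp n.1).subtypeL.contDiff)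
  filter_upwards [h] with v hv hc
  refine hv ⟨⟨v - z, ?_⟩, by simp⟩
  rw [mem_perp, ← pairingL_apply, map_sub, pairingL_apply, pairingL_apply, hc, hz, sub_self]

/-- Each of the countably many subspaces has dimension at most `r - 2`, hence so does the union of
their traces on `n^⊥`, while `n^⊥` has dimension `r - 1`. -/
lemma dense_perp_compl (n : NPlus r) : Dense {x : perp n.1 | ∀ W ∈ codimTwo r, (x : MR r) ∉ W} := by
  have hr := finrank_perp n
  rcases (codimTwo r).eq_empty_or_nonempty with h0 | ⟨W₀, hW₀⟩
  · simp [h0]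
  -- A member of the family forces `r ≥ 2`, which is needed because `r - 2` below is a subtraction
  -- of natural numbers.
  have h2 := hW₀.1
  have h : dimH (⋃ W ∈ codimTwo r, {x : perp n.1 | (x : MR r) ∈ W}) <
      Module.finrank ℝ (perp n.1) := by
    rw [dimH_bUnion (countable_codimTwo r)]
    refine lt_of_le_of_lt (b := ((r - 2 : ℕ) : ENNReal)) (iSup₂_le fun W hW => ?_)
      (by exact_mod_cast (show r - 2 < Module.finrank ℝ (perp n.1) by omega))
    have hc : ContDiff ℝ 1 fun x : W => (x : MR r) := W.subtypeL.contDiff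
    rw [← isometry_subtype_coe.dimH_image]
    refine (dimH_mono (t := Set.range fun x : W => (x : MR r)) ?_).trans
      (hc.dimH_range_le.trans ?_)
    · rintro _ ⟨x, hx, rfl⟩
      exact ⟨⟨x, hx⟩, rfl⟩
    · have h4 := hW.1
      exact_mod_cast (show _ ≤ r - 2 by omega)
  refine (dense_compl_of_dimH_lt_finrank h).mono fun x hx W hW hxW => ?_
  exact hx (Set.mem_biUnion hW hxW)

/-! ### Generic ellipses -/

/-- An ellipse through `z` and `z₀`. -/
def ellipse (z z₀ v : MR r) (t : ℝ) : MR r :=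
  (2⁻¹ : ℝ) • (z + z₀) - Real.sin (2 * Real.pi * t) • (2⁻¹ : ℝ) • (z - z₀) +
    Real.cos (2 * Real.pi * t) • v

lemma contDiff_ellipse (z z₀ v : MR r) : ContDiff ℝ ∞ (ellipse z z₀ v) := by
  unfold ellipse
  fun_prop

lemma pairing_ellipse (n : Expo r) (z z₀ v : MR r) (t : ℝ) : pairing n (ellipse z z₀ v t) =
    (pairing n z + pairing n z₀) / 2 - Real.sin (2 * Real.pi * t) *
      ((pairing n z - pairing n z₀) / 2) + Real.cos (2 * Real.pi * t) * pairing n v := by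
  simp only [ellipse, ← pairingL_apply, map_add, map_sub, map_smul, smul_eq_mul]
  ring

lemma pairing_deriv_ellipse (n : Expo r) (z z₀ v : MR r) (t : ℝ) :
    pairing n (deriv (ellipse z z₀ v) t) = -(2 * Real.pi) * (Real.cos (2 * Real.pi * t) *
      ((pairing n z - pairing n z₀) / 2) + Real.sin (2 * Real.pi * t) * pairing n v) := by
  have hd : HasDerivAt (ellipse z z₀ v) (deriv (ellipse z z₀ v) t) t :=
    ((contDiff_ellipse z z₀ v).differentiable (by simp) t).hasDerivAt
  have h1 : HasDerivAt (fun s => pairing n (ellipse z z₀ v s))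
      (pairing n (deriv (ellipse z z₀ v) t)) t :=
    (LinearMap.toContinuousLinearMap (pairingL n)).hasFDerivAt.comp_hasDerivAt t hd
  simp only [pairing_ellipse] at h1
  have hl : HasDerivAt (fun s : ℝ => 2 * Real.pi * s) (2 * Real.pi) t := by
    simpa using (hasDerivAt_id t).const_mul (2 * Real.pi)
  have h2 := ((hl.sin.mul_const ((pairing n z - pairing n z₀) / 2)).const_sub
    ((pairing n z + pairing n z₀) / 2)).add (hl.cos.mul_const (pairing n v))
  rw [h1.unique h2]
  ring

lemma cos_eq_zero_iff_of_mem_Icc {t : ℝ} (ht : t ∈ Set.Icc (0 : ℝ) 1) :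
    Real.cos (2 * Real.pi * t) = 0 ↔ t = 1 / 4 ∨ t = 3 / 4 := by
  constructor
  · intro h
    obtain ⟨k, hk⟩ := Real.cos_eq_zero_iff.1 h
    have h1 : 4 * t = 2 * k + 1 := by
      have := Real.pi_pos
      have h2 : Real.pi * (4 * t) = Real.pi * (2 * k + 1) := by linarith
      exact mul_left_cancel₀ this.ne' h2
    have h2 : (-1 : ℝ) < k := by linarith [ht.1]
    have h3 : (k : ℝ) < 2 := by linarith [ht.2]
    have h2' : -1 < k := by exact_mod_cast h2
    have h3' : k < 2 := by exact_mod_cast h3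
    obtain rfl | rfl : k = 0 ∨ k = 1 := by omega
    · left; push_cast at h1; linarith
    · right; push_cast at h1; linarith
  · rintro (rfl | rfl)
    · rw [show 2 * Real.pi * (1 / 4) = Real.pi / 2 by ring, Real.cos_pi_div_two]
    · rw [show 2 * Real.pi * (3 / 4) = Real.pi / 2 + Real.pi by ring, Real.cos_add_pi,
        Real.cos_pi_div_two, neg_zero]

lemma ellipse_quarter (z z₀ v : MR r) : ellipse z z₀ v (1 / 4) = z₀ := by
  rw [ellipse, show 2 * Real.pi * (1 / 4) = Real.pi / 2 by ring, Real.cos_pi_div_two,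
    Real.sin_pi_div_two]
  module

lemma ellipse_three_quarters (z z₀ v : MR r) : ellipse z z₀ v (3 / 4) = z := by
  rw [ellipse, show 2 * Real.pi * (3 / 4) = Real.pi / 2 + Real.pi by ring, Real.cos_add_pi,
    Real.sin_add_pi, Real.cos_pi_div_two, Real.sin_pi_div_two]
  module

open MeasureTheory in
/-- A generic ellipse avoids a subspace of codimension two outside of its two base points. -/
lemma ae_ellipse_notMem {W : Submodule ℝ (MR r)} (hW : Module.finrank ℝ W + 2 ≤ r) (z z₀ : MR r) :
    ∀ᵐ v : MR r, ∀ t, Real.cos (2 * Real.pi * t) ≠ 0 → ellipse z z₀ v t ∉ W := by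
  -- Solve `ellipse z z₀ v t = w ∈ W` for `v`, with parameters `w` and `x = sin/cos`; then `1/cos =
  -- ε √(1 + x²)` with a sign `ε`. The exceptional `v` form the image of a space of dimension `dim W
  -- + 1 < r`.
  have key : ∀ ε : ℝ, ∀ᵐ v : MR r, v ∉ Set.range fun x : W × ℝ => (x.1 : MR r) -
      (ε * √(1 + x.2 ^ 2)) • (2⁻¹ : ℝ) • (z + z₀) + x.2 • (2⁻¹ : ℝ) • (z - z₀) := fun ε => by
    refine ae_notMem_range (by rw [Module.finrank_prod, Module.finrank_self]; omega) ?_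
    have h1 : ContDiff ℝ 1 fun x : W × ℝ => (x.1 : MR r) := W.subtypeL.contDiff.comp contDiff_fst
    have h2 : ContDiff ℝ 1 fun x : W × ℝ => √(1 + x.2 ^ 2) :=
      ContDiff.sqrt (by fun_prop) fun x => by positivity
    fun_prop
  filter_upwards [key 1, key (-1)] with v h1 h2 t hc ht
  set c := Real.cos (2 * Real.pi * t) with hcdef
  set s := Real.sin (2 * Real.pi * t) with hsdef
  have hcs : c ^ 2 + s ^ 2 = 1 := Real.cos_sq_add_sin_sq _
  have hsq : √(1 + (s / c) ^ 2) = |c⁻¹| := by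
    rw [← Real.sqrt_sq_eq_abs]
    congr 1
    field_simp
    exact hcs
  have hv : ∀ ε : ℝ, ε * √(1 + (s / c) ^ 2) = c⁻¹ → v = c⁻¹ • ellipse z z₀ v t -
      (ε * √(1 + (s / c) ^ 2)) • (2⁻¹ : ℝ) • (z + z₀) + (s / c) • (2⁻¹ : ℝ) • (z - z₀) := by
    intro ε hε
    rw [hε, ellipse, ← hcdef, ← hsdef, smul_add, smul_sub, smul_smul c⁻¹ c, inv_mul_cancel₀ hc,
      smul_smul c⁻¹ s, div_eq_inv_mul]
    module
  have hmem : c⁻¹ • ellipse z z₀ v t ∈ W := W.smul_mem _ ht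
  rcases abs_choice c⁻¹ with h | h
  · exact h1 ⟨(⟨_, hmem⟩, s / c), (hv 1 (by rw [hsq, h, one_mul])).symm⟩
  · exact h2 ⟨(⟨_, hmem⟩, s / c), (hv (-1) (by rw [hsq, h, neg_one_mul, neg_neg])).symm⟩

namespace ScatteringDiagram

variable {𝔰 : Seed Γ} {D : ScatteringDiagram 𝔰}

open MeasureTheory in
/-- Any two nonsingular points of a hyperplane lie on an admissible loop that crosses the hyperplane
only there. -/
lemma exists_loop {n : NPlus r} {z z₀ : MR r} (hz : z ∈ perp n.1) (hz₀ : z₀ ∈ perp n.1)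
    (hzs : z ∉ D.Sing) (hzs₀ : z₀ ∉ D.Sing) : ∃ γ : ℝ → MR r, D.IsAdmissible γ ∧ γ 0 = γ 1 ∧
      γ (1 / 4) = z₀ ∧ γ (3 / 4) = z ∧
      ∀ t ∈ Set.Icc (0 : ℝ) 1, γ t ∈ perp n.1 → t = 1 / 4 ∨ t = 3 / 4 := by
  -- Equality is the condition for the ellipse to be tangent to `m^⊥`. For `m = n` it excludes `⟨n,
  -- v⟩ = 0`.
  have h1 : ∀ᵐ v : MR r, ∀ m : NPlus r, pairing m.1 v ^ 2 ≠ pairing m.1 z * pairing m.1 z₀ := by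
    rw [ae_all_iff]
    intro m
    filter_upwards [ae_pairing_ne m (√(pairing m.1 z * pairing m.1 z₀)),
      ae_pairing_ne m (-√(pairing m.1 z * pairing m.1 z₀))] with v hv hv' h
    rw [← h, Real.sqrt_sq_eq_abs] at hv hv'
    rcases abs_choice (pairing m.1 v) with e | e
    · exact hv e.symm
    · exact hv' (by rw [e, neg_neg])
  -- Keeps the base point `(z + z₀)/2 + v` of the loop off all hyperplanes.
  have h2 : ∀ᵐ v : MR r, ∀ m : NPlus r,
      pairing m.1 v ≠ -((pairing m.1 z + pairing m.1 z₀) / 2) :=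
    ae_all_iff.2 fun m => ae_pairing_ne m _
  have h3 : ∀ᵐ v : MR r, ∀ W ∈ codimTwo r, ∀ t, Real.cos (2 * Real.pi * t) ≠ 0 →
      ellipse z z₀ v t ∉ W :=
    (ae_ball_iff (countable_codimTwo r)).2 fun W hW => ae_ellipse_notMem hW.1 z z₀
  obtain ⟨v, hv1, hv2, hv3⟩ := (h1.and (h2.and h3)).exists
  have hends : ∀ t, Real.sin (2 * Real.pi * t) = 0 → Real.cos (2 * Real.pi * t) = 1 →
      ellipse z z₀ v t ∉ D.Supp := by
    intro t hs hc h
    obtain ⟨i, hi⟩ := Set.mem_iUnion.1 h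
    have := (D.wall i).support_perp _ hi
    rw [pairing_ellipse, hs, hc] at this
    exact hv2 (D.wall i).normal (by linarith)
  refine ⟨ellipse z z₀ v, ⟨(contDiff_ellipse z z₀ v).contDiffOn, hends 0 (by simp) (by simp),
    hends 1 (by simp) (by simp), ?_, ?_⟩, ?_, ellipse_quarter z z₀ v,
    ellipse_three_quarters z z₀ v, ?_⟩
  · intro t _ i hi hd
    have e1 := (D.wall i).support_perp _ hi
    rw [pairing_ellipse] at e1
    rw [pairing_deriv_ellipse, mul_eq_zero] at hd
    have e2 := hd.resolve_left (by have := Real.pi_pos; linarith)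
    have hcs := Real.cos_sq_add_sin_sq (2 * Real.pi * t)
    set c := Real.cos (2 * Real.pi * t)
    set s := Real.sin (2 * Real.pi * t)
    refine hv1 (D.wall i).normal ?_
    set V := pairing (D.wall i).normal.1 v
    set p := pairing (D.wall i).normal.1 z
    set q := pairing (D.wall i).normal.1 z₀
    -- If value and derivative both vanish, rotation invariance of the sum of squares gives `((p +
    -- q)/2)² = ((p - q)/2)² + V²`, that is, `V² = p q`.
    have e3 : (s * ((p - q) / 2) - c * V) ^ 2 + (c * ((p - q) / 2) + s * V) ^ 2 =
        (c ^ 2 + s ^ 2) * (((p - q) / 2) ^ 2 + V ^ 2) := by ring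
    rw [e2, hcs, show s * ((p - q) / 2) - c * V = (p + q) / 2 by linarith] at e3
    linarith
  · intro t ht h
    by_cases hc : Real.cos (2 * Real.pi * t) = 0
    · rcases (cos_eq_zero_iff_of_mem_Icc ht).1 hc with rfl | rfl
      · rw [ellipse_quarter] at h
        exact hzs₀ h
      · rw [ellipse_three_quarters] at h
        exact hzs h
    · obtain ⟨W, hW, hWt⟩ := exists_codimTwo_of_mem_Sing h
      exact hv3 W hW t hc hWt
  · simp [ellipse]
  · intro t ht h
    rw [mem_perp, pairing_ellipse, mem_perp.1 hz, mem_perp.1 hz₀] at h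
    refine (cos_eq_zero_iff_of_mem_Icc ht).1 ?_
    have h0 : Real.cos (2 * Real.pi * t) * pairing n.1 v = 0 := by linarith
    -- As `z` and `z₀` lie in `n^⊥`, the pairing with `n` along the ellipse is `cos · ⟨n, v⟩`, so
    -- only the two zeros of the cosine remain.
    refine (mul_eq_zero.1 h0).resolve_right fun hV => hv1 n ?_
    rw [hV, mem_perp.1 hz]
    ring

end ScatteringDiagram

/-! ### Integrality of the wall elements -/

lemma Seed.vec_single (𝔰 : Seed Γ) (i : Fin r) : 𝔰.vec (Finsupp.single i 1) = 𝔰.e i := by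
  rw [Seed.vec, Finset.sum_eq_single i]
  · simp
  · intro j _ hj
    simp [Finsupp.single_eq_of_ne hj]
  · simp

lemma Seed.pstar_mem_perp (𝔰 : Seed Γ) (n : Expo r) : 𝔰.pstar n ∈ perp n := by
  have h0 : 𝔰.form n n = 0 := by
    have := Γ.form_skew (𝔰.vec n) (𝔰.vec n)
    rw [Seed.form]
    linarith
  have h1 : 𝔰.form n n = ∑ i, (n i : ℚ) * 𝔰.form (Finsupp.single i 1) n := by
    have hv : Γ.form (𝔰.vec n) = ∑ i, n i • Γ.form (𝔰.e i) := by
      simp only [Seed.vec, map_sum, map_nsmul]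
    rw [Seed.form, hv, AddMonoidHom.finsetSum_apply]
    refine Finset.sum_congr rfl fun i _ => ?_
    rw [Seed.form, 𝔰.vec_single, AddMonoidHom.nsmul_apply, nsmul_eq_mul]
  rw [mem_perp, pairing]
  simp only [Seed.pstar]
  exact_mod_cast h1.symm.trans h0

lemma NPlus.e_injective : Function.Injective (NPlus.e : Fin r → NPlus r) := fun _ _ h =>
  (Finsupp.single_left_inj one_ne_zero).1 (congrArg Subtype.val h)

/-- This places the prescribed incoming elements `Ψ_{1/δ_i}[e_i]` among the `Ψ_{1/δ(n),b}[n]`. -/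
lemma FixedData.normFactor_single (Γ : FixedData r N) (i : Fin r) :
    Γ.normFactor (Finsupp.single i 1) = Γ.δ i := by
  have h : Γ.content (Finsupp.single i 1) = Γ.cofactor i := by
    refine Nat.dvd_antisymm ?_ ?_
    · have := Γ.content_dvd (Finsupp.single i 1) i
      rw [Finsupp.single_eq_same, Nat.cast_one, one_mul] at this
      exact_mod_cast this
    · have : (Γ.cofactor i : ℤ) ∣ Γ.content (Finsupp.single i 1) := by
        rw [Γ.content_cast]
        refine Finset.dvd_gcd fun j _ => ?_
        by_cases hj : j = i
        · subst hj
          simp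
        · rw [Finsupp.single_eq_of_ne hj]
          simp
      exact_mod_cast this
  have h1 : (Γ.cofactor i : ℚ) ≠ 0 := Nat.cast_ne_zero.2 (Γ.cofactor_pos i).ne'
  rw [FixedData.normFactor, h, div_eq_iff h1]
  exact_mod_cast (Γ.δ_mul_cofactor i).symm

lemma StructureGroup.dilogLog_e (𝔰 : Seed Γ) (i : Fin r) :
    dilogLog 𝔰 (NPlus.e i) 0 = (dilog 𝔰 (1 / Γ.δ i) 0 (NPlus.e i)).log := by
  rw [dilogLog, show (NPlus.e i).1 = Finsupp.single i 1 from rfl, Γ.normFactor_single, Int.cast_zero,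
    zero_div]

lemma OneUnit.defect_mem_par {𝔰 : Seed Γ} {n : Expo r} {X : LieHat 𝔰} (hX : X ∈ LieHat.par 𝔰 n)
    (φ : Fin r → ℤ) : (defect φ (StructureGroup.toUnit 𝔰 ⟨X⟩)).1 ∈ QTorus.par 𝔰 n := by
  have hf := LieHat.emb_mem_par hX
  have := defect_exp hf (LieHat.emb_coeff_zero X) φ
  refine this ▸ QTorus.exp_mem_par ((QTorus.par 𝔰 n).sub_mem hf (QTorus.tau_mem_par hf _))

namespace ScatteringDiagram

open StructureGroup

variable {𝔰 : Seed Γ} {D : ScatteringDiagram 𝔰}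

lemma isIntegral_neg {n : NPlus r} {X : LieHat 𝔰} (hX : X ∈ LieHat.par 𝔰 n.1) {l : ℕ} :
    OneUnit.IsIntegral l (toUnit 𝔰 ⟨-X⟩) ↔ OneUnit.IsIntegral l (toUnit 𝔰 ⟨X⟩) := by
  rw [← mk_inv hX, map_inv, OneUnit.isIntegral_inv_iff]

lemma isIntegral_signed {n : NPlus r} {X : LieHat 𝔰} (hX : X ∈ LieHat.par 𝔰 n.1) {l : ℕ}
    (v : MR r) : OneUnit.IsIntegral l (toUnit 𝔰 ⟨X.signed v⟩) ↔
      OneUnit.IsIntegral l (toUnit 𝔰 ⟨X⟩) := by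
  by_cases hv : pairing n.1 v < 0
  · rw [LieHat.signed_of_neg hX hv]
  · rw [LieHat.signed_of_not_neg hX hv, isIntegral_neg hX]

lemma signed_mem_par {n : NPlus r} {X : LieHat 𝔰} (hX : X ∈ LieHat.par 𝔰 n.1) (v : MR r) :
    X.signed v ∈ LieHat.par 𝔰 n.1 := by
  by_cases hv : pairing n.1 v < 0
  · rwa [LieHat.signed_of_neg hX hv]
  · rw [LieHat.signed_of_not_neg hX hv]
    exact (LieHat.par 𝔰 n.1).neg_mem hX

lemma isIntegral_mk_zero (l : ℕ) : OneUnit.IsIntegral l (toUnit 𝔰 ⟨0⟩) := by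
  rw [mk_zero, map_one]
  exact OneUnit.isIntegral_one l

/-- Near the direction `p^*(n)`, only incoming walls matter. -/
lemma exists_isIntegral_total (hD : D.IsQCSD) {n : NPlus r} (hn : IsPrimitive n) (l : ℕ) :
    ∃ z ∈ perp n.1, z ∉ D.Sing ∧ OneUnit.IsIntegral l (toUnit 𝔰 ⟨D.total z⟩) := by
  obtain ⟨-, ι, hι, hinc, hwall⟩ := hD
  -- The non-incoming walls in `n^⊥` that are visible in `G^{≤l}`: finitely many closed cones, none
  -- containing `p^*(n)`, so a neighbourhood `O` of `p^*(n)` avoids them all.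
  set J := {j | (D.wall j).elt ∉ Gtail 𝔰 l} ∩ {j | (D.wall j).normal = n ∧
    ¬ (D.wall j).IsIncoming}
  have hJ : J.Finite := (D.finite l).inter_of_left _
  set O : Set (MR r) := ⋂ j ∈ J, ((D.wall j).support : Set (MR r))ᶜ
  have hO : IsOpen O := hJ.isOpen_biInter fun j _ =>
    (D.wall j).support_rational.isClosed.isOpen_compl
  have hpO : 𝔰.pstar n.1 ∈ O := by
    refine Set.mem_iInter₂.2 fun j hj hmem => hj.2.2 ?_
    rw [Wall.IsIncoming, hj.2.1]
    exact hmem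
  -- Perturbing `p^*(n)` within `n^⊥` leaves the singular locus and all other hyperplanes `m^⊥`.
  obtain ⟨⟨z, hz⟩, hzO, hzW⟩ := (dense_perp_compl n).inter_open_nonempty
    (Subtype.val ⁻¹' O) (hO.preimage continuous_subtype_val) ⟨⟨_, 𝔰.pstar_mem_perp n.1⟩, hpO⟩
  have hzs : z ∉ D.Sing := fun h => by
    obtain ⟨W, hW, hzW'⟩ := exists_codimTwo_of_mem_Sing h
    exact hzW W hW hzW'
  have hnormal : ∀ j, z ∈ (D.wall j).support → (D.wall j).normal = n := by
    intro j hj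
    by_contra hne
    have hd := finrank_perp_inf_perp (D.wall j).normal_primitive hn hne
    exact hzW _ ⟨hd.le, Or.inr ⟨((D.wall j).normal, n), rfl⟩⟩
      ⟨mem_perp.2 ((D.wall j).support_perp z hj), hz⟩
  refine ⟨z, hz, hzs, ?_⟩
  have hex : ∀ j, z ∈ (D.wall j).support → (D.wall j).elt ∉ Gtail 𝔰 l →
      ∃ i, ι i = j ∧ NPlus.e i = n := by
    intro j hj hl
    have hin : (D.wall j).IsIncoming := by
      by_contra hin
      exact Set.mem_iInter₂.1 hzO j ⟨hl, hnormal j hj, hin⟩ hj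
    obtain ⟨i, rfl⟩ := (hinc j).1 hin
    exact ⟨i, rfl, by rw [← (hwall i).1, hnormal _ hj]⟩
  obtain ⟨s, hs⟩ := D.exists_finset z l
  -- At most one visible wall is left: an incoming wall with normal `n = e_i`, which occurs once.
  rcases s.eq_empty_or_nonempty with rfl | ⟨j, hj⟩
  · refine (isIntegral_mk_zero l).congr (agree_iff.2 fun m hm => ?_)
    change (0 : LieHat 𝔰) m = D.total z m
    rw [total_apply hm hs, Finset.sum_empty, LieHat.zero_apply]
  · obtain ⟨i, rfl, hi⟩ := hex j ((hs j).1 hj).1 ((hs j).1 hj).2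
    have hs1 : s = {ι i} := Finset.eq_singleton_iff_unique_mem.2 ⟨hj, fun k hk => by
      obtain ⟨i', rfl, hi'⟩ := hex k ((hs k).1 hk).1 ((hs k).1 hk).2
      rw [NPlus.e_injective (hi'.trans hi.symm)]⟩
    refine (isIntegral_dilogLog (𝔰 := 𝔰) (NPlus.e i) 0 l).congr (agree_iff.2 fun m hm => ?_)
    change dilogLog 𝔰 (NPlus.e i) 0 m = D.total z m
    rw [total_apply hm hs, hs1, Finset.sum_singleton, dilogLog_e, (hwall i).2.2]

/-- The first coefficient that could fail to be integral at one crossing is the sum of those at the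
other crossings of the loop. -/
lemma isIntegral_step {γ : ℝ → MR r} (hγ : D.IsAdmissible γ) (hp : D.HasPathProduct γ 1) {l : ℕ}
    (hl : ∀ z, z ∉ D.Sing → OneUnit.IsIntegral l (toUnit 𝔰 ⟨D.total z⟩)) {n : NPlus r}
    (hn : IsPrimitive n) {t₀ t₁ : ℝ} (ht₁ : t₁ ∈ Set.Icc (0 : ℝ) 1)
    (ht : ∀ t ∈ Set.Icc (0 : ℝ) 1, γ t ∈ perp n.1 → t = t₀ ∨ t = t₁)
    (h0 : OneUnit.IsIntegral (l + 1) (toUnit 𝔰 (D.step γ t₀)))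
    (h1 : (D.step γ t₁).log ∈ LieHat.par 𝔰 n.1) :
    OneUnit.IsIntegral (l + 1) (toUnit 𝔰 (D.step γ t₁)) := by
  classical
  obtain ⟨L, hL, hE⟩ := hasPathProduct_iff.1 hp (l + 1)
  obtain ⟨ts, hts, hE'⟩ := hL.exists_times hγ
  have hprod := hE.trans hE'
  by_cases hmem : t₁ ∈ ts
  swap
  · have h : D.step γ t₁ ∈ Gtail 𝔰 (l + 1) := by
      by_contra h
      exact hmem (hts.mem_of_notMem t₁ ht₁ h)
    refine (OneUnit.isIntegral_one (𝔰 := 𝔰) (l + 1)).congr ?_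
    rw [← map_one (toUnit 𝔰)]
    exact eqMod_iff_agree.1 (eqMod_one_iff.2 h).symm
  have hstep : ∀ t ∈ Set.Icc (0 : ℝ) 1, ∀ i, γ t ∈ (D.wall i).support →
      D.total (γ t) ∈ LieHat.par 𝔰 (D.wall i).normal.1 := fun t ht i hi =>
    total_mem_par fun j hj => normal_eq (hγ.avoids t ht) hj hi
  have hstep0 : ∀ t, γ t ∉ D.Supp → D.step γ t = 1 := fun t ht => by
    rw [step, total_eq_zero ht, ← mk_zero, LieHat.signed]
    simp
  have hint : ∀ t ∈ ts, OneUnit.IsIntegral l (toUnit 𝔰 (D.step γ t)) := by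
    intro t ht
    have htI := hts.mem_Icc t ht
    by_cases hS : γ t ∈ D.Supp
    · obtain ⟨i, hi⟩ := Set.mem_iUnion.1 hS
      exact (isIntegral_signed (hstep t htI i hi) _).2 (hl _ (hγ.avoids t htI))
    · rw [hstep0 t hS, map_one]
      exact OneUnit.isIntegral_one l
  intro φ m hm
  -- Only coefficients at multiples of `n` can be nonzero in the cocycle at `t₁`.
  by_cases hmn : ∃ j : ℕ, m = j • n.1
  swap
  · by_contra hne
    refine hmn (OneUnit.defect_mem_par h1 φ m fun h => hne ?_)
    have : (OneUnit.defect φ (toUnit 𝔰 (D.step γ t₁))).1.coeff m = 0 := h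
    rw [this]
    exact intRing.zero_mem
  by_cases hm0 : m = 0
  · rw [hm0, (OneUnit.defect φ _).2]
    exact intRing.one_mem
  set f : ℝ → K := fun t => (OneUnit.defect φ (toUnit 𝔰 (D.step γ t))).1.coeff m
  -- All crossings are integral up to degree `l`, so the next coefficients add up, modulo integral
  -- elements, to that of the trivial total product.
  have hsum : (ts.map f).sum ∈ intRing := by
    have h2 := (OneUnit.isIntegral_list_prod (ts.map fun t => toUnit 𝔰 (D.step γ t))
      (fun u hu => by
        obtain ⟨t, ht, rfl⟩ := List.mem_map.1 hu
        exact hint t ht) φ hm).2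
    have h3 : (ts.map fun t => toUnit 𝔰 (D.step γ t)).prod =
        toUnit 𝔰 (ts.map (D.step γ)).prod := by
      rw [map_list_prod, List.map_map]
      rfl
    have h4 : (OneUnit.defect φ (toUnit 𝔰 (ts.map (D.step γ)).prod)).1.coeff m ∈ intRing := by
      rw [← OneUnit.defect_agree (eqMod_iff_agree.1 hprod) φ m (by omega), map_one,
        OneUnit.defect_one]
      exact OneUnit.coeff_one_mem m
    rw [h3, List.map_map] at h2
    have h5 := intRing.sub_mem h4 h2
    rwa [sub_sub_cancel] at h5
  have hother : ∀ t ∈ ts.toFinset.erase t₁, f t ∈ intRing := by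
    intro t ht'
    obtain ⟨hne, hts'⟩ := Finset.mem_erase.1 ht'
    have htI := hts.mem_Icc t (List.mem_toFinset.1 hts')
    by_cases hperp : γ t ∈ perp n.1
    · rw [(ht t htI hperp).resolve_right hne]
      exact h0 φ m hm
    by_cases hS : γ t ∈ D.Supp
    · obtain ⟨i, hi⟩ := Set.mem_iUnion.1 hS
      suffices h : f t = 0 by
        rw [h]
        exact intRing.zero_mem
      by_contra h
      obtain ⟨j, hj⟩ := hmn
      -- A crossing of another hyperplane has coefficients only along another primitive ray, hence
      -- none at `m`.
      obtain ⟨j', hj'⟩ := OneUnit.defect_mem_par (signed_mem_par (hstep t htI i hi) (deriv γ t)) φ m h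
      refine hperp ?_
      rw [hn.eq_of_nsmul (D.wall i).normal_primitive (m := ⟨m, hm0⟩) hj hj']
      exact mem_perp.2 ((D.wall i).support_perp _ hi)
    · change (OneUnit.defect φ (toUnit 𝔰 (D.step γ t))).1.coeff m ∈ intRing
      rw [hstep0 t hS, map_one, OneUnit.defect_one]
      exact OneUnit.coeff_one_mem m
  rw [← List.sum_toFinset f (hts.sorted.imp ne_of_gt),
    ← Finset.add_sum_erase _ _ (List.mem_toFinset.2 hmem)] at hsum
  have := intRing.sub_mem hsum (intRing.sum_mem hother)
  rwa [add_sub_cancel_right] at this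

/-- All wall elements of a quantum cluster scattering diagram are integral. -/
theorem IsQCSD.isIntegral (hD : D.IsQCSD) (l : ℕ) {z : MR r} (hz : z ∉ D.Sing) :
    OneUnit.IsIntegral l (toUnit 𝔰 ⟨D.total z⟩) := by
  induction l generalizing z with
  | zero => exact OneUnit.isIntegral_zero _
  | succ l ih =>
    by_cases hS : z ∈ D.Supp
    swap
    · rw [total_eq_zero hS]
      exact isIntegral_mk_zero _
    obtain ⟨i, hi⟩ := Set.mem_iUnion.1 hS
    have hpar := total_mem_par fun j hj => normal_eq hz hj hi
    have hn := (D.wall i).normal_primitive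
    have hzp := mem_perp.2 ((D.wall i).support_perp z hi)
    -- The reference point in the same hyperplane, already known to be integral in degree `l + 1`;
    -- the loop through it transfers this to `z`.
    obtain ⟨z₀, hz₀, hzs₀, hint⟩ := exists_isIntegral_total hD hn (l + 1)
    obtain ⟨γ, hγ, hclosed, e0, e1, ht⟩ := exists_loop hzp hz₀ hz hzs₀
    have hpar1 : (D.step γ (3 / 4)).log ∈ LieHat.par 𝔰 (D.wall i).normal.1 := by
      rw [step, e1]
      exact signed_mem_par hpar _
    have h := isIntegral_step hγ (hD.1 γ hγ hclosed) (fun z hz => ih hz) hn (t₀ := 1 / 4)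
      (t₁ := 3 / 4) (by norm_num) ht ?_ hpar1
    · rw [step, e1] at h
      exact (isIntegral_signed hpar _).1 h
    · rw [step, e0]
      by_cases hS₀ : z₀ ∈ D.Supp
      · obtain ⟨j, hj⟩ := Set.mem_iUnion.1 hS₀
        exact (isIntegral_signed (total_mem_par fun k hk => normal_eq hzs₀ hk hj) _).2 hint
      · rw [total_eq_zero hS₀, LieHat.signed]
        simpa using isIntegral_mk_zero _

end ScatteringDiagram

/-! ### The equivalent scattering diagram -/

open Classical in
/-- The Möbius inverse of a function of finite sets. -/
def mobius {α A : Type*} [AddCommGroup A] (f : Finset α → A) (T : Finset α) : A :=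
  f T - ∑ S : {S // S ∈ T.powerset.filter (· ≠ T)}, mobius f S.1
  termination_by T.card
  decreasing_by
    have h := Finset.mem_filter.1 S.2
    exact Finset.card_lt_card ((Finset.mem_powerset.1 h.1).ssubset_of_ne h.2)

lemma sum_mobius {α A : Type*} [AddCommGroup A] (f : Finset α → A) (T : Finset α) :
    ∑ S ∈ T.powerset, mobius f S = f T := by
  classical
  have h : mobius f T = f T - ∑ S ∈ T.powerset.filter (· ≠ T), mobius f S := by
    rw [mobius, Finset.sum_coe_sort (T.powerset.filter (· ≠ T)) (mobius f)]
  rw [← Finset.sum_filter_add_sum_filter_not _ (· ≠ T)]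
  have h2 : T.powerset.filter (fun S => ¬ S ≠ T) = {T} := by
    ext S
    simp only [Finset.mem_filter, Finset.mem_powerset, not_not, Finset.mem_singleton]
    exact ⟨fun h => h.2, fun h => ⟨h.subset, h⟩⟩
  rw [h2, Finset.sum_singleton, h]
  abel

namespace StructureGroup

variable {𝔰 : Seed Γ}

lemma dilogComb_sum {ι : Type*} (s : Finset ι) (m : NPlus r) (c : ι → ℤ →₀ ℤ) :
    dilogComb 𝔰 m (∑ i ∈ s, c i) = ∑ i ∈ s, dilogComb 𝔰 m (c i) := by
  classical
  induction s using Finset.induction_on with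
  | empty => simp [dilogComb]
  | insert i s hi ih =>
    rw [Finset.sum_insert hi, Finset.sum_insert hi, ← ih]
    exact Finsupp.sum_add_index' (fun _ => zero_smul _ _) fun _ _ _ => add_smul _ _ _

lemma dilogComb_apply_of_subset {m : NPlus r} {c : ℤ →₀ ℤ} {B : Finset ℤ} (h : c.support ⊆ B)
    (m' : NPlus r) : dilogComb 𝔰 m c m' = ∑ b ∈ B, (c b : K) * dilogLog 𝔰 m b m' := by
  rw [dilogComb_apply]
  exact Finsupp.sum_of_support_subset _ h _ fun b _ => by rw [Int.cast_zero, zero_mul]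

lemma dilogLog_eq_zero_of_deg_lt (m : NPlus r) (b : ℤ) {m' : NPlus r} (h : deg m'.1 < deg m.1) :
    dilogLog 𝔰 m b m' = 0 := by
  refine dilogLog_eq_zero m b fun j hj h' => ?_
  rw [h', deg_nsmul] at h
  have := Nat.le_mul_of_pos_left (deg m.1) hj
  omega

end StructureGroup

namespace ScatteringDiagram

open StructureGroup

variable {𝔰 : Seed Γ}

/-! ### Exponents as functions of the set of supports through a point -/

open Classical in
/-- The supports of the walls with normal vector `n` that are nontrivial in `G^{≤l}`. -/
def cones (D : ScatteringDiagram 𝔰) (n : NPlus r) (l : ℕ) : Finset (PointedCone ℝ (MR r)) :=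
  ((D.finite l).toFinset.filter fun i => (D.wall i).normal = n).image fun i => (D.wall i).support

/-- Those among the supports that contain `z`. -/
def conesAt (D : ScatteringDiagram 𝔰) (n : NPlus r) (l : ℕ) (z : MR r) :
    Finset (PointedCone ℝ (MR r)) :=
  letI := Classical.decPred fun C : PointedCone ℝ (MR r) => z ∈ C
  (D.cones n l).filter fun C => z ∈ C

open Classical in
/-- The exponents of `n.mult j` at the points whose set of supports is `S`. -/
def exponentsOn (D : ScatteringDiagram 𝔰) (n : NPlus r) (j : ℕ)
    (S : Finset (PointedCone ℝ (MR r))) : ℤ →₀ ℤ :=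
  if h : S.Nonempty ∧ ∃ z, z ∉ D.Sing ∧ D.conesAt n (deg (n.mult j).1) z = S then
    exponents n (D.total h.2.choose) j else 0

open Classical in
/-- The exponents of the elements of the walls supported on the intersection of `T`. -/
def wallExponents (D : ScatteringDiagram 𝔰) (n : NPlus r) (j : ℕ)
    (T : Finset (PointedCone ℝ (MR r))) : ℤ →₀ ℤ :=
  if T ⊆ D.cones n (deg (n.mult j).1) then mobius (D.exponentsOn n j) T else 0

variable {D : ScatteringDiagram 𝔰}

lemma mem_cones {n : NPlus r} {l : ℕ} {C : PointedCone ℝ (MR r)} : C ∈ D.cones n l ↔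
    ∃ i, (D.wall i).elt ∉ Gtail 𝔰 l ∧ (D.wall i).normal = n ∧ (D.wall i).support = C := by
  simp [cones, and_assoc]

lemma mem_conesAt {n : NPlus r} {l : ℕ} {z : MR r} {C : PointedCone ℝ (MR r)} :
    C ∈ D.conesAt n l z ↔ C ∈ D.cones n l ∧ z ∈ C :=
  @Finset.mem_filter _ _ (Classical.decPred _) _ _

lemma cones_mono (n : NPlus r) {l l' : ℕ} (h : l ≤ l') : D.cones n l ⊆ D.cones n l' := by
  intro C hC
  obtain ⟨i, h1, h2⟩ := mem_cones.1 hC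
  exact mem_cones.2 ⟨i, fun h' => h1 (Gtail_anti h h'), h2⟩

lemma exists_wall_of_mem_conesAt {n : NPlus r} {l : ℕ} {z : MR r} {C : PointedCone ℝ (MR r)}
    (h : C ∈ D.conesAt n l z) :
    ∃ i, z ∈ (D.wall i).support ∧ (D.wall i).normal = n := by
  obtain ⟨h1, hz⟩ := mem_conesAt.1 h
  obtain ⟨i, -, hn, rfl⟩ := mem_cones.1 h1
  exact ⟨i, hz, hn⟩

/-- A visible wall with normal `n` passes through a point exactly when its support is among the
recorded cones. This makes the exponents a function of a finite set, as Möbius inversion requires.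
-/
lemma total_eq_of_conesAt_eq {n : NPlus r} {l : ℕ} {z z' : MR r}
    (hz : ∀ i, z ∈ (D.wall i).support → (D.wall i).normal = n)
    (hz' : ∀ i, z' ∈ (D.wall i).support → (D.wall i).normal = n)
    (h : D.conesAt n l z = D.conesAt n l z') {m : NPlus r} (hm : deg m.1 ≤ l) :
    D.total z m = D.total z' m := by
  obtain ⟨s, hs⟩ := D.exists_finset z l
  rw [total_apply hm hs, total_apply hm]
  have key : ∀ z z', (∀ i, z ∈ (D.wall i).support → (D.wall i).normal = n) →
      D.conesAt n l z = D.conesAt n l z' → ∀ i, z ∈ (D.wall i).support →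
      (D.wall i).elt ∉ Gtail 𝔰 l → z' ∈ (D.wall i).support := by
    intro z z' hz h i hi hl
    have h1 : (D.wall i).support ∈ D.conesAt n l z :=
      mem_conesAt.2 ⟨mem_cones.2 ⟨i, hl, hz i hi, rfl⟩, hi⟩
    rw [h] at h1
    exact (mem_conesAt.1 h1).2
  intro i
  rw [hs]
  exact ⟨fun h1 => ⟨key z z' hz h i h1.1 h1.2, h1.2⟩,
    fun h1 => ⟨key z' z hz' h.symm i h1.1 h1.2, h1.2⟩⟩

/-- The representative chosen in `exponentsOn` is immaterial, because the coefficients involved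
agree at all points with the same supports. With no supports the relevant coefficients vanish,
matching the default value. -/
lemma exponentsOn_conesAt {n : NPlus r} (j : ℕ) {z : MR r} (hz : z ∉ D.Sing)
    (hzn : ∀ i, z ∈ (D.wall i).support → (D.wall i).normal = n) :
    D.exponentsOn n j (D.conesAt n (deg (n.mult j).1) z) = exponents n (D.total z) j := by
  have hdeg : ∀ i ≤ j, deg (n.mult i).1 ≤ deg (n.mult j).1 := fun i hi =>
    (NPlus.deg_mult_le (n := n)).2 hi
  by_cases hS : (D.conesAt n (deg (n.mult j).1) z).Nonempty
  · have h : (D.conesAt n (deg (n.mult j).1) z).Nonempty ∧ ∃ z', z' ∉ D.Sing ∧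
        D.conesAt n (deg (n.mult j).1) z' = D.conesAt n (deg (n.mult j).1) z := ⟨hS, z, hz, rfl⟩
    rw [exponentsOn, dif_pos h]
    obtain ⟨h1, h2⟩ := h.2.choose_spec
    refine exponents_congr n j fun i hi => total_eq_of_conesAt_eq (fun k hk => ?_) hzn h2 (hdeg i hi)
    obtain ⟨C, hC⟩ := hS
    rw [← h2] at hC
    obtain ⟨i', hi', hn'⟩ := exists_wall_of_mem_conesAt hC
    rw [← hn']
    exact normal_eq h1 hk hi'
  · rw [exponentsOn, dif_neg fun h => hS h.1, ← exponents_zero (𝔰 := 𝔰) n j]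
    refine (exponents_congr n j fun i hi => ?_).symm
    obtain ⟨s, hs⟩ := D.exists_finset z (deg (n.mult j).1)
    rw [total_apply (hdeg i hi) hs, LieHat.zero_apply]
    refine Finset.sum_eq_zero fun k hk => absurd ?_ hS
    obtain ⟨h1, h2⟩ := (hs k).1 hk
    exact ⟨_, mem_conesAt.2 ⟨mem_cones.2 ⟨k, h2, hzn k h1, rfl⟩, h1⟩⟩

/-- The empty intersection is the whole space and carries no wall, so its exponents must vanish. -/
lemma wallExponents_empty (n : NPlus r) (j : ℕ) : D.wallExponents n j ∅ = 0 := by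
  have h := sum_mobius (D.exponentsOn n j) ∅
  rw [Finset.powerset_empty, Finset.sum_singleton, exponentsOn, dif_neg (by simp)] at h
  rw [wallExponents, h, ite_self]

/-- Möbius inversion. Raising the level from `j` to `k` adds cones, but sets containing a cone not
yet visible at level `j` have zero exponents by the cut-off in `wallExponents`. -/
lemma sum_wallExponents {n : NPlus r} {j k : ℕ} (hjk : j ≤ k) {z : MR r} (hz : z ∉ D.Sing)
    (hzn : ∀ i, z ∈ (D.wall i).support → (D.wall i).normal = n) :
    ∑ T ∈ (D.conesAt n (deg (n.mult k).1) z).powerset, D.wallExponents n j T =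
      exponents n (D.total z) j := by
  rw [← exponentsOn_conesAt j hz hzn, ← sum_mobius (D.exponentsOn n j)]
  have hle := cones_mono (D := D) n ((NPlus.deg_mult_le (n := n)).2 hjk)
  have hsub : D.conesAt n (deg (n.mult j).1) z ⊆ D.conesAt n (deg (n.mult k).1) z := fun C hC =>
    mem_conesAt.2 ⟨hle (mem_conesAt.1 hC).1, (mem_conesAt.1 hC).2⟩
  rw [← Finset.sum_subset (Finset.powerset_mono.2 hsub)]
  · refine Finset.sum_congr rfl fun T hT => if_pos fun C hC => ?_
    exact (mem_conesAt.1 (Finset.mem_powerset.1 hT hC)).1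
  · intro T hT hT'
    refine if_neg fun h => hT' (Finset.mem_powerset.2 fun C hC => ?_)
    exact mem_conesAt.2 ⟨h hC, (mem_conesAt.1 (Finset.mem_powerset.1 hT hC)).2⟩

/-! ### The diagram of quantum dilogarithm walls -/

/-- Indices of the walls of the new scattering diagram: the wall `(T, n, j, b)` has normal vector
`n` and is supported on the intersection of the set `T` of supports of walls with normal vector `n`;
its element is a power of `Ψ_{1/δ(m), b/δ₀}[m]`, `m = (j + 1) n`. -/
abbrev DilogIndex (D : ScatteringDiagram 𝔰) : Type :=
  {x : Finset (PointedCone ℝ (MR r)) × NPlus r × ℕ × ℤ // x.1.Nonempty ∧ IsPrimitive x.2.1 ∧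
    (∀ C ∈ x.1, ∃ i, (D.wall i).normal = x.2.1 ∧ (D.wall i).support = C) ∧
    coneDim (x.1.inf id) + 1 = r}

lemma mem_inf {T : Finset (PointedCone ℝ (MR r))} {z : MR r} :
    z ∈ T.inf id ↔ ∀ C ∈ T, z ∈ C := by
  rw [Submodule.mem_finsetInf]
  rfl

/-- The wall with the given index. -/
def dilogWall (D : ScatteringDiagram 𝔰) (x : D.DilogIndex) : Wall 𝔰 where
  normal := x.1.2.1
  support := x.1.1.inf id
  elt := (dilog 𝔰 (1 / Γ.normFactor (x.1.2.1.mult x.1.2.2.1).1) (x.1.2.2.2 / Γ.δ₀)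
    (x.1.2.1.mult x.1.2.2.1)).power (D.wallExponents x.1.2.1 x.1.2.2.1 x.1.1 x.1.2.2.2 : K)
  normal_primitive := x.2.2.1
  support_rational := IsRationalCone.finset_inf x.2.1 fun C hC => by
    obtain ⟨i, -, rfl⟩ := x.2.2.2.1 C hC
    exact (D.wall i).support_rational
  support_perp z hz := by
    obtain ⟨C, hC⟩ := x.2.1
    obtain ⟨i, hn, rfl⟩ := x.2.2.2.1 C hC
    rw [← hn]
    exact (D.wall i).support_perp z (mem_inf.1 hz _ hC)
  support_codim := x.2.2.2.2
  elt_mem := (LieHat.par 𝔰 x.1.2.1.1).smul_mem _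
    (par_mult_le x.1.2.1 x.1.2.2.1 (dilogLog_mem_par _ x.1.2.2.2))

lemma dilogWall_log (x : D.DilogIndex) (m : NPlus r) : (D.dilogWall x).elt.log m =
    (D.wallExponents x.1.2.1 x.1.2.2.1 x.1.1 x.1.2.2.2 : K) *
      dilogLog 𝔰 (x.1.2.1.mult x.1.2.2.1) x.1.2.2.2 m := rfl

lemma finite_deg_le (l : ℕ) : {n : NPlus r | deg n.1 ≤ l}.Finite := by
  have h : {a : Expo r | deg a ≤ l}.Finite := by
    refine Set.Finite.subset (Set.finite_Iic (Finsupp.equivFunOnFinite.symm fun _ => l)) ?_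
    intro a ha i
    exact (Finset.single_le_sum (f := fun i => a i) (fun _ _ => Nat.zero_le _)
      (Finset.mem_univ i)).trans ha
  exact h.preimage Subtype.val_injective.injOn

lemma exists_of_log_ne_zero {x : D.DilogIndex} {m : NPlus r} (h : (D.dilogWall x).elt.log m ≠ 0) :
    deg (x.1.2.1.mult x.1.2.2.1).1 ≤ deg m.1 ∧
      x.1.1 ⊆ D.cones x.1.2.1 (deg (x.1.2.1.mult x.1.2.2.1).1) ∧
      x.1.2.2.2 ∈ (D.wallExponents x.1.2.1 x.1.2.2.1 x.1.1).support := by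
  rw [dilogWall_log] at h
  have h1 := left_ne_zero_of_mul h
  have h2 := right_ne_zero_of_mul h
  have h1' : D.wallExponents x.1.2.1 x.1.2.2.1 x.1.1 x.1.2.2.2 ≠ 0 := fun h0 => h1 (by
    rw [h0, Int.cast_zero])
  refine ⟨?_, ?_, Finsupp.mem_support_iff.2 h1'⟩
  · by_contra hlt
    exact h2 (dilogLog_eq_zero_of_deg_lt _ _ (not_le.1 hlt))
  · by_contra hsub
    rw [wallExponents, if_neg hsub] at h1'
    exact h1' rfl

/-- A bound on the degree leaves finitely many `n` and `j`; then `T` consists of finitely many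
visible cones, and `b` lies in a finite support of exponents. -/
lemma finite_dilogWall (D : ScatteringDiagram 𝔰) (l : ℕ) :
    {x | (D.dilogWall x).elt ∉ Gtail 𝔰 l}.Finite := by
  set F : NPlus r → ℕ → Set (Finset (PointedCone ℝ (MR r)) × NPlus r × ℕ × ℤ) := fun n j =>
    ⋃ T ∈ (D.cones n (deg (n.mult j).1)).powerset,
      (fun b => (T, n, j, b)) '' ((D.wallExponents n j T).support : Set ℤ)
  have hF : ∀ n j, (F n j).Finite := fun n j =>
    Set.Finite.biUnion (Finset.finite_toSet _) fun T _ => (Finset.finite_toSet _).image _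
  have h : (⋃ n ∈ {n : NPlus r | deg n.1 ≤ l}, ⋃ j ∈ Set.Iic l, F n j).Finite :=
    (finite_deg_le l).biUnion fun n _ => (Set.finite_Iic l).biUnion fun j _ => hF n j
  refine Set.Finite.subset (h.preimage (Subtype.val_injective.injOn)) ?_
  rintro ⟨⟨T, n, j, b⟩, hx⟩ hmem
  obtain ⟨m, hm, hne⟩ : ∃ m : NPlus r, deg m.1 ≤ l ∧
      (D.dilogWall ⟨⟨T, n, j, b⟩, hx⟩).elt.log m ≠ 0 := by
    by_contra! hcon
    exact hmem fun m hm => hcon m hm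
  obtain ⟨h1, h2, h3⟩ := exists_of_log_ne_zero hne
  have h4 : (j + 1) * deg n.1 ≤ l := by
    rw [← deg_nsmul]
    exact h1.trans hm
  have h5 := deg_pos n.2
  refine Set.mem_iUnion₂.2 ⟨n, ?_, Set.mem_iUnion₂.2 ⟨j, ?_, Set.mem_iUnion₂.2
    ⟨T, Finset.mem_powerset.2 h2, b, h3, rfl⟩⟩⟩
  · exact (Nat.le_mul_of_pos_left _ (Nat.succ_pos j)).trans h4
  · have := (Nat.le_mul_of_pos_right (j + 1) h5).trans h4
    exact Set.mem_Iic.2 (by omega)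

/-- The scattering diagram whose wall elements are powers of quantum dilogarithms. -/
def dilogDiagram (D : ScatteringDiagram 𝔰) : ScatteringDiagram 𝔰 where
  Index := D.DilogIndex
  wall := D.dilogWall
  finite := D.finite_dilogWall

/-- Singletons `T` retain every old support, even if the new element there is trivial. Hence the old
support and singular locus lie in the new ones, and a curve admissible for the new diagram is
admissible for the old one. -/
lemma exists_dilogWall (D : ScatteringDiagram 𝔰) (i : D.Index) : ∃ x : D.dilogDiagram.Index,
    (D.dilogDiagram.wall x).normal = (D.wall i).normal ∧
      (D.dilogDiagram.wall x).support = (D.wall i).support := by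
  refine ⟨⟨({(D.wall i).support}, (D.wall i).normal, 0, 0), Finset.singleton_nonempty _,
    (D.wall i).normal_primitive, fun C hC => ⟨i, rfl, (Finset.mem_singleton.1 hC).symm⟩, ?_⟩, rfl,
    Finset.inf_singleton⟩
  rw [Finset.inf_singleton]
  exact (D.wall i).support_codim

lemma supp_subset_dilogDiagram (D : ScatteringDiagram 𝔰) : D.Supp ⊆ D.dilogDiagram.Supp := by
  intro z hz
  obtain ⟨i, hi⟩ := Set.mem_iUnion.1 hz
  obtain ⟨x, -, hx⟩ := D.exists_dilogWall i
  exact Set.mem_iUnion.2 ⟨x, by rw [hx]; exact hi⟩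

lemma sing_subset_dilogDiagram (D : ScatteringDiagram 𝔰) : D.Sing ⊆ D.dilogDiagram.Sing := by
  rintro z (hz | ⟨i, j, hd, hi, hj⟩)
  · obtain ⟨i, hi⟩ := Set.mem_iUnion.1 hz
    obtain ⟨x, -, hx⟩ := D.exists_dilogWall i
    exact Or.inl (Set.mem_iUnion.2 ⟨x, by rw [hx]; exact hi⟩)
  · obtain ⟨x, -, hx⟩ := D.exists_dilogWall i
    obtain ⟨y, -, hy⟩ := D.exists_dilogWall j
    exact Or.inr ⟨x, y, by rw [hx, hy]; exact hd, by rw [hx]; exact hi, by rw [hy]; exact hj⟩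

lemma IsAdmissible.of_dilogDiagram {γ : ℝ → MR r} (hγ : D.dilogDiagram.IsAdmissible γ) :
    D.IsAdmissible γ where
  smooth := hγ.smooth
  source h := hγ.source (D.supp_subset_dilogDiagram h)
  target h := hγ.target (D.supp_subset_dilogDiagram h)
  transversal t ht i hi := by
    obtain ⟨x, hn, hx⟩ := D.exists_dilogWall i
    rw [← hn]
    exact hγ.transversal t ht x (by rw [hx]; exact hi)
  avoids t ht h := hγ.avoids t ht (D.sing_subset_dilogDiagram h)

/-- Near a nonsingular point each cone fills `n^⊥`, and so does a finite intersection. Thus no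
intersection needed at such a point is lost by the dimension condition on the indices. -/
lemma coneDim_inf_add_one {n : NPlus r} {z : MR r} (hz : z ∉ D.Sing)
    {T : Finset (PointedCone ℝ (MR r))} (hT : T.Nonempty)
    (h : ∀ C ∈ T, z ∈ C ∧ ∃ i, (D.wall i).normal = n ∧ (D.wall i).support = C) :
    coneDim (T.inf id) + 1 = r := by
  have hperp : ∀ x ∈ T.inf id, x ∈ perp n.1 := by
    intro x hx
    obtain ⟨C, hC⟩ := hT
    obtain ⟨-, i, hn, rfl⟩ := h C hC
    rw [← hn]
    exact mem_perp.2 ((D.wall i).support_perp x (mem_inf.1 hx _ hC))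
  have hU : ∀ C : PointedCone ℝ (MR r), ∃ U : Set (MR r), C ∈ T → IsOpen U ∧ z ∈ U ∧
      ∀ x ∈ U, x ∈ perp n.1 → x ∈ C := by
    intro C
    by_cases hC : C ∈ T
    · obtain ⟨hzC, i, hn, rfl⟩ := h C hC
      obtain ⟨U, hU⟩ := exists_isOpen hz hzC
      exact ⟨U, fun _ => hn ▸ hU⟩
    · exact ⟨∅, fun h => absurd h hC⟩
  choose U hU using hU
  have hzT : z ∈ T.inf id := mem_inf.2 fun C hC => (h C hC).1
  rw [coneDim_eq_of_isOpen hperp (U := ⋂ C ∈ T, U C)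
    (isOpen_biInter_finset fun C hC => (hU C hC).1)
    (Set.mem_iInter₂.2 fun C hC => (hU C hC).2.1) (hperp z hzT) fun x hx hxp =>
      mem_inf.2 fun C hC => (hU C hC).2.2 x (Set.mem_iInter₂.1 hx C hC) hxp]
  exact finrank_perp n

/-- The contributing walls through `z` are indexed by the sets `T` of supports through `z`; summing
their exponents over `T` undoes the Möbius inversion. -/
lemma total_dilogDiagram_mult {n : NPlus r} (hn : IsPrimitive n) {z : MR r} (hz : z ∉ D.Sing)
    (hzn : ∀ i, z ∈ (D.wall i).support → (D.wall i).normal = n) (k : ℕ) :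
    D.dilogDiagram.total z (n.mult k) = ∑ j ∈ Finset.range (k + 1),
      dilogComb 𝔰 (n.mult j) (exponents n (D.total z) j) (n.mult k) := by
  classical
  set S := D.conesAt n (deg (n.mult k).1) z
  set B : Finset ℤ := (S.powerset ×ˢ Finset.range (k + 1)).biUnion fun p =>
    (D.wallExponents n p.2 p.1).support
  set F : Finset (PointedCone ℝ (MR r)) × NPlus r × ℕ × ℤ → K := fun x =>
    (D.wallExponents x.2.1 x.2.2.1 x.1 x.2.2.2 : K) * dilogLog 𝔰 (x.2.1.mult x.2.2.1) x.2.2.2 (n.mult k)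
  set s : Finset (Finset (PointedCone ℝ (MR r)) × NPlus r × ℕ × ℤ) :=
    S.powerset ×ˢ {n} ×ˢ Finset.range (k + 1) ×ˢ B
  have h1 : D.dilogDiagram.total z (n.mult k) = ∑ x ∈ s, F x := by
    have e : D.dilogDiagram.total z (n.mult k) =
        ∑ᶠ x ∈ {x : D.DilogIndex | z ∈ x.1.1.inf id}, F x.1 := rfl
    rw [e, ← finsum_mem_image Subtype.val_injective.injOn]
    refine finsum_mem_eq_sum_of_inter_support_eq _ ?_
    ext x
    constructor
    · rintro ⟨⟨x, hx, rfl⟩, hF⟩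
      refine ⟨?_, hF⟩
      obtain ⟨h2, h3, h4⟩ := exists_of_log_ne_zero (x := x) (m := n.mult k) hF
      have hx1 : x.1.2.1 = n := by
        obtain ⟨C, hC⟩ := x.2.1
        obtain ⟨i, hi, rfl⟩ := x.2.2.2.1 C hC
        rw [← hi]
        exact hzn i (mem_inf.1 hx _ hC)
      rw [hx1] at h2 h3 h4
      have hj := (NPlus.deg_mult_le (n := n)).1 h2
      have hS : x.1.1 ∈ S.powerset := Finset.mem_powerset.2 fun C hC =>
        mem_conesAt.2 ⟨cones_mono n h2 (h3 hC), mem_inf.1 hx C hC⟩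
      have hj' : x.1.2.2.1 ∈ Finset.range (k + 1) := Finset.mem_range.2 (by omega)
      refine Finset.mem_coe.2 (Finset.mem_product.2 ⟨hS, Finset.mem_product.2
        ⟨Finset.mem_singleton.2 hx1, Finset.mem_product.2 ⟨hj', ?_⟩⟩⟩)
      exact Finset.mem_biUnion.2 ⟨(x.1.1, x.1.2.2.1), Finset.mem_product.2 ⟨hS, hj'⟩, h4⟩
    -- Conversely, a nonzero term comes from an actual wall: `T` is nonempty because the empty set
    -- has zero exponents, and its intersection has the right dimension.
    · rintro ⟨hx, hF⟩
      refine ⟨?_, hF⟩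
      obtain ⟨T, n', j, b⟩ := x
      simp only [s, Finset.mem_coe, Finset.mem_product, Finset.mem_powerset,
        Finset.mem_singleton] at hx
      obtain ⟨hT, rfl, -, -⟩ := hx
      have hTne : T.Nonempty := by
        rw [Finset.nonempty_iff_ne_empty]
        rintro rfl
        refine hF ?_
        simp only [F, wallExponents_empty, Finsupp.zero_apply, Int.cast_zero, zero_mul]
      have hwall : ∀ C ∈ T, z ∈ C ∧ ∃ i, (D.wall i).normal = n' ∧ (D.wall i).support = C := by
        intro C hC
        obtain ⟨hC1, hzC⟩ := mem_conesAt.1 (hT hC)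
        obtain ⟨i, -, hi⟩ := mem_cones.1 hC1
        exact ⟨hzC, i, hi⟩
      exact ⟨⟨(T, n', j, b), hTne, hn, fun C hC => (hwall C hC).2,
        coneDim_inf_add_one hz hTne hwall⟩, mem_inf.2 fun C hC => (hwall C hC).1, rfl⟩
  have h2 : ∑ x ∈ s, F x = ∑ j ∈ Finset.range (k + 1), ∑ T ∈ S.powerset, ∑ b ∈ B,
      F (T, n, j, b) := by
    simp only [s]
    rw [Finset.sum_product, Finset.sum_congr rfl fun T _ => Finset.sum_product _ _ _]
    simp only [Finset.sum_singleton]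
    rw [Finset.sum_congr rfl fun T _ => Finset.sum_product _ _ _, Finset.sum_comm]
  rw [h1, h2]
  refine Finset.sum_congr rfl fun j hj => ?_
  rw [← sum_wallExponents (Nat.lt_succ_iff.1 (Finset.mem_range.1 hj)) hz hzn, dilogComb_sum,
    LieHat.sum_apply]
  refine Finset.sum_congr rfl fun T hT => ?_
  have hB : (D.wallExponents n j T).support ⊆ B := fun b hb =>
    Finset.mem_biUnion.2 ⟨(T, j), Finset.mem_product.2 ⟨hT, hj⟩, hb⟩
  rw [dilogComb_apply_of_subset hB]

lemma IsQCSD.total_dilogDiagram (hD : D.IsQCSD) {z : MR r} (hz : z ∉ D.Sing) :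
    D.dilogDiagram.total z = D.total z := by
  have hwall : ∀ x, z ∈ (D.dilogDiagram.wall x).support →
      ∃ i, z ∈ (D.wall i).support ∧ (D.wall i).normal = (D.dilogDiagram.wall x).normal := by
    intro x hx
    obtain ⟨C, hC⟩ := x.2.1
    obtain ⟨i, hi, rfl⟩ := x.2.2.2.1 C hC
    exact ⟨i, mem_inf.1 hx _ hC, hi⟩
  by_cases hS : z ∈ D.Supp
  swap
  · rw [total_eq_zero hS, total_eq_zero]
    intro h
    obtain ⟨x, hx⟩ := Set.mem_iUnion.1 h
    obtain ⟨i, hi, -⟩ := hwall x hx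
    exact hS (Set.mem_iUnion.2 ⟨i, hi⟩)
  obtain ⟨i, hi⟩ := Set.mem_iUnion.1 hS
  have hzn : ∀ j, z ∈ (D.wall j).support → (D.wall j).normal = (D.wall i).normal :=
    fun j hj => normal_eq hz hj hi
  have hpar := total_mem_par hzn
  have hpar' : D.dilogDiagram.total z ∈ LieHat.par 𝔰 (D.wall i).normal.1 :=
    total_mem_par fun x hx => by
      obtain ⟨j, hj, hn⟩ := hwall x hx
      rw [← hn, hzn j hj]
  funext m
  by_cases hm : ∃ j : ℕ, m.1 = j • (D.wall i).normal.1
  · obtain ⟨j, hj⟩ := hm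
    obtain ⟨k, rfl⟩ := NPlus.exists_eq_mult hj
    rw [total_dilogDiagram_mult (D.wall i).normal_primitive hz hzn k]
    exact sum_dilogComb_exponents (mem_integralPar.2 ⟨hpar, fun l => hD.isIntegral l hz⟩) k
  · have h1 : D.total z m = 0 := by
      by_contra h
      exact hm (hpar m h)
    have h2 : D.dilogDiagram.total z m = 0 := by
      by_contra h
      exact hm (hpar' m h)
    rw [h1, h2]

end ScatteringDiagram

end QCSD

end

theorem mainTheorem7 {r : ℕ} {N : Type*} [AddCommGroup N] (Γ : QCSD.FixedData r N)
    (𝔰 : QCSD.Seed Γ) (D : QCSD.ScatteringDiagram 𝔰) (hD : D.IsQCSD) :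
    ∃ D' : QCSD.ScatteringDiagram.{_, 0} 𝔰, D'.IsConsistent ∧ D.Equivalent D' ∧
      ∀ j : D'.Index, ∃ (n : QCSD.NPlus r) (d : ℚ) (b c : ℤ), 𝔰.IsNormalizationFactor n d ∧
        (D'.wall j).elt = (QCSD.StructureGroup.dilog 𝔰 (1 / d) (b / Γ.δ₀) n).power (c : QCSD.K) := by
  -- Off the old singular locus both diagrams have the same total at each point, so path-ordered
  -- products carry over from the old diagram to the new one.
  have key : ∀ γ, D.dilogDiagram.IsAdmissible γ → D.IsAdmissible γ →
      ∀ p, D.HasPathProduct γ p → D.dilogDiagram.HasPathProduct γ p := fun γ hγ' hγ p hp =>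
    hp.of_total_eq hγ hγ' fun t ht => hD.total_dilogDiagram (hγ.avoids t ht)
  refine ⟨D.dilogDiagram, fun γ hγ h => ?_, fun γ hγ hγ' => ?_, fun x => ?_⟩
  · exact key γ hγ hγ.of_dilogDiagram 1 (hD.1 γ hγ.of_dilogDiagram h)
  · obtain ⟨p, hp⟩ := hγ.exists_hasPathProduct
    exact ⟨p, hp, key γ hγ' hγ p hp⟩
  · exact ⟨_, _, _, _, 𝔰.isNormalizationFactor _, rfl⟩
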